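/- **Setting.** Let $n\ge 2$, $1\le r\le d$, and let $\|\cdot\|$ be the Frobenius norm and $\|\cdot\|_2$ the operator norm on $\mathbb R^{d\times r}$. Let $\mathrm{St}(d,r)=\{x\in\mathbb R^{d\times r}: x^\top x=I_r\}$, with tangent spaces $\mathrm T_x=\{\xi: x^\top\xi+\xi^\top x=0\}$, orthogonal projections $\mathcal P_{\mathrm T_x}(y)=y-\frac12x(x^\top y+y^\top x)$, Riemannian gradient $\mathrm{grad}f(x)=\mathcal P_{\mathrm T_x}(\nabla f(x))$ and polar retraction $\mathcal R_x(\xi)=(x+\xi)(I_r+\xi^\top\xi)^{-1/2}$. For $\mathbf x=(x_1,\dots,x_n)\in\mathrm{St}(d,r)^n$ the induced arithmetic mean is $\bar x\in\arg\min_{y\in\mathrm{St}(d,r)}\sum_i\|y-x_i\|^2$, and $\|\mathbf x-\bar{\mathbf x}\|^2=\sum_i\|x_i-\bar x\|^2$. For $\delta_1,\delta_2$ with $0<\delta_1\le\frac{\delta_2}{5\sqrt r}$ and $\delta_2\le\frac16$, the consensus region is $$\mathcal N=\{\mathbf x\in\mathrm{St}(d,r)^n:\ \|\mathbf x-\bar{\mathbf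 x}\|^2\le n\delta_1^2,\ \max_i\|x_i-\bar x\|\le\delta_2\}.$$ *Network.* $W\in\mathbb R^{n\times n}$ is symmetric and doubly stochastic with second largest singular value $\sigma_2<1$. The integer $t\ge1$ satisfies $t\ge\lceil\log_{\sigma_2}(\frac1{2\sqrt n})\rceil$ (no further condition if $\sigma_2=0$). With the eigenvalues $\lambda_1\ge\dots\ge\lambda_n$ of $W^t$ put $L_t=1-\lambda_n$, $\mu_t=1-\lambda_2$, $\gamma_t=(1-4r\delta_1^2)(1-\frac{\delta_2^2}2)\mu_t$; let $0<\alpha\le\min\{\frac{2-\delta_2^2}{2L_t},1\}$ and $\rho_t=\sqrt{1-\gamma_t\alpha}$ (then $\rho_t<1$). *Objective.* $f=\frac1n\sum_{i=1}^nf_i$, where the $f_i:\mathbb R^{d\times r}\to\mathbb R$ are differentiable, $\nabla f_i$ is $L$-Lipschitz with $L>0$, and $\|\nabla f_i(x)\|_2\le L_n$ for all $i$ and $x\in\mathrm{St}(d,r)$. Put $L_g=L+L_n$, $L_G=L+2L_n$, $f^*=\min_{\mathrm{St}(d,r)}f$. *Algorithm (DRSGD).* $\mathbf x_0\in\mathcal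 N$ is deterministic and for all $k\ge0$, $i\in[n]$ $$x_{i,k+1}=\mathcal R_{x_{i,k}}\big(-\alpha\,\mathrm{grad}\varphi_i^t(\mathbf x_k)-\beta_kv_{i,k}\big),\qquad \mathrm{grad}\varphi_i^t(\mathbf x)=\mathcal P_{\mathrm T_{x_i}}\Big(\sum_j(W^t)_{ij}(x_i-x_j)\Big).$$ The stochastic gradients $v_{i,k}$ are random matrices on a standard Borel probability space such that almost surely $v_{i,k}\in\mathrm T_{x_{i,k}}$ and $\|v_{i,k}\|\le D$ (with $D>0$), $\mathbb E[v_{i,k}\mid\mathbf x_k]=\mathrm{grad}f_i(x_{i,k})$, $v_{i,k}$ and $v_{j,k}$ are conditionally independent given $\mathbf x_k$ for $i\ne j$, and $\mathbb E\|v_{i,k}-\mathrm{grad}f_i(x_{i,k})\|^2\le\Xi^2$ (with $\Xi\ge 0$). *Stepsizes.* Let $\tilde\beta=\min\{\frac{1-\rho_t}D,\frac1{L_G}\}$ and $p\in(0,1]$. The sequence $(\beta_k)_{k\ge 0}$ is nonincreasing, satisfies $\beta_k\le\min\{\frac1{5L_g},\frac{\alpha\delta_1}{5D},\frac{(1-\rho_t)\delta_1}D\}$,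 and for constants $c_1>0$ and $c_2$ $$c_1\,\tilde\beta\,(k+1)^{-p}\le\beta_k\le c_2\,\tilde\beta\,(k+1)^{-p}\qquad(k\ge0).$$ **Theorem.** There are a constant $A>0$, depending only on $c_1,c_2$, and a constant $C>0$, depending only on $c_1,c_2,p$, an upper bound $\rho_0<1$ of $\rho_t$ and an upper bound $\kappa$ of $L_G/D$ (in particular not on $n,d,r$, and on $D$ only through $\kappa$), such that, with $\mathcal T_1=2(4\sqrt r+6\alpha)^2C^2+8$ and $\mathcal T_2=201\alpha^2C^2+9$: 1. almost surely, $\mathbf x_k\in\mathcal N$ and $\frac1n\|\mathbf x_k-\bar{\mathbf x}_k\|^2\le CD^2\beta_k^2$ for all $k\ge0$; 2. $\|\mathrm{grad}f(\bar x_k)\|^2$ is integrable for every $k\ge0$, and for every $K\ge0$ $$\min_{0\le k\le K}\mathbb E\|\mathrm{grad}f(\bar x_k)\|^2\le\frac{f(\bar x_0)-f^*+\frac{3L_g\Xi^2}{2n}\sum_{k=0}^K\beta_k^2+\big(\frac{CD^2L_g^2}2+\mathcal T_1D^4\big)\sum_{k=0}^K\beta_k^3+\mathcal T_2L_gD^4\sum_{k=0}^K\beta_k^4}{\sum_{k=0}^K\beta_k/4};$$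 3. if $p=\frac12$, then for every $K\ge1$ $$\min_{0\le k\le K}\mathbb E\|\mathrm{grad}f(\bar x_k)\|^2\le A\Big[\frac{f(\bar x_0)-f^*}{\tilde\beta\sqrt{K+1}}+\frac{L_g\Xi^2}n\cdot\frac{\tilde\beta\ln(K+1)}{\sqrt{K+1}}+\big(CD^2L_g^2+\mathcal T_1D^4\big)\frac{\tilde\beta^2}{\sqrt{K+1}}+\mathcal T_2L_gD^4\frac{\tilde\beta^3}{\sqrt{K+1}}\Big].$$ -/

import Mathlib

open MeasureTheory ProbabilityTheory
open scoped Matrix MatrixOrder Matrix.Norms.Frobenius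

/-- Real `d × r` matrices are measurable entrywise (equivalently, Borel). -/
instance matrixMeasurableSpace (d r : ℕ) : MeasurableSpace (Matrix (Fin d) (Fin r) ℝ) :=
  inferInstanceAs (MeasurableSpace (Fin d → Fin r → ℝ))

instance matrixBorelSpace (d r : ℕ) : BorelSpace (Matrix (Fin d) (Fin r) ℝ) :=
  inferInstanceAs (BorelSpace (Fin d → Fin r → ℝ))

namespace DRSGD

noncomputable section

/-! ### Geometry of the Stiefel manifold

On matrices, `‖·‖` is the Frobenius norm throughout. -/

/-- The Stiefel manifold `St(d, r)`. -/
def stiefel (d r : ℕ) : Set (Matrix (Fin d) (Fin r) ℝ) := {x | xᵀ * x = 1}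

/-- Orthogonal projection of `y` onto the tangent space of `St(d, r)` at `x`. -/
def tangentProj {d r : ℕ} (x y : Matrix (Fin d) (Fin r) ℝ) : Matrix (Fin d) (Fin r) ℝ :=
  y - (1 / 2 : ℝ) • (x * (xᵀ * y + yᵀ * x))

/-- The tangent space of `St(d, r)` at `x`. -/
def tangentSpace {d r : ℕ} (x : Matrix (Fin d) (Fin r) ℝ) : Set (Matrix (Fin d) (Fin r) ℝ) :=
  {ξ | xᵀ * ξ + ξᵀ * x = 0}

/-- The polar retraction `R_x(ξ) = (x + ξ) (I + ξᵀ ξ)^{-1/2}`. -/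
def polarRetraction {d r : ℕ} (x ξ : Matrix (Fin d) (Fin r) ℝ) : Matrix (Fin d) (Fin r) ℝ :=
  (x + ξ) * (CFC.sqrt (1 + ξᵀ * ξ))⁻¹

/-- The Euclidean gradient: the matrix of partial derivatives. -/
def euclGrad {d r : ℕ} (f : Matrix (Fin d) (Fin r) ℝ → ℝ) (x : Matrix (Fin d) (Fin r) ℝ) :
    Matrix (Fin d) (Fin r) ℝ :=
  Matrix.of fun a b => fderiv ℝ f x (Matrix.single a b 1)

/-- The Riemannian gradient on `St(d, r)` (for the metric induced by the Frobenius product). -/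
def riemGrad {d r : ℕ} (f : Matrix (Fin d) (Fin r) ℝ → ℝ) (x : Matrix (Fin d) (Fin r) ℝ) :
    Matrix (Fin d) (Fin r) ℝ :=
  tangentProj x (euclGrad f x)

/-- The spectral (operator) norm `‖·‖₂` of a matrix. -/
def opNorm {d r : ℕ} (A : Matrix (Fin d) (Fin r) ℝ) : ℝ :=
  ‖LinearMap.toContinuousLinearMap (Matrix.toEuclideanLin A)‖

/-- The global objective `f = (1/n) ∑ᵢ fᵢ`. -/
def average {n d r : ℕ} (f : Fin n → Matrix (Fin d) (Fin r) ℝ → ℝ)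
    (x : Matrix (Fin d) (Fin r) ℝ) : ℝ :=
  (1 / (n : ℝ)) * ∑ i, f i x

/-! ### Induced arithmetic mean and consensus region -/

/-- `y` is an induced arithmetic mean of `x₁, …, xₙ`: it minimizes `∑ᵢ ‖y - xᵢ‖²` on `St(d, r)`. -/
def IsIAM {n d r : ℕ} (x : Fin n → Matrix (Fin d) (Fin r) ℝ) (y : Matrix (Fin d) (Fin r) ℝ) :
    Prop :=
  y ∈ stiefel d r ∧ ∀ z ∈ stiefel d r, ∑ i, ‖y - x i‖ ^ 2 ≤ ∑ i, ‖z - x i‖ ^ 2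

/-- The induced arithmetic mean `x̄`. A minimizer exists since `St(d, r)` is compact; where it is not
unique (which never happens in the consensus region) one of the minimizers is picked. -/
def iam {n d r : ℕ} (x : Fin n → Matrix (Fin d) (Fin r) ℝ) : Matrix (Fin d) (Fin r) ℝ :=
  Classical.epsilon (IsIAM x)

/-- The squared consensus error `‖𝐱 - 𝐱̄‖_F² = ∑ᵢ ‖xᵢ - x̄‖²`. -/
def consensusErrSq {n d r : ℕ} (x : Fin n → Matrix (Fin d) (Fin r) ℝ) : ℝ :=
  ∑ i, ‖x i - iam x‖ ^ 2

/-- The consensus region `𝒩 = 𝒩₁ ∩ 𝒩₂`. -/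
def consensusRegion (n d r : ℕ) (δ₁ δ₂ : ℝ) : Set (Fin n → Matrix (Fin d) (Fin r) ℝ) :=
  {x | (∀ i, x i ∈ stiefel d r) ∧ consensusErrSq x ≤ n * δ₁ ^ 2 ∧ ∀ i, ‖x i - iam x‖ ≤ δ₂}

/-! ### Mixing matrix -/

/-- The `k`-th eigenvalue (zero-indexed, in nonincreasing order, with multiplicity) of a real
symmetric matrix. -/
def sortedEigenvalue {n : ℕ} (A : Matrix (Fin n) (Fin n) ℝ) (k : ℕ) : ℝ :=
  open Classical in
  if h : A.IsHermitian ∧ k < Fintype.card (Fin n) then h.1.eigenvalues₀ ⟨k, h.2⟩ else 0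

/-- The second largest singular value `σ₂` of a matrix. -/
def sigmaTwo {n : ℕ} (W : Matrix (Fin n) (Fin n) ℝ) : ℝ :=
  (Matrix.toEuclideanLin W).singularValues 1

/-- Symmetric doubly stochastic matrices with `σ₂ < 1`. -/
structure IsMixingMatrix {n : ℕ} (W : Matrix (Fin n) (Fin n) ℝ) : Prop where
  symm : W.IsSymm
  nonneg : ∀ i j, 0 ≤ W i j
  row_sum : ∀ i, ∑ j, W i j = 1
  sigmaTwo_lt_one : sigmaTwo W < 1

/-- `L_t = 1 - λ_n(W^t)`. -/
def consensusLip {n : ℕ} (W : Matrix (Fin n) (Fin n) ℝ) (t : ℕ) : ℝ :=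
  1 - sortedEigenvalue (W ^ t) (n - 1)

/-- `γ_t = (1 - 4 r δ₁²) (1 - δ₂²/2) μ_t` with `μ_t = 1 - λ₂(W^t)`. -/
def gammaT {n : ℕ} (r : ℕ) (δ₁ δ₂ : ℝ) (W : Matrix (Fin n) (Fin n) ℝ) (t : ℕ) : ℝ :=
  (1 - 4 * r * δ₁ ^ 2) * (1 - δ₂ ^ 2 / 2) * (1 - sortedEigenvalue (W ^ t) 1)

/-- The linear consensus rate `ρ_t = √(1 - γ_t α)`. -/
def rhoT {n : ℕ} (r : ℕ) (δ₁ δ₂ α : ℝ) (W : Matrix (Fin n) (Fin n) ℝ) (t : ℕ) : ℝ :=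
  √(1 - gammaT r δ₁ δ₂ W t * α)

/-- `grad φᵢᵗ(𝐱)`, the `i`-th block of the Riemannian gradient of
`φᵗ(𝐱) = (1/4) ∑ᵢⱼ (W^t)ᵢⱼ ‖xᵢ - xⱼ‖²`. -/
def gradPhi {n d r : ℕ} (W : Matrix (Fin n) (Fin n) ℝ) (t : ℕ)
    (x : Fin n → Matrix (Fin d) (Fin r) ℝ) (i : Fin n) : Matrix (Fin d) (Fin r) ℝ :=
  tangentProj (x i) (∑ j, (W ^ t) i j • (x i - x j))

/-! ### The algorithm -/

/-- `x` is a run of DRSGD started at `x₀`: `t` consensus steps with stepsize `α`, gradient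
stepsizes `β k`, and `v k ω i` the stochastic Riemannian gradient of agent `i` at iteration `k`. -/
structure IsRun {n d r : ℕ} {Ω : Type*} [MeasurableSpace Ω] (W : Matrix (Fin n) (Fin n) ℝ) (t : ℕ)
    (α : ℝ) (β : ℕ → ℝ) (x₀ : Fin n → Matrix (Fin d) (Fin r) ℝ)
    (v x : ℕ → Ω → Fin n → Matrix (Fin d) (Fin r) ℝ) : Prop where
  measurable_v : ∀ k, Measurable (v k)
  measurable_x : ∀ k, Measurable (x k)
  init : ∀ ω, x 0 ω = x₀
  step : ∀ k ω i, x (k + 1) ω i =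
    polarRetraction (x k ω i) (-(α • gradPhi W t (x k ω) i) - β k • v k ω i)

/-- The assumptions on the stochastic Riemannian gradients `v k ω i` of `f i` at `x k ω i`:
tangency, unbiasedness and independence across agents given the current iterate, variance at most
`Ξ²` and norm at most `D`. -/
structure IsStochasticGradient {n d r : ℕ} {Ω : Type*} [MeasurableSpace Ω] [StandardBorelSpace Ω]
    (P : Measure Ω) [IsProbabilityMeasure P] (f : Fin n → Matrix (Fin d) (Fin r) ℝ → ℝ) (Ξ D : ℝ)
    (v x : ℕ → Ω → Fin n → Matrix (Fin d) (Fin r) ℝ) (hx : ∀ k, Measurable (x k)) : Prop where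
  tangent : ∀ k i, ∀ᵐ ω ∂P, v k ω i ∈ tangentSpace (x k ω i)
  bounded : ∀ k i, ∀ᵐ ω ∂P, ‖v k ω i‖ ≤ D
  unbiased : ∀ k i, P[fun ω => v k ω i | MeasurableSpace.comap (x k) inferInstance]
    =ᵐ[P] fun ω => riemGrad (f i) (x k ω i)
  indep : ∀ k i j, i ≠ j → CondIndepFun (MeasurableSpace.comap (x k) inferInstance)
    (hx k).comap_le (fun ω => v k ω i) (fun ω => v k ω j) P
  variance : ∀ k i, ∫ ω, ‖v k ω i - riemGrad (f i) (x k ω i)‖ ^ 2 ∂P ≤ Ξ ^ 2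

/-- `𝒯₁ = 2 (4 √r + 6 α)² C² + 8 M²` with `M = 1` (the polar retraction). -/
def T₁ (r : ℕ) (α C : ℝ) : ℝ := 2 * (4 * √(r : ℝ) + 6 * α) ^ 2 * C ^ 2 + 8

/-- `𝒯₂ = 201 α² C² + 9 M²` with `M = 1` (the polar retraction). -/
def T₂ (α C : ℝ) : ℝ := 201 * α ^ 2 * C ^ 2 + 9

end

end DRSGD

/-!
The proof follows the consensus error and the objective at the induced arithmetic mean `x̄`.

*Geometry.* The estimates on the Stiefel manifold rest on one identity: for `x, y ∈ St(d, r)` the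
symmetric part of `xᵀ (x - y)` is `(1/2) (x - y)ᵀ (x - y)`, hence quadratic in `x - y`
(`transpose_mul_sub_add`). The polar retraction of `ξ` is the orthonormal factor of a polar
decomposition of `x + ξ` whose other factor is `≥ 1` (`exists_polar_factor`). Therefore it does not
increase distances to points of `St(d, r)` (`norm_polarRetraction_sub_le`) and differs from `x + ξ`
by at most `‖ξ‖² / 2` (`norm_add_sub_polarRetraction_le`). The optimality condition for `x̄` gives
the exact factorization `x̂ = x̄ (1 - E)` of the Euclidean mean, with `E` quadratic in the consensus
error (`euclMean_eq`). Thus `x̂` is within second order of `x̄`, and on the consensus region `x̄` is a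
Lipschitz function of `𝐱` (`norm_iam_sub_iam_le`), which also gives its measurability.

*Consensus.* A restricted secant inequality for the consensus potential
(`IsSymmStochastic.energy_le_sum_inner`), combined with the spectral gap of `W ^ t`, shows that the
consensus part of a step contracts the error by `ρ`, so that the root mean square errors satisfy
`e (k + 1) ≤ ρ e k + D β k` (`ConsensusParams.consensusErr_step_le`). The number `t` of
communication rounds brings the rows of `W ^ t` close to the uniform distribution, which keeps every
single agent within `δ₂` of the mean; so the consensus region is invariant
(`ConsensusParams.step_mem_consensusRegion`). As `β k` decays only polynomially, the recursion gives
`e k = O(D β k)` with a constant that depends only on `c₁, c₂`, a bound for `ρ < 1` and a bound for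
`L_G / D` (`exists_bound_of_contraction`, `le_of_linear_contraction`).

*Stationarity.* The mean moves by `-β k` times the average stochastic gradient, up to an error
`O(D² β k²)` (`ConsensusParams.norm_iam_step_le`), and the objective admits a quadratic upper bound
on the manifold in terms of its Riemannian gradient (`le_riemannian_quadratic_bound`). Conditioning
on the current iterate, where conditional independence of the agents divides the variance by `n`
(`integral_norm_average_sub_sq_le`), gives a descent inequality for the expected objective
(`ConsensusParams.integral_descent`). Summing it over `k` yields the bound on the smallest expected
gradient, and estimates of `∑ k ^ (-m / 2)` yield the rate for `p = 1 / 2` (`sum_stepsize_bound`).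
-/

namespace DRSGD

noncomputable section

/-! ### The Frobenius inner product -/

/-- The inner product `⟪A, B⟫ = ∑ᵢⱼ Aᵢⱼ Bᵢⱼ` that induces the Frobenius norm. -/
scoped instance frobeniusInnerProductSpace {m n : Type*} [Fintype m] [Fintype n] :
    InnerProductSpace ℝ (Matrix m n ℝ) where
  inner A B := ∑ i, ∑ j, A i j * B i j
  norm_sq_eq_re_inner A := by
    have h : (0 : ℝ) ≤ ∑ i, ∑ j, ‖A i j‖ ^ (2 : ℝ) := by positivity
    rw [Matrix.frobenius_norm_def, ← Real.sqrt_eq_rpow, Real.sq_sqrt h]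
    simp [pow_two]
  conj_inner_symm A B := by simp [mul_comm]
  add_left A B C := by simp [add_mul, Finset.sum_add_distrib]
  smul_left A B c := by simp [Finset.mul_sum, mul_assoc]

section Frobenius

variable {l m n : Type*} [Fintype l] [Fintype m] [Fintype n]

local notation "⟪" x ", " y "⟫" => inner ℝ x y

theorem inner_eq_sum (A B : Matrix m n ℝ) : ⟪A, B⟫ = ∑ i, ∑ j, A i j * B i j := rfl

theorem inner_eq_trace (A B : Matrix m n ℝ) : ⟪A, B⟫ = (Aᵀ * B).trace := by
  rw [inner_eq_sum, Finset.sum_comm]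
  simp [Matrix.trace, Matrix.mul_apply]

theorem inner_transpose (A B : Matrix m n ℝ) : ⟪Aᵀ, Bᵀ⟫ = ⟪A, B⟫ := by
  rw [inner_eq_sum, inner_eq_sum, Finset.sum_comm]; rfl

theorem inner_mul_left_eq (C : Matrix l m ℝ) (A : Matrix m n ℝ) (B : Matrix l n ℝ) :
    ⟪C * A, B⟫ = ⟪A, Cᵀ * B⟫ := by
  rw [inner_eq_trace, inner_eq_trace, Matrix.transpose_mul, Matrix.mul_assoc]

theorem inner_mul_right_eq (A : Matrix l m ℝ) (C : Matrix m n ℝ) (B : Matrix l n ℝ) :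
    ⟪A * C, B⟫ = ⟪A, B * Cᵀ⟫ := by
  rw [← inner_transpose, Matrix.transpose_mul, inner_mul_left_eq, ← inner_transpose A,
    Matrix.transpose_mul]

theorem norm_transpose (A : Matrix m n ℝ) : ‖Aᵀ‖ = ‖A‖ := Matrix.frobenius_norm_transpose A

theorem norm_sq_eq_sum_col (A : Matrix m n ℝ) : ‖A‖ ^ 2 = ∑ j, ∑ i, A i j ^ 2 := by
  rw [← real_inner_self_eq_norm_sq, inner_eq_sum, Finset.sum_comm]
  simp [pow_two]

/-- The trace of a product of two positive semidefinite matrices is nonnegative. -/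
theorem inner_nonneg_of_posSemidef [DecidableEq n] {P Q : Matrix n n ℝ} (hP : P.PosSemidef)
    (hQ : Q.PosSemidef) : 0 ≤ ⟪P, Q⟫ := by
  obtain ⟨B, rfl⟩ := CStarAlgebra.nonneg_iff_eq_star_mul_self.mp hP.nonneg
  have h := (hQ.mul_mul_conjTranspose_same B).trace_nonneg
  rw [Matrix.star_eq_conjTranspose, Matrix.conjTranspose_eq_transpose_of_trivial] at *
  rw [inner_mul_left_eq, inner_eq_trace, ← Matrix.mul_assoc]
  rw [Matrix.mul_assoc, Matrix.trace_mul_comm, Matrix.mul_assoc, Matrix.trace_mul_comm] at h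
  simpa [Matrix.mul_assoc] using h

theorem posSemidef_transpose_mul_self (A : Matrix m n ℝ) : (Aᵀ * A).PosSemidef := by
  simpa using Matrix.posSemidef_conjTranspose_mul_self A

theorem inner_one_transpose_mul_self [DecidableEq n] (A : Matrix m n ℝ) :
    ⟪(1 : Matrix n n ℝ), Aᵀ * A⟫ = ‖A‖ ^ 2 := by
  rw [← real_inner_self_eq_norm_sq, inner_eq_trace, inner_eq_trace]; simp

theorem norm_transpose_mul_self_le (A : Matrix m n ℝ) : ‖Aᵀ * A‖ ≤ ‖A‖ ^ 2 := by
  refine (Matrix.frobenius_norm_mul _ _).trans ?_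
  rw [norm_transpose, pow_two]

theorem norm_mul_of_orthonormal [DecidableEq m] {x : Matrix l m ℝ} (hx : xᵀ * x = 1)
    (A : Matrix m n ℝ) : ‖x * A‖ = ‖A‖ := by
  have h : ‖x * A‖ ^ 2 = ‖A‖ ^ 2 := by
    rw [← real_inner_self_eq_norm_sq, inner_mul_left_eq, ← Matrix.mul_assoc, hx, Matrix.one_mul,
      real_inner_self_eq_norm_sq]
  exact (pow_left_inj₀ (norm_nonneg _) (norm_nonneg _) two_ne_zero).1 h

/-- A bound `‖G B‖ ≤ c ‖B‖` for all `B` passes to the transpose of `G`. -/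
theorem norm_transpose_mul_le {G : Matrix l m ℝ} {c : ℝ} (hc : 0 ≤ c)
    (B : Matrix l n ℝ) (hG : ∀ A : Matrix m n ℝ, ‖G * A‖ ≤ c * ‖A‖) : ‖Gᵀ * B‖ ≤ c * ‖B‖ := by
  have h1 : ‖Gᵀ * B‖ ^ 2 ≤ c * ‖Gᵀ * B‖ * ‖B‖ := by
    rw [← real_inner_self_eq_norm_sq, inner_mul_left_eq, Matrix.transpose_transpose,
      real_inner_comm]
    exact (real_inner_le_norm _ _).trans (mul_le_mul_of_nonneg_right (hG _) (norm_nonneg _))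
  rcases (norm_nonneg (Gᵀ * B)).eq_or_lt with h0 | h0
  · rw [← h0]; positivity
  · nlinarith

theorem norm_transpose_mul_le_of_orthonormal [DecidableEq m] {x : Matrix l m ℝ} (hx : xᵀ * x = 1)
    (B : Matrix l n ℝ) : ‖xᵀ * B‖ ≤ ‖B‖ := by
  simpa using norm_transpose_mul_le zero_le_one B fun A => by
    rw [norm_mul_of_orthonormal hx, one_mul]

end Frobenius

variable {d r : ℕ}

theorem opNorm_nonneg (G : Matrix (Fin d) (Fin r) ℝ) : 0 ≤ opNorm G := norm_nonneg _

/-- `‖G B‖ ≤ ‖G‖₂ ‖B‖` for the Frobenius norm on the right. -/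
theorem norm_mul_le_opNorm {q : ℕ} (G : Matrix (Fin d) (Fin r) ℝ) (B : Matrix (Fin r) (Fin q) ℝ) :
    ‖G * B‖ ≤ opNorm G * ‖B‖ := by
  have key : ‖G * B‖ ^ 2 ≤ (opNorm G * ‖B‖) ^ 2 := by
    rw [mul_pow, norm_sq_eq_sum_col, norm_sq_eq_sum_col, Finset.mul_sum]
    refine Finset.sum_le_sum fun j _ => ?_
    have h := (LinearMap.toContinuousLinearMap (Matrix.toEuclideanLin G)).le_opNorm
      (WithLp.toLp 2 fun i => B i j)
    have h2 := pow_le_pow_left₀ (norm_nonneg _) h 2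
    rw [mul_pow, EuclideanSpace.norm_sq_eq, EuclideanSpace.norm_sq_eq] at h2
    simpa [opNorm, Matrix.toEuclideanLin, Matrix.mulVec, dotProduct, Matrix.mul_apply, ← pow_two]
      using h2
  exact (pow_le_pow_iff_left₀ (norm_nonneg _) (mul_nonneg (opNorm_nonneg G) (norm_nonneg _))
    two_ne_zero).1 key

theorem norm_transpose_mul_le_opNorm {q : ℕ} (G : Matrix (Fin d) (Fin r) ℝ)
    (B : Matrix (Fin d) (Fin q) ℝ) : ‖Gᵀ * B‖ ≤ opNorm G * ‖B‖ :=
  norm_transpose_mul_le (opNorm_nonneg G) B fun A => norm_mul_le_opNorm G A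

/-! ### The Stiefel manifold and its tangent projections -/

section Stiefel

variable {d r : ℕ} {x y : Matrix (Fin d) (Fin r) ℝ}

local notation "⟪" x ", " y "⟫" => inner ℝ x y

theorem norm_sq_of_mem_stiefel (hx : x ∈ stiefel d r) : ‖x‖ ^ 2 = r := by
  have hx' : xᵀ * x = 1 := hx
  rw [← real_inner_self_eq_norm_sq, inner_eq_trace, hx']; simp

theorem norm_of_mem_stiefel (hx : x ∈ stiefel d r) : ‖x‖ = √r := by
  rw [← norm_sq_of_mem_stiefel hx, Real.sqrt_sq (norm_nonneg _)]

theorem isCompact_stiefel (d r : ℕ) : IsCompact (stiefel d r) := by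
  refine Metric.isCompact_of_isClosed_isBounded ?_ ?_
  · have : Continuous fun x : Matrix (Fin d) (Fin r) ℝ => xᵀ * x := by fun_prop
    exact isClosed_eq this continuous_const
  · refine (Metric.isBounded_closedBall (x := 0) (r := √r)).subset fun x hx => ?_
    rw [mem_closedBall_zero_iff, norm_of_mem_stiefel hx]

theorem stiefel_nonempty (h : r ≤ d) : (stiefel d r).Nonempty := by
  refine ⟨Matrix.of fun i j => if i = Fin.castLE h j then 1 else 0, ?_⟩
  change _ = _
  ext i j
  simp [Matrix.mul_apply, Matrix.one_apply, (Fin.castLE_injective h).eq_iff]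
  exact if_congr eq_comm rfl rfl

/-- The symmetric part of `xᵀ (x - y)` is quadratic in `x - y`. -/
theorem transpose_mul_sub_add (hx : x ∈ stiefel d r) (hy : y ∈ stiefel d r) :
    xᵀ * (x - y) + (x - y)ᵀ * x = (x - y)ᵀ * (x - y) := by
  have hx' : xᵀ * x = 1 := hx
  have hy' : yᵀ * y = 1 := hy
  simp only [Matrix.transpose_sub, Matrix.mul_sub, Matrix.sub_mul, hx', hy']
  abel

theorem tangentProj_sub_eq (hx : x ∈ stiefel d r) (hy : y ∈ stiefel d r) :
    tangentProj x (x - y) = (x - y) - (1 / 2 : ℝ) • (x * ((x - y)ᵀ * (x - y))) := by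
  rw [tangentProj, transpose_mul_sub_add hx hy]

/-- The tangent projection at `x` as a linear map. -/
def tangentProjLin (x : Matrix (Fin d) (Fin r) ℝ) :
    Matrix (Fin d) (Fin r) ℝ →ₗ[ℝ] Matrix (Fin d) (Fin r) ℝ where
  toFun := tangentProj x
  map_add' a b := by
    simp only [tangentProj, Matrix.mul_add, Matrix.transpose_add, Matrix.add_mul, smul_add]
    abel
  map_smul' c a := by
    simp only [tangentProj, Matrix.transpose_smul, Matrix.mul_smul, Matrix.smul_mul, smul_sub,
      Matrix.mul_add, smul_add, RingHom.id_apply, smul_comm c]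

theorem tangentProjLin_apply (x a : Matrix (Fin d) (Fin r) ℝ) :
    tangentProjLin x a = tangentProj x a := rfl

/-- The tangent projection is self-adjoint. -/
theorem inner_tangentProj (x a b : Matrix (Fin d) (Fin r) ℝ) :
    ⟪tangentProj x a, b⟫ = ⟪a, tangentProj x b⟫ := by
  have h1 : ⟪aᵀ * x, xᵀ * b⟫ = ⟪xᵀ * a, bᵀ * x⟫ := by
    rw [← inner_transpose]; simp
  have h2 : ⟪a, x * (xᵀ * b)⟫ = ⟪xᵀ * a, xᵀ * b⟫ := by
    rw [inner_mul_left_eq]; simp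
  have h3 : ⟪a, x * (bᵀ * x)⟫ = ⟪xᵀ * a, bᵀ * x⟫ := by
    rw [inner_mul_left_eq]; simp
  simp only [tangentProj, inner_sub_left, inner_sub_right, inner_smul_left, inner_smul_right,
    Matrix.mul_add, inner_add_left, inner_add_right, inner_mul_left_eq x, h1, h2, h3]
  simp

theorem mem_tangentSpace_iff {ξ : Matrix (Fin d) (Fin r) ℝ} :
    ξ ∈ tangentSpace x ↔ xᵀ * ξ + ξᵀ * x = 0 := Iff.rfl

theorem tangentProj_mem (hx : x ∈ stiefel d r) (a : Matrix (Fin d) (Fin r) ℝ) :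
    tangentProj x a ∈ tangentSpace x := by
  have hx' : xᵀ * x = 1 := hx
  rw [mem_tangentSpace_iff, tangentProj]
  simp only [Matrix.mul_sub, Matrix.transpose_sub, Matrix.transpose_smul, Matrix.mul_smul,
    Matrix.sub_mul, Matrix.smul_mul, Matrix.transpose_mul, Matrix.mul_assoc, hx', Matrix.mul_one]
  rw [← Matrix.mul_assoc xᵀ x, hx', Matrix.one_mul]
  simp only [Matrix.transpose_add, Matrix.transpose_mul, Matrix.transpose_transpose, smul_add]
  module

theorem tangentProj_of_mem {ξ : Matrix (Fin d) (Fin r) ℝ} (hξ : ξ ∈ tangentSpace x) :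
    tangentProj x ξ = ξ := by
  rw [tangentProj, mem_tangentSpace_iff.1 hξ]; simp

theorem inner_tangentProj_self (hx : x ∈ stiefel d r) (a : Matrix (Fin d) (Fin r) ℝ) :
    ⟪tangentProj x a, a⟫ = ‖tangentProj x a‖ ^ 2 := by
  rw [← real_inner_self_eq_norm_sq, inner_tangentProj, inner_tangentProj,
    tangentProj_of_mem (tangentProj_mem hx a)]

theorem norm_tangentProj_le (hx : x ∈ stiefel d r) (a : Matrix (Fin d) (Fin r) ℝ) :
    ‖tangentProj x a‖ ≤ ‖a‖ := by
  have h := real_inner_le_norm (tangentProj x a) a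
  rw [inner_tangentProj_self hx] at h
  nlinarith [norm_nonneg (tangentProj x a), norm_nonneg a]

theorem smul_mem_tangentSpace {ξ : Matrix (Fin d) (Fin r) ℝ} (c : ℝ) (hξ : ξ ∈ tangentSpace x) :
    c • ξ ∈ tangentSpace x := by
  rw [mem_tangentSpace_iff] at *
  rw [Matrix.transpose_smul, Matrix.mul_smul, Matrix.smul_mul, ← smul_add, hξ, smul_zero]

theorem sub_mem_tangentSpace {ξ η : Matrix (Fin d) (Fin r) ℝ} (hξ : ξ ∈ tangentSpace x)
    (hη : η ∈ tangentSpace x) : ξ - η ∈ tangentSpace x := by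
  rw [mem_tangentSpace_iff] at *
  rw [Matrix.transpose_sub, Matrix.mul_sub, Matrix.sub_mul]
  rw [show xᵀ * ξ - xᵀ * η + (ξᵀ * x - ηᵀ * x) = (xᵀ * ξ + ξᵀ * x) - (xᵀ * η + ηᵀ * x) by abel,
    hξ, hη, sub_zero]

/-! ### The polar retraction -/

/-- A positive semidefinite square root of a matrix `1 + Q ≥ 1` is itself `≥ 1`. -/
theorem posSemidef_sub_one_of_mul_self {S : Matrix (Fin r) (Fin r) ℝ}
    {ξ : Matrix (Fin d) (Fin r) ℝ} (hS : S.PosSemidef) (hSS : S * S = 1 + ξᵀ * ξ) :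
    (S - 1).PosSemidef := by
  have hH : (S - 1).IsHermitian := hS.1.sub Matrix.isHermitian_one
  rw [hH.posSemidef_iff_eigenvalues_nonneg]
  intro i
  set u := hH.eigenvectorBasis i
  have hu := hH.mulVec_eigenvectorBasis i
  have hnorm : (u : Fin r → ℝ) ⬝ᵥ (u : Fin r → ℝ) = 1 := by
    have h1 : ‖u‖ = 1 := hH.eigenvectorBasis.orthonormal.1 i
    have h2 := EuclideanSpace.norm_sq_eq u
    rw [h1] at h2
    simp only [dotProduct, ← pow_two]
    simpa using h2.symm
  set s := hH.eigenvalues i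
  have hSu : S *ᵥ (u : Fin r → ℝ) = (1 + s) • (u : Fin r → ℝ) := by
    have : S *ᵥ (u : Fin r → ℝ) = (S - 1) *ᵥ (u : Fin r → ℝ) + (u : Fin r → ℝ) := by
      rw [Matrix.sub_mulVec, Matrix.one_mulVec, sub_add_cancel]
    rw [this]
    erw [hu]
    rw [add_smul, one_smul, add_comm]
  have h0 : 0 ≤ 1 + s := by
    have := hS.dotProduct_mulVec_nonneg (u : Fin r → ℝ)
    rw [hSu] at this
    simpa [dotProduct_smul, hnorm] using this
  have h1 : 1 ≤ (1 + s) ^ 2 := by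
    have e1 : (u : Fin r → ℝ) ⬝ᵥ ((S * S) *ᵥ (u : Fin r → ℝ)) = (1 + s) ^ 2 := by
      rw [← Matrix.mulVec_mulVec, hSu, Matrix.mulVec_smul, hSu]
      simp [dotProduct_smul, hnorm, pow_two]
    have e2 : 0 ≤ (u : Fin r → ℝ) ⬝ᵥ ((ξᵀ * ξ) *ᵥ (u : Fin r → ℝ)) := by
      simpa using (posSemidef_transpose_mul_self ξ).dotProduct_mulVec_nonneg (u : Fin r → ℝ)
    rw [← e1, hSS, Matrix.add_mulVec, dotProduct_add, Matrix.one_mulVec, hnorm]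
    linarith
  change (0 : ℝ) ≤ s
  nlinarith

/-- The polar retraction is the orthonormal factor of a polar decomposition `x + ξ = R_x(ξ) S`
with a positive semidefinite factor `S ≥ 1`. -/
theorem exists_polar_factor (hx : x ∈ stiefel d r) {ξ : Matrix (Fin d) (Fin r) ℝ}
    (hξ : ξ ∈ tangentSpace x) :
    ∃ S : Matrix (Fin r) (Fin r) ℝ, (S - 1).PosSemidef ∧ S * S = 1 + ξᵀ * ξ ∧
      polarRetraction x ξ ∈ stiefel d r ∧ polarRetraction x ξ * S = x + ξ := by
  have hx' : xᵀ * x = 1 := hx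
  have hpos : (0 : Matrix (Fin r) (Fin r) ℝ) ≤ 1 + ξᵀ * ξ :=
    (Matrix.PosSemidef.one.add (posSemidef_transpose_mul_self ξ)).nonneg
  set S := CFC.sqrt (1 + ξᵀ * ξ) with hSdef
  have hS : S.PosSemidef := Matrix.nonneg_iff_posSemidef.1 (CFC.sqrt_nonneg _)
  have hSS : S * S = 1 + ξᵀ * ξ := CFC.sqrt_mul_sqrt_self _ hpos
  have hST : Sᵀ = S := by simpa using hS.1.eq
  have hdetU : IsUnit S.det := by
    have h1 : (1 + ξᵀ * ξ).PosDef :=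
      Matrix.PosDef.one.add_posSemidef (posSemidef_transpose_mul_self ξ)
    have h2 : (S * S).det ≠ 0 := by rw [hSS]; exact h1.det_pos.ne'
    rw [Matrix.det_mul] at h2
    exact isUnit_iff_ne_zero.2 (left_ne_zero_of_mul h2)
  have hR : polarRetraction x ξ = (x + ξ) * S⁻¹ := rfl
  refine ⟨S, posSemidef_sub_one_of_mul_self hS hSS, hSS, ?_, ?_⟩
  · have hgram : (x + ξ)ᵀ * (x + ξ) = S * S := by
      rw [hSS, Matrix.transpose_add, Matrix.mul_add, Matrix.add_mul, Matrix.add_mul, hx']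
      have := mem_tangentSpace_iff.1 hξ
      rw [show (1 + ξᵀ * x + (xᵀ * ξ + ξᵀ * ξ)) = 1 + (xᵀ * ξ + ξᵀ * x) + ξᵀ * ξ by abel, this,
        add_zero]
    change (polarRetraction x ξ)ᵀ * polarRetraction x ξ = 1
    rw [hR, Matrix.transpose_mul, Matrix.transpose_nonsing_inv, hST, Matrix.mul_assoc,
      ← Matrix.mul_assoc _ (x + ξ), hgram, Matrix.mul_assoc, Matrix.mul_nonsing_inv _ hdetU,
      Matrix.mul_one, Matrix.nonsing_inv_mul _ hdetU]
  · rw [hR, Matrix.mul_assoc, Matrix.nonsing_inv_mul _ hdetU, Matrix.mul_one]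

theorem polarRetraction_mem (hx : x ∈ stiefel d r) {ξ : Matrix (Fin d) (Fin r) ℝ}
    (hξ : ξ ∈ tangentSpace x) : polarRetraction x ξ ∈ stiefel d r := by
  obtain ⟨S, -, -, h, -⟩ := exists_polar_factor hx hξ
  exact h

/-- Passing from `x + ξ` to the polar retraction does not increase the distance to any point of the
Stiefel manifold. -/
theorem norm_polarRetraction_sub_le (hx : x ∈ stiefel d r) (hy : y ∈ stiefel d r)
    {ξ : Matrix (Fin d) (Fin r) ℝ} (hξ : ξ ∈ tangentSpace x) :
    ‖polarRetraction x ξ - y‖ ≤ ‖x + ξ - y‖ := by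
  obtain ⟨S, hS, -, hR, hRS⟩ := exists_polar_factor hx hξ
  set R := polarRetraction x ξ
  have hR' : Rᵀ * R = 1 := hR
  set T := S - 1 with hT
  have hTT : Tᵀ = T := by simpa using hS.1.eq
  have hxξ : x + ξ - y = (R - y) + R * T := by
    rw [← hRS, hT, Matrix.mul_sub, Matrix.mul_one]; abel
  -- `⟪R - y, R T⟫` is the trace of a product of positive semidefinite matrices
  have hcross : 0 ≤ ⟪R - y, R * T⟫ := by
    have h1 : ⟪R - y, R * T⟫ = ⟪Rᵀ * (R - y), T⟫ := by
      rw [inner_mul_left_eq]; simp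
    have h2 : ⟪Rᵀ * (R - y), T⟫ = ⟪(R - y)ᵀ * R, T⟫ := by
      rw [← inner_transpose, hTT]; simp
    have h3 : ⟪Rᵀ * (R - y), T⟫ + ⟪(R - y)ᵀ * R, T⟫ = ⟪(R - y)ᵀ * (R - y), T⟫ := by
      rw [← inner_add_left, transpose_mul_sub_add hR hy]
    have h4 := inner_nonneg_of_posSemidef (posSemidef_transpose_mul_self (R - y)) hS
    rw [h1]; linarith
  have hsq : ‖x + ξ - y‖ ^ 2 = ‖R - y‖ ^ 2 + 2 * ⟪R - y, R * T⟫ + ‖R * T‖ ^ 2 := by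
    rw [hxξ, norm_add_sq_real]
  exact (pow_le_pow_iff_left₀ (norm_nonneg _) (norm_nonneg _) two_ne_zero).1
    (by nlinarith [sq_nonneg ‖R * T‖])

/-- The polar retraction is a second-order approximation of `x + ξ`: with `T = S - 1 ≥ 0` for the
polar factor `S`, one has `ξᵀ ξ = T² + 2 T`, whence `2 ‖T‖ ≤ ‖ξᵀ ξ‖`. -/
theorem norm_add_sub_polarRetraction_le (hx : x ∈ stiefel d r)
    {ξ : Matrix (Fin d) (Fin r) ℝ} (hξ : ξ ∈ tangentSpace x) :
    ‖x + ξ - polarRetraction x ξ‖ ≤ (1 / 2) * ‖ξ‖ ^ 2 := by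
  obtain ⟨S, hS, hSS, hR, hRS⟩ := exists_polar_factor hx hξ
  set R := polarRetraction x ξ
  set T := S - 1 with hT
  have hTT : Tᵀ = T := by simpa using hS.1.eq
  have h1 : x + ξ - R = R * T := by rw [← hRS, hT, Matrix.mul_sub, Matrix.mul_one]
  rw [h1, norm_mul_of_orthonormal hR]
  have h2 : ξᵀ * ξ = T * T + (2 : ℝ) • T := by
    have hS1 : S = T + 1 := by rw [hT]; abel
    rw [hS1, Matrix.mul_add, Matrix.add_mul, Matrix.mul_one, Matrix.one_mul] at hSS
    have : ξᵀ * ξ = (T * T + T + (T + 1)) - 1 := by rw [hSS]; abel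
    rw [this, two_smul]; abel
  have h3 : 0 ≤ ⟪T * T, T⟫ := by
    have h := inner_nonneg_of_posSemidef (posSemidef_transpose_mul_self T) hS
    rwa [hTT] at h
  have h4 : (2 * ‖T‖) ^ 2 ≤ ‖ξᵀ * ξ‖ ^ 2 := by
    rw [h2, norm_add_sq_real, inner_smul_right, norm_smul]
    simp only [Real.norm_ofNat]
    nlinarith [sq_nonneg ‖T * T‖]
  have h5 := (pow_le_pow_iff_left₀ (by positivity) (norm_nonneg _) two_ne_zero).1 h4
  linarith [norm_transpose_mul_self_le ξ]

/-! ### The induced arithmetic mean -/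

variable {n : ℕ}

/-- The Euclidean mean of `x₁, …, xₙ`. -/
def euclMean (x : Fin n → Matrix (Fin d) (Fin r) ℝ) : Matrix (Fin d) (Fin r) ℝ :=
  (1 / (n : ℝ)) • ∑ i, x i

/-- The matrix `(1 / 2n) ∑ᵢ (xᵢ - x̄)ᵀ (xᵢ - x̄)`, by which the Euclidean mean falls short of the
induced arithmetic mean `x̄`. -/
def meanDefect (x : Fin n → Matrix (Fin d) (Fin r) ℝ) : Matrix (Fin r) (Fin r) ℝ :=
  (1 / (2 * n : ℝ)) • ∑ i, (x i - iam x)ᵀ * (x i - iam x)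

theorem isIAM_iam {x : Fin n → Matrix (Fin d) (Fin r) ℝ} (h : (stiefel d r).Nonempty) :
    IsIAM x (iam x) := by
  refine Classical.epsilon_spec (p := IsIAM x) ?_
  obtain ⟨y, hy, hmin⟩ := (isCompact_stiefel d r).exists_isMinOn h
    (f := fun y => ∑ i, ‖y - x i‖ ^ 2) (by fun_prop)
  exact ⟨y, hy, fun z hz => hmin hz⟩

theorem consensusErrSq_nonneg (x : Fin n → Matrix (Fin d) (Fin r) ℝ) : 0 ≤ consensusErrSq x :=
  Finset.sum_nonneg fun _ _ => sq_nonneg _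

theorem norm_meanDefect_le (x : Fin n → Matrix (Fin d) (Fin r) ℝ) :
    ‖meanDefect x‖ ≤ (1 / 2) * (1 / (n : ℝ) * consensusErrSq x) := by
  rw [meanDefect, norm_smul, Real.norm_of_nonneg (by positivity)]
  have : ‖∑ i, (x i - iam x)ᵀ * (x i - iam x)‖ ≤ consensusErrSq x :=
    (norm_sum_le _ _).trans (Finset.sum_le_sum fun i _ => norm_transpose_mul_self_le _)
  calc _ ≤ 1 / (2 * n : ℝ) * consensusErrSq x := by gcongr
    _ = _ := by ring

theorem transpose_meanDefect (x : Fin n → Matrix (Fin d) (Fin r) ℝ) :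
    (meanDefect x)ᵀ = meanDefect x := by
  simp [meanDefect, Matrix.transpose_smul, Matrix.transpose_sum, Matrix.transpose_mul]

/-- First-order optimality of the induced arithmetic mean. -/
theorem tangentProj_iam_euclMean (hn : n ≠ 0) {x : Fin n → Matrix (Fin d) (Fin r) ℝ}
    (h : (stiefel d r).Nonempty) : tangentProj (iam x) (euclMean x) = 0 := by
  obtain ⟨hy, hmin⟩ := isIAM_iam (x := x) h
  set y := iam x
  have hn' : (0 : ℝ) < n := by positivity
  have hmax : ∀ z ∈ stiefel d r, ⟪z, euclMean x⟫ ≤ ⟪y, euclMean x⟫ := by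
    intro z hz
    have hexp : ∀ w ∈ stiefel d r,
        ∑ i, ‖w - x i‖ ^ 2 = n * r - 2 * n * ⟪w, euclMean x⟫ + ∑ i, ‖x i‖ ^ 2 := by
      intro w hw
      simp only [norm_sub_sq_real, Finset.sum_add_distrib, Finset.sum_sub_distrib,
        norm_sq_of_mem_stiefel hw, euclMean, inner_smul_right, ← Finset.mul_sum, ← inner_sum]
      simp
      field_simp
    have := hmin z hz
    rw [hexp y hy, hexp z hz] at this
    nlinarith
  set ξ := tangentProj y (euclMean x) with hξ
  have hξT : ξ ∈ tangentSpace y := tangentProj_mem hy _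
  -- compare `y` with the points `R_y(s ξ)` for small `s > 0`
  have hle : ∀ s : ℝ, 0 < s → ⟪ξ, euclMean x⟫ ≤ s * ((1 / 2) * ‖ξ‖ ^ 2 * ‖euclMean x‖) := by
    intro s hs
    have hT := smul_mem_tangentSpace s hξT
    have h1 := hmax _ (polarRetraction_mem hy hT)
    have h2 := norm_add_sub_polarRetraction_le hy hT
    have h3 := real_inner_le_norm (y + s • ξ - polarRetraction y (s • ξ)) (euclMean x)
    rw [inner_sub_left, inner_add_left, inner_smul_left] at h3
    have h4 := mul_le_mul_of_nonneg_right h2 (norm_nonneg (euclMean x))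
    rw [norm_smul, Real.norm_of_nonneg hs.le] at h4
    simp only [conj_trivial] at h3
    have : s * ⟪ξ, euclMean x⟫ ≤ s * (s * ((1 / 2) * ‖ξ‖ ^ 2 * ‖euclMean x‖)) := by nlinarith
    exact le_of_mul_le_mul_left this hs
  have h0 : ⟪ξ, euclMean x⟫ ≤ 0 := by
    refine le_of_forall_pos_le_add fun ε hε => ?_
    set c := (1 / 2) * ‖ξ‖ ^ 2 * ‖euclMean x‖
    have hc : 0 ≤ c := by positivity
    refine (hle (ε / (c + 1)) (by positivity)).trans ?_
    rw [zero_add, div_mul_eq_mul_div, div_le_iff₀ (by positivity)]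
    nlinarith
  rw [hξ, inner_tangentProj_self hy] at h0
  have : ‖ξ‖ = 0 := by nlinarith [norm_nonneg ξ]
  exact norm_eq_zero.1 this

/-- Since the symmetric part of `x̄ᵀ xᵢ` is `1 - (xᵢ - x̄)ᵀ (xᵢ - x̄) / 2`, the optimality condition
says that the Euclidean mean factors through the induced arithmetic mean: `x̂ = x̄ (1 - E)`. -/
theorem euclMean_eq (hn : n ≠ 0) {x : Fin n → Matrix (Fin d) (Fin r) ℝ}
    (hx : ∀ i, x i ∈ stiefel d r) :
    euclMean x = iam x - iam x * meanDefect x := by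
  have hne : (stiefel d r).Nonempty := ⟨_, hx ⟨0, Nat.pos_of_ne_zero hn⟩⟩
  have h := tangentProj_iam_euclMean hn (x := x) hne
  have hy := (isIAM_iam (x := x) hne).1
  set y := iam x with hyd
  have hn' : (n : ℝ) ≠ 0 := by positivity
  have hS : (1 / 2 : ℝ) • (yᵀ * euclMean x + (euclMean x)ᵀ * y) = 1 - meanDefect x := by
    have hE : ∀ i, (x i - y)ᵀ * (x i - y) = (2 : ℝ) • 1 - (yᵀ * x i + (x i)ᵀ * y) := by
      intro i
      have hx' : (x i)ᵀ * x i = 1 := hx i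
      have hy' : yᵀ * y = 1 := hy
      simp only [Matrix.transpose_sub, Matrix.mul_sub, Matrix.sub_mul, hx', hy', two_smul]
      abel
    simp only [meanDefect, ← hyd, hE, Finset.sum_sub_distrib, Finset.sum_add_distrib, euclMean,
      Matrix.transpose_smul, Matrix.mul_smul, Matrix.smul_mul, Matrix.transpose_sum,
      ← Matrix.mul_sum, ← Matrix.sum_mul, Finset.sum_const, Finset.card_univ, Fintype.card_fin]
    rw [← Nat.cast_smul_eq_nsmul ℝ, smul_sub, smul_smul, smul_smul]
    rw [show 1 / (2 * (n : ℝ)) * (n : ℝ) * 2 = 1 by field_simp, one_smul]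
    rw [show 1 / (2 * (n : ℝ)) = (1 / 2) * (1 / (n : ℝ)) by field_simp]
    module
  rw [tangentProj, sub_eq_zero, ← Matrix.mul_smul, hS, Matrix.mul_sub, Matrix.mul_one] at h
  exact h

/-- Stability of the induced arithmetic mean in terms of the Euclidean means. -/
theorem norm_iam_sub_iam_le (hn : n ≠ 0) {x x' : Fin n → Matrix (Fin d) (Fin r) ℝ}
    (hx : ∀ i, x i ∈ stiefel d r) (hx' : ∀ i, x' i ∈ stiefel d r) :
    (1 - (1 / 2) * (‖meanDefect x‖ + ‖meanDefect x'‖)) * ‖iam x - iam x'‖ ≤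
      ‖euclMean x - euclMean x'‖ := by
  have hne : (stiefel d r).Nonempty := ⟨_, hx ⟨0, Nat.pos_of_ne_zero hn⟩⟩
  have hy := (isIAM_iam (x := x) hne).1
  have hy' := (isIAM_iam (x := x') hne).1
  have e := euclMean_eq hn hx
  have e' := euclMean_eq hn hx'
  -- each optimality condition is tested against the difference of the two means
  have half : ∀ {a b : Matrix (Fin d) (Fin r) ℝ} {E : Matrix (Fin r) (Fin r) ℝ},
      a ∈ stiefel d r → b ∈ stiefel d r → Eᵀ = E →
      (1 / 2) * (1 - ‖E‖) * ‖a - b‖ ^ 2 ≤ ⟪a - b, a - a * E⟫ := by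
    intro a b E ha hb hE
    have h0 : a - a * E = a * (1 - E) := by rw [Matrix.mul_sub, Matrix.mul_one]
    have h1 : ⟪a - b, a * (1 - E)⟫ = ⟪aᵀ * (a - b), 1 - E⟫ := by
      rw [inner_mul_left_eq]; simp
    have h2 : ⟪aᵀ * (a - b), 1 - E⟫ = ⟪(a - b)ᵀ * a, 1 - E⟫ := by
      rw [← inner_transpose]; simp [hE]
    have h3 : ⟪aᵀ * (a - b), 1 - E⟫ + ⟪(a - b)ᵀ * a, 1 - E⟫ = ⟪(a - b)ᵀ * (a - b), 1 - E⟫ := by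
      rw [← inner_add_left, transpose_mul_sub_add ha hb]
    have h4 : ⟪(a - b)ᵀ * (a - b), 1 - E⟫ = ‖a - b‖ ^ 2 - ⟪(a - b)ᵀ * (a - b), E⟫ := by
      rw [inner_sub_right, real_inner_comm, inner_one_transpose_mul_self]
    have h5 : ⟪(a - b)ᵀ * (a - b), E⟫ ≤ ‖a - b‖ ^ 2 * ‖E‖ :=
      (real_inner_le_norm _ _).trans
        (mul_le_mul_of_nonneg_right (norm_transpose_mul_self_le _) (norm_nonneg _))
    rw [h0, h1]; nlinarith
  have k1 := half hy hy' (transpose_meanDefect x)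
  have k2 := half hy' hy (transpose_meanDefect x')
  rw [← e] at k1
  rw [← e', ← neg_sub (iam x), inner_neg_left, norm_neg] at k2
  have k3 := real_inner_le_norm (iam x - iam x') (euclMean x - euclMean x')
  rw [inner_sub_right] at k3
  rcases (norm_nonneg (iam x - iam x')).eq_or_lt with h0 | h0
  · rw [← h0, mul_zero]; exact norm_nonneg _
  · nlinarith

theorem norm_euclMean_sub_iam_le (hn : n ≠ 0) {x : Fin n → Matrix (Fin d) (Fin r) ℝ}
    (hx : ∀ i, x i ∈ stiefel d r) :
    ‖euclMean x - iam x‖ ≤ (1 / 2) * (1 / (n : ℝ) * consensusErrSq x) := by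
  have hne : (stiefel d r).Nonempty := ⟨_, hx ⟨0, Nat.pos_of_ne_zero hn⟩⟩
  rw [euclMean_eq hn hx, sub_sub_cancel_left, norm_neg,
    norm_mul_of_orthonormal (isIAM_iam (x := x) hne).1]
  exact norm_meanDefect_le x

end Stiefel

/-! ### Spectral bounds for symmetric operators and mixing matrices -/

section SymmetricOperator

variable {E : Type*} [NormedAddCommGroup E] [InnerProductSpace ℝ E] [FiniteDimensional ℝ E]
  {T : E →ₗ[ℝ] E} {m : ℕ}

local notation "⟪" x ", " y "⟫" => inner ℝ x y

omit [FiniteDimensional ℝ E] in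
theorem inner_eq_sum_repr (b : OrthonormalBasis (Fin m) ℝ E) (x y : E) :
    ⟪x, y⟫ = ∑ k, b.repr x k * b.repr y k := by
  rw [← b.repr.inner_map_map, PiLp.inner_apply]
  simp [mul_comm]

theorem eigenvalue_le_one (hT : T.IsSymmetric) (hm : Module.finrank ℝ E = m)
    (hle : ∀ z, ⟪z, T z⟫ ≤ ‖z‖ ^ 2) (k : Fin m) : hT.eigenvalues hm k ≤ 1 := by
  have h := hle (hT.eigenvectorBasis hm k)
  have h1 : ‖hT.eigenvectorBasis hm k‖ = 1 := (hT.eigenvectorBasis hm).orthonormal.1 k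
  rw [hT.apply_eigenvectorBasis, inner_smul_right, real_inner_self_eq_norm_sq, h1] at h
  simpa using h

/-- If a symmetric operator `T ≤ 1` fixes `u ≠ 0`, then its quadratic form is bounded by the second
largest eigenvalue on the orthogonal complement of `u`. -/
theorem inner_apply_le_second_eigenvalue (hT : T.IsSymmetric) (hm : Module.finrank ℝ E = m)
    (h1 : 1 < m) {u : E} (hu : u ≠ 0) (hTu : T u = u) (hle : ∀ z, ⟪z, T z⟫ ≤ ‖z‖ ^ 2) {z : E}
    (hz : ⟪z, u⟫ = 0) : ⟪z, T z⟫ ≤ hT.eigenvalues hm ⟨1, h1⟩ * ‖z‖ ^ 2 := by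
  by_cases hlam : 1 ≤ hT.eigenvalues hm ⟨1, h1⟩
  · nlinarith [hle z, sq_nonneg ‖z‖]
  push Not at hlam
  set b := hT.eigenvectorBasis hm
  set lam := hT.eigenvalues hm with hlamdef
  have hanti : Antitone lam := hT.eigenvalues_antitone hm
  have happ : ∀ w k, b.repr (T w) k = lam k * b.repr w k := fun w k =>
    hT.eigenvectorBasis_apply_self_apply hm w k
  have hpos : ∀ k : Fin m, k ≠ ⟨0, by omega⟩ → lam k ≤ lam ⟨1, h1⟩ := fun k hk => by
    refine hanti (Fin.mk_le_of_le_val ?_)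
    have : k.val ≠ 0 := fun h => hk (Fin.ext h)
    omega
  have hu0 : ∀ k : Fin m, k ≠ ⟨0, by omega⟩ → b.repr u k = 0 := fun k hk => by
    have h := happ u k
    rw [hTu] at h
    have : lam k < 1 := (hpos k hk).trans_lt hlam
    by_contra hne
    exact this.ne (mul_right_cancel₀ hne (by rw [← h, one_mul]))
  have hz0 : b.repr z ⟨0, by omega⟩ = 0 := by
    rw [inner_eq_sum_repr b, Finset.sum_eq_single ⟨0, by omega⟩] at hz
    · refine (mul_eq_zero.1 hz).resolve_right fun h => hu ?_
      have : b.repr u = 0 := by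
        ext k
        by_cases hk : k = ⟨0, by omega⟩
        · rw [hk, h]; rfl
        · rw [hu0 k hk]; rfl
      exact b.repr.map_eq_zero_iff.1 this
    · intro k _ hk; rw [hu0 k hk, mul_zero]
    · intro h; exact absurd (Finset.mem_univ _) h
  rw [← real_inner_self_eq_norm_sq, inner_eq_sum_repr b, inner_eq_sum_repr b, Finset.mul_sum]
  refine Finset.sum_le_sum fun k _ => ?_
  rw [happ]
  by_cases hk : k = ⟨0, by omega⟩
  · rw [hk, hz0]; simp
  · nlinarith [hpos k hk, sq_nonneg (b.repr z k)]

theorem le_inner_apply_of_eigenvalue (hT : T.IsSymmetric) (hm : Module.finrank ℝ E = m)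
    (h0 : m - 1 < m) (z : E) : hT.eigenvalues hm ⟨m - 1, h0⟩ * ‖z‖ ^ 2 ≤ ⟪z, T z⟫ := by
  set b := hT.eigenvectorBasis hm
  rw [← real_inner_self_eq_norm_sq, inner_eq_sum_repr b, inner_eq_sum_repr b, Finset.mul_sum]
  refine Finset.sum_le_sum fun k _ => ?_
  have happ : b.repr (T z) k = hT.eigenvalues hm k * b.repr z k :=
    hT.eigenvectorBasis_apply_self_apply hm z k
  rw [happ]
  have : hT.eigenvalues hm ⟨m - 1, h0⟩ ≤ hT.eigenvalues hm k :=
    hT.eigenvalues_antitone hm (Fin.le_def.2 (by have := k.2; simp only; omega))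
  nlinarith [sq_nonneg (b.repr z k)]

/-- For `0 ≤ 1 - T ≤ 1 - λ_min`, `(1 - T)² ≤ (1 - λ_min) (1 - T)`. -/
theorem norm_sub_apply_sq_le (hT : T.IsSymmetric) (hm : Module.finrank ℝ E = m)
    (h0 : m - 1 < m) (hle : ∀ z, ⟪z, T z⟫ ≤ ‖z‖ ^ 2) (z : E) :
    ‖z - T z‖ ^ 2 ≤ (1 - hT.eigenvalues hm ⟨m - 1, h0⟩) * ⟪z, z - T z⟫ := by
  set b := hT.eigenvectorBasis hm
  rw [← real_inner_self_eq_norm_sq, inner_eq_sum_repr b, inner_eq_sum_repr b, Finset.mul_sum]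
  refine Finset.sum_le_sum fun k _ => ?_
  have h1 : b.repr (z - T z) k = (1 - hT.eigenvalues hm k) * b.repr z k := by
    have := hT.eigenvectorBasis_apply_self_apply hm z k
    rw [map_sub, PiLp.sub_apply, this]
    simp only [RCLike.ofReal_real_eq_id, id_eq]
    ring
  have h2 : hT.eigenvalues hm ⟨m - 1, h0⟩ ≤ hT.eigenvalues hm k :=
    hT.eigenvalues_antitone hm (Fin.le_def.2 (by have := k.2; simp only; omega))
  have h3 := eigenvalue_le_one hT hm hle k
  rw [h1]
  have h4 : 0 ≤ (hT.eigenvalues hm k - hT.eigenvalues hm ⟨m - 1, h0⟩) *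
      ((1 - hT.eigenvalues hm k) * b.repr z k ^ 2) :=
    mul_nonneg (sub_nonneg.2 h2) (mul_nonneg (sub_nonneg.2 h3) (sq_nonneg _))
  nlinarith

end SymmetricOperator

section Mixing

variable {n : ℕ}

/-- Symmetric (doubly) stochastic matrices. -/
structure IsSymmStochastic (A : Matrix (Fin n) (Fin n) ℝ) : Prop where
  symm : A.IsSymm
  nonneg : ∀ i j, 0 ≤ A i j
  row_sum : ∀ i, ∑ j, A i j = 1

theorem IsMixingMatrix.isSymmStochastic_pow {W : Matrix (Fin n) (Fin n) ℝ}
    (hW : IsMixingMatrix W) (t : ℕ) : IsSymmStochastic (W ^ t) := by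
  refine ⟨hW.symm.pow t, ?_, ?_⟩
  · induction t with
    | zero => intro i j; rw [pow_zero, Matrix.one_apply]; split_ifs <;> norm_num
    | succ t ih =>
      intro i j
      rw [pow_succ, Matrix.mul_apply]
      exact Finset.sum_nonneg fun k _ => mul_nonneg (ih i k) (hW.nonneg k j)
  · induction t with
    | zero => intro i; simp [Matrix.one_apply]
    | succ t ih =>
      intro i
      simp only [pow_succ, Matrix.mul_apply]
      rw [Finset.sum_comm]
      simp only [← Finset.mul_sum, hW.row_sum, mul_one, ih]

namespace IsSymmStochastic

variable {A : Matrix (Fin n) (Fin n) ℝ} (hA : IsSymmStochastic A)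
include hA

theorem apply_comm (i j : Fin n) : A i j = A j i := hA.symm.apply j i

theorem col_sum (j : Fin n) : ∑ i, A i j = 1 := by
  simp only [hA.apply_comm _ j, hA.row_sum]

theorem isHermitian : A.IsHermitian := by
  simpa [Matrix.IsHermitian] using hA.symm.eq

/-- A doubly stochastic matrix does not increase the Euclidean norm, by Jensen's inequality in each
row. -/
theorem sum_sq_mulVec_le (z : Fin n → ℝ) : ∑ i, (∑ j, A i j * z j) ^ 2 ≤ ∑ j, z j ^ 2 := by
  calc ∑ i, (∑ j, A i j * z j) ^ 2 ≤ ∑ i, ∑ j, A i j * z j ^ 2 := by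
        refine Finset.sum_le_sum fun i _ => ?_
        have := Finset.sum_sq_le_sum_mul_sum_of_sq_le_mul Finset.univ
          (r := fun j => A i j * z j) (f := fun j => A i j) (g := fun j => A i j * z j ^ 2)
          (fun j _ => hA.nonneg i j) (fun j _ => mul_nonneg (hA.nonneg i j) (sq_nonneg _))
          (fun j _ => le_of_eq (by ring))
        simpa [hA.row_sum] using this
    _ = ∑ j, z j ^ 2 := by
        rw [Finset.sum_comm]
        simp only [← Finset.sum_mul, hA.col_sum, one_mul]

theorem sum_mul_mulVec_le (z : Fin n → ℝ) : ∑ i, z i * ∑ j, A i j * z j ≤ ∑ j, z j ^ 2 := by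
  have h1 := hA.sum_sq_mulVec_le z
  have h2 : ∑ i, z i * ∑ j, A i j * z j ≤ ∑ i, (z i ^ 2 / 2 + (∑ j, A i j * z j) ^ 2 / 2) :=
    Finset.sum_le_sum fun i _ => by nlinarith [sq_nonneg (z i - ∑ j, A i j * z j)]
  rw [Finset.sum_add_distrib, ← Finset.sum_div, ← Finset.sum_div] at h2
  linarith

theorem sum_mul_mulVec_ge (z : Fin n → ℝ) : -∑ j, z j ^ 2 ≤ ∑ i, z i * ∑ j, A i j * z j := by
  have h1 := hA.sum_sq_mulVec_le z
  have h2 : ∑ i, (-(z i ^ 2 / 2) - (∑ j, A i j * z j) ^ 2 / 2) ≤ ∑ i, z i * ∑ j, A i j * z j :=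
    Finset.sum_le_sum fun i _ => by nlinarith [sq_nonneg (z i + ∑ j, A i j * z j)]
  rw [Finset.sum_sub_distrib, Finset.sum_neg_distrib, ← Finset.sum_div, ← Finset.sum_div] at h2
  linarith

/-- The Laplacian form of `A` as a weighted sum of squared differences. -/
theorem sum_mul_laplacian (z : Fin n → ℝ) :
    ∑ i, z i * ∑ j, A i j * (z i - z j) = (1 / 2) * ∑ i, ∑ j, A i j * (z i - z j) ^ 2 := by
  have h1 : ∑ i, z i * ∑ j, A i j * (z i - z j) = ∑ i, ∑ j, A i j * (z i * (z i - z j)) := by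
    refine Finset.sum_congr rfl fun i _ => ?_
    rw [Finset.mul_sum]
    exact Finset.sum_congr rfl fun j _ => by ring
  have h2 : ∑ i, ∑ j, A i j * (z i * (z i - z j)) = ∑ i, ∑ j, A i j * (z j * (z j - z i)) := by
    rw [Finset.sum_comm]
    exact Finset.sum_congr rfl fun i _ => Finset.sum_congr rfl fun j _ => by
      rw [hA.apply_comm]
  have h3 : ∑ i, ∑ j, A i j * (z i - z j) ^ 2 =
      ∑ i, ∑ j, A i j * (z i * (z i - z j)) + ∑ i, ∑ j, A i j * (z j * (z j - z i)) := by
    rw [← Finset.sum_add_distrib]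
    refine Finset.sum_congr rfl fun i _ => ?_
    rw [← Finset.sum_add_distrib]
    exact Finset.sum_congr rfl fun j _ => by ring
  rw [h3, ← h2, h1]; ring

theorem laplacian_eq (z : Fin n → ℝ) (i : Fin n) :
    ∑ j, A i j * (z i - z j) = z i - ∑ j, A i j * z j := by
  simp only [mul_sub, Finset.sum_sub_distrib, ← Finset.sum_mul, hA.row_sum, one_mul]

theorem sum_mul_laplacian_eq (z : Fin n → ℝ) :
    ∑ i, z i * ∑ j, A i j * (z i - z j) = ∑ i, z i ^ 2 - ∑ i, z i * ∑ j, A i j * z j := by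
  rw [← Finset.sum_sub_distrib]
  exact Finset.sum_congr rfl fun i _ => by rw [hA.laplacian_eq]; ring

end IsSymmStochastic

theorem toEuclideanLin_apply_apply (A : Matrix (Fin n) (Fin n) ℝ) (z : EuclideanSpace ℝ (Fin n))
    (i : Fin n) : Matrix.toEuclideanLin A z i = ∑ j, A i j * z j := by
  simp [Matrix.toEuclideanLin, Matrix.mulVec, dotProduct]

theorem inner_euclidean_eq (z w : EuclideanSpace ℝ (Fin n)) : inner ℝ z w = ∑ i, z i * w i := by
  simp [PiLp.inner_apply, mul_comm]

namespace IsSymmStochastic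

variable {A : Matrix (Fin n) (Fin n) ℝ} (hA : IsSymmStochastic A)
include hA

theorem inner_toEuclideanLin_le (z : EuclideanSpace ℝ (Fin n)) :
    inner ℝ z (Matrix.toEuclideanLin A z) ≤ ‖z‖ ^ 2 := by
  rw [inner_euclidean_eq, ← real_inner_self_eq_norm_sq, inner_euclidean_eq]
  simp only [toEuclideanLin_apply_apply, ← pow_two]
  exact hA.sum_mul_mulVec_le z

theorem toEuclideanLin_one :
    Matrix.toEuclideanLin A (WithLp.toLp 2 fun _ => (1 : ℝ)) = WithLp.toLp 2 fun _ => (1 : ℝ) := by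
  ext i; rw [toEuclideanLin_apply_apply]; simp [hA.row_sum]

/-- On vectors with zero sum, the quadratic form of `A` is at most the second largest eigenvalue. -/
theorem sum_mul_mulVec_le_sortedEigenvalue (hn : 2 ≤ n) {z : Fin n → ℝ} (hz : ∑ i, z i = 0) :
    ∑ i, z i * ∑ j, A i j * z j ≤ sortedEigenvalue A 1 * ∑ i, z i ^ 2 := by
  have hlt : 1 < Fintype.card (Fin n) := by rw [Fintype.card_fin]; omega
  have hev : sortedEigenvalue A 1 = hA.isHermitian.eigenvalues₀ ⟨1, hlt⟩ :=
    dif_pos ⟨hA.isHermitian, hlt⟩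
  have hu : (WithLp.toLp 2 fun _ => (1 : ℝ) : EuclideanSpace ℝ (Fin n)) ≠ 0 := by
    intro h
    simpa using congrArg (fun w : EuclideanSpace ℝ (Fin n) => w ⟨0, by omega⟩) h
  have h := inner_apply_le_second_eigenvalue
    (Matrix.isSymmetric_toEuclideanLin_iff.2 hA.isHermitian) finrank_euclideanSpace hlt hu
    hA.toEuclideanLin_one hA.inner_toEuclideanLin_le (z := WithLp.toLp 2 z)
    (by rw [inner_euclidean_eq]; simpa using hz)
  rw [inner_euclidean_eq, ← real_inner_self_eq_norm_sq, inner_euclidean_eq] at h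
  simp only [toEuclideanLin_apply_apply, ← pow_two] at h
  rw [hev]
  exact h

/-- Identifies the last entry of `sortedEigenvalue` with the smallest eigenvalue of the associated
operator, whose eigenvalues are indexed by `Fin (Fintype.card (Fin n))`. -/
theorem sortedEigenvalue_last (hn : 2 ≤ n) :
    ∃ h : Fintype.card (Fin n) - 1 < Fintype.card (Fin n), sortedEigenvalue A (n - 1) =
      (Matrix.isSymmetric_toEuclideanLin_iff.2 hA.isHermitian).eigenvalues finrank_euclideanSpace
        ⟨Fintype.card (Fin n) - 1, h⟩ := by
  have hlt : n - 1 < Fintype.card (Fin n) := by rw [Fintype.card_fin]; omega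
  refine ⟨by rw [Fintype.card_fin]; omega, ?_⟩
  rw [sortedEigenvalue, dif_pos ⟨hA.isHermitian, hlt⟩, Matrix.IsHermitian.eigenvalues₀]
  congr 2
  rw [Fintype.card_fin]

theorem sum_laplacian_le (hn : 2 ≤ n) (z : Fin n → ℝ) :
    ∑ i, z i * ∑ j, A i j * (z i - z j) ≤
      (1 - sortedEigenvalue A (n - 1)) * ∑ i, z i ^ 2 := by
  obtain ⟨h0, hev⟩ := hA.sortedEigenvalue_last hn
  have h := le_inner_apply_of_eigenvalue
    (Matrix.isSymmetric_toEuclideanLin_iff.2 hA.isHermitian) finrank_euclideanSpace h0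
    (WithLp.toLp 2 z)
  rw [← hev, inner_euclidean_eq, ← real_inner_self_eq_norm_sq, inner_euclidean_eq] at h
  simp only [toEuclideanLin_apply_apply, ← pow_two] at h
  rw [hA.sum_mul_laplacian_eq]
  linarith

/-- The square of the Laplacian is at most `1 - λ_min` times the Laplacian. -/
theorem sum_laplacian_sq_le (hn : 2 ≤ n) (z : Fin n → ℝ) :
    ∑ i, (∑ j, A i j * (z i - z j)) ^ 2 ≤
      (1 - sortedEigenvalue A (n - 1)) * ∑ i, z i * ∑ j, A i j * (z i - z j) := by
  obtain ⟨h0, hev⟩ := hA.sortedEigenvalue_last hn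
  have h := norm_sub_apply_sq_le
    (Matrix.isSymmetric_toEuclideanLin_iff.2 hA.isHermitian) finrank_euclideanSpace h0
    hA.inner_toEuclideanLin_le (WithLp.toLp 2 z)
  rw [← hev, inner_euclidean_eq, ← real_inner_self_eq_norm_sq, inner_euclidean_eq] at h
  simp only [PiLp.sub_apply, toEuclideanLin_apply_apply, ← pow_two] at h
  simp only [hA.laplacian_eq]
  exact h

/-- The spectral gap controls the variance by the Laplacian form. -/
theorem gap_mul_variance_le (hn : 2 ≤ n) (z : Fin n → ℝ) :
    (1 - sortedEigenvalue A 1) * ∑ i, (z i - (1 / (n : ℝ)) * ∑ j, z j) ^ 2 ≤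
      ∑ i, z i * ∑ j, A i j * (z i - z j) := by
  set c := (1 / (n : ℝ)) * ∑ j, z j with hc
  have hn' : (n : ℝ) ≠ 0 := by positivity
  have h := hA.sum_mul_mulVec_le_sortedEigenvalue hn (z := fun i => z i - c) (by
    rw [Finset.sum_sub_distrib, hc]; simp; field_simp; ring)
  have e1 : ∑ i, z i * ∑ j, A i j * (z i - z j) =
      ∑ i, (z i - c) * ∑ j, A i j * ((z i - c) - (z j - c)) := by
    rw [hA.sum_mul_laplacian, hA.sum_mul_laplacian (fun i => z i - c)]
    simp
  rw [e1, hA.sum_mul_laplacian_eq (fun i => z i - c)]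
  linarith

/-- The second largest eigenvalue of a stochastic matrix is at least `-1`, so its spectral gap is at
most `2`. -/
theorem neg_one_le_sortedEigenvalue (hn : 2 ≤ n) : -1 ≤ sortedEigenvalue A 1 := by
  -- test the spectral bound on a difference of two coordinate vectors
  set i₀ : Fin n := ⟨0, by omega⟩
  set i₁ : Fin n := ⟨1, by omega⟩
  have h01 : i₀ ≠ i₁ := by simp [i₀, i₁]
  set z : Fin n → ℝ := Pi.single i₀ 1 - Pi.single i₁ 1 with hz
  have h1 := hA.sum_mul_mulVec_le_sortedEigenvalue hn (z := z) (by simp [hz])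
  have h2 := hA.sum_mul_mulVec_ge z
  have h3 : 0 < ∑ i, z i ^ 2 := by
    refine Finset.sum_pos' (fun i _ => sq_nonneg _) ⟨i₀, Finset.mem_univ _, ?_⟩
    simp [hz, h01]
  nlinarith

end IsSymmStochastic

/-! ### Powers of the mixing matrix -/

section Powers

variable {W : Matrix (Fin n) (Fin n) ℝ}

theorem IsMixingMatrix.isSymmStochastic (hW : IsMixingMatrix W) : IsSymmStochastic W :=
  ⟨hW.symm, hW.nonneg, hW.row_sum⟩

theorem sigmaTwo_nonneg (W : Matrix (Fin n) (Fin n) ℝ) : 0 ≤ sigmaTwo W :=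
  LinearMap.singularValues_nonneg _ _

/-- A mixing matrix contracts vectors with zero sum by the factor `σ₂`. -/
theorem IsMixingMatrix.sum_sq_mulVec_le (hW : IsMixingMatrix W) (hn : 2 ≤ n) {z : Fin n → ℝ}
    (hz : ∑ i, z i = 0) : ∑ i, (∑ j, W i j * z j) ^ 2 ≤ sigmaTwo W ^ 2 * ∑ i, z i ^ 2 := by
  have hS := hW.isSymmStochastic
  set T := Matrix.toEuclideanLin W
  have hlt : 1 < n := by omega
  have hfr : Module.finrank ℝ (EuclideanSpace ℝ (Fin n)) = n := by simp
  have hadj : T.adjoint = T := by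
    rw [← Matrix.toEuclideanLin_conjTranspose_eq_adjoint, hS.isHermitian.eq]
  have hnorm : ∀ w, inner ℝ w ((T.adjoint ∘ₗ T) w) = ‖T w‖ ^ 2 := fun w => by
    rw [LinearMap.comp_apply, LinearMap.adjoint_inner_right, real_inner_self_eq_norm_sq]
  have hTn : ∀ w : EuclideanSpace ℝ (Fin n), ‖T w‖ ^ 2 = ∑ i, (∑ j, W i j * w j) ^ 2 := fun w => by
    rw [← real_inner_self_eq_norm_sq, inner_euclidean_eq]
    simp only [T, toEuclideanLin_apply_apply, ← pow_two]
  have hu : (WithLp.toLp 2 fun _ => (1 : ℝ) : EuclideanSpace ℝ (Fin n)) ≠ 0 := by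
    intro h
    simpa using congrArg (fun w : EuclideanSpace ℝ (Fin n) => w ⟨0, by omega⟩) h
  have h := inner_apply_le_second_eigenvalue T.isSymmetric_adjoint_comp_self
    hfr hlt hu
    (by rw [LinearMap.comp_apply, hadj, hS.toEuclideanLin_one, hS.toEuclideanLin_one])
    (fun w => by
      rw [hnorm, hTn, ← real_inner_self_eq_norm_sq, inner_euclidean_eq]
      simp only [← pow_two]
      exact hS.sum_sq_mulVec_le w)
    (z := WithLp.toLp 2 z) (by rw [inner_euclidean_eq]; simpa using hz)
  rw [hnorm, hTn, ← T.sq_singularValues_of_lt hfr hlt, ← real_inner_self_eq_norm_sq,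
    inner_euclidean_eq] at h
  simp only [← pow_two] at h
  exact h

/-- Each row of `W ^ t` approaches the uniform distribution at the rate `σ₂ ^ t`. -/
theorem IsMixingMatrix.sum_sq_pow_sub_le (hW : IsMixingMatrix W) (hn : 2 ≤ n) (t : ℕ)
    (i : Fin n) : ∑ j, ((W ^ t) i j - 1 / (n : ℝ)) ^ 2 ≤ (sigmaTwo W ^ t) ^ 2 := by
  have hn' : (n : ℝ) ≠ 0 := by positivity
  have hmul : ∀ t j, (W ^ (t + 1)) i j - 1 / (n : ℝ) =
      ∑ k, W j k * ((W ^ t) i k - 1 / (n : ℝ)) := by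
    intro t j
    simp only [mul_sub, Finset.sum_sub_distrib, ← Finset.sum_mul, hW.row_sum, one_mul]
    rw [pow_succ, Matrix.mul_apply]
    congr 1
    exact Finset.sum_congr rfl fun k _ => by rw [hW.isSymmStochastic.apply_comm, mul_comm]
  have hsum : ∀ t, ∑ j, ((W ^ t) i j - 1 / (n : ℝ)) = 0 := fun t => by
    rw [Finset.sum_sub_distrib, (hW.isSymmStochastic_pow t).row_sum]; simp [hn']
  induction t with
  | zero =>
    have h1 : ∀ j, ((W ^ 0) i j - 1 / (n : ℝ)) ^ 2 =
        (if i = j then 1 - 2 / (n : ℝ) else 0) + 1 / (n : ℝ) ^ 2 := fun j => by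
      rw [pow_zero, Matrix.one_apply]; split_ifs <;> ring
    simp only [h1, Finset.sum_add_distrib]
    simp
    have : (0 : ℝ) ≤ 1 / n := by positivity
    have e : (n : ℝ) * ((n : ℝ) ^ 2)⁻¹ = 1 / n := by field_simp
    have e2 : (2 : ℝ) / n = 2 * (1 / n) := by ring
    rw [e, e2]; linarith
  | succ t ih =>
    have h := hW.sum_sq_mulVec_le hn (hsum t)
    simp only [hmul]
    refine h.trans ?_
    rw [pow_succ (sigmaTwo W) t, mul_pow, mul_comm]
    gcongr

/-- With `t ≥ log_{σ₂}(1 / (2 √n))` rounds of communication, each row of `W ^ t` is within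
`1 / (2 √n)` of the uniform distribution. -/
theorem IsMixingMatrix.sum_sq_pow_sub_le_of_logb (hW : IsMixingMatrix W) (hn : 2 ≤ n) {t : ℕ}
    (ht : 1 ≤ t) (hlog : ⌈Real.logb (sigmaTwo W) (1 / (2 * √(n : ℝ)))⌉ ≤ (t : ℤ)) (i : Fin n) :
    ∑ j, ((W ^ t) i j - 1 / (n : ℝ)) ^ 2 ≤ (1 : ℝ) / (4 * n) := by
  refine (hW.sum_sq_pow_sub_le hn t i).trans ?_
  have hn' : (0 : ℝ) < n := by positivity
  have key : sigmaTwo W ^ t ≤ 1 / (2 * √(n : ℝ)) := by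
    rcases (sigmaTwo_nonneg W).eq_or_lt with h0 | h0
    · rw [← h0, zero_pow (by omega)]; positivity
    · rw [Int.ceil_le, Int.cast_natCast, Real.logb_le_iff_le_rpow_of_base_lt_one h0
        hW.sigmaTwo_lt_one (by positivity), Real.rpow_natCast] at hlog
      exact hlog
  have h2 := pow_le_pow_left₀ (pow_nonneg (sigmaTwo_nonneg W) t) key 2
  rw [div_pow, mul_pow, Real.sq_sqrt hn'.le] at h2
  refine h2.trans (le_of_eq (by norm_num))

end Powers

end Mixing

/-! ### The consensus energy -/

section Energy

variable {n d r : ℕ} {A : Matrix (Fin n) (Fin n) ℝ} {x : Fin n → Matrix (Fin d) (Fin r) ℝ}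

local notation "⟪" x ", " y "⟫" => inner ℝ x y

/-- The block `∑ⱼ Aᵢⱼ (xᵢ - xⱼ)` of the Euclidean gradient of the consensus potential. -/
def laplacian (A : Matrix (Fin n) (Fin n) ℝ) (x : Fin n → Matrix (Fin d) (Fin r) ℝ) (i : Fin n) :
    Matrix (Fin d) (Fin r) ℝ :=
  ∑ j, A i j • (x i - x j)

/-- Twice the consensus potential: `∑ᵢ ⟪xᵢ, ∑ⱼ Aᵢⱼ (xᵢ - xⱼ)⟫ = (1/2) ∑ᵢⱼ Aᵢⱼ ‖xᵢ - xⱼ‖²`. -/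
def energy (A : Matrix (Fin n) (Fin n) ℝ) (x : Fin n → Matrix (Fin d) (Fin r) ℝ) : ℝ :=
  ∑ i, ⟪x i, laplacian A x i⟫

theorem gradPhi_eq (W : Matrix (Fin n) (Fin n) ℝ) (t : ℕ) (x : Fin n → Matrix (Fin d) (Fin r) ℝ)
    (i : Fin n) : gradPhi W t x i = tangentProj (x i) (laplacian (W ^ t) x i) := rfl

theorem laplacian_apply (i : Fin n) (a : Fin d) (b : Fin r) :
    laplacian A x i a b = ∑ j, A i j * (x i a b - x j a b) := by
  simp [laplacian, Matrix.sum_apply]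

theorem sum_inner_eq (x y : Fin n → Matrix (Fin d) (Fin r) ℝ) :
    ∑ i, ⟪x i, y i⟫ = ∑ a, ∑ b, ∑ i, x i a b * y i a b := by
  simp only [inner_eq_sum]
  rw [Finset.sum_comm]
  exact Finset.sum_congr rfl fun a _ => Finset.sum_comm

theorem sum_norm_sq_eq (x : Fin n → Matrix (Fin d) (Fin r) ℝ) :
    ∑ i, ‖x i‖ ^ 2 = ∑ a, ∑ b, ∑ i, x i a b ^ 2 := by
  simp only [← real_inner_self_eq_norm_sq]
  rw [sum_inner_eq]
  simp only [pow_two]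

theorem energy_eq_sum_entries (A : Matrix (Fin n) (Fin n) ℝ)
    (x : Fin n → Matrix (Fin d) (Fin r) ℝ) :
    energy A x = ∑ a, ∑ b, ∑ i, x i a b * ∑ j, A i j * (x i a b - x j a b) := by
  rw [energy, sum_inner_eq]
  simp only [laplacian_apply]

theorem laplacian_sub_const (y : Matrix (Fin d) (Fin r) ℝ) :
    laplacian A (fun i => x i - y) = laplacian A x := by
  funext i; simp [laplacian]

variable (hA : IsSymmStochastic A)
include hA

theorem IsSymmStochastic.laplacian_eq_sub (i : Fin n) :
    laplacian A x i = x i - ∑ j, A i j • x j := by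
  simp only [laplacian, smul_sub, Finset.sum_sub_distrib, ← Finset.sum_smul, hA.row_sum, one_smul]

theorem IsSymmStochastic.sum_laplacian : ∑ i, laplacian A x i = 0 := by
  simp only [hA.laplacian_eq_sub, Finset.sum_sub_distrib]
  rw [Finset.sum_comm]
  simp only [← Finset.sum_smul, hA.col_sum, one_smul, sub_self]

theorem IsSymmStochastic.energy_sub_const (y : Matrix (Fin d) (Fin r) ℝ) :
    energy A (fun i => x i - y) = energy A x := by
  simp only [energy, laplacian_sub_const, inner_sub_left, Finset.sum_sub_distrib, ← inner_sum,
    hA.sum_laplacian, inner_zero_right, sub_zero]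

theorem IsSymmStochastic.energy_eq :
    energy A x = (1 / 2) * ∑ i, ∑ j, A i j * ‖x i - x j‖ ^ 2 := by
  have h1 : energy A x = ∑ i, ∑ j, A i j * ⟪x i, x i - x j⟫ := by
    simp only [energy, laplacian, inner_sum, inner_smul_right]
  have h2 : energy A x = ∑ i, ∑ j, A i j * ⟪x j, x j - x i⟫ := by
    rw [h1, Finset.sum_comm]
    exact Finset.sum_congr rfl fun i _ => Finset.sum_congr rfl fun j _ => by rw [hA.apply_comm]
  have h3 : ∑ i, ∑ j, A i j * ‖x i - x j‖ ^ 2 = energy A x + energy A x := by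
    nth_rw 1 [h1, h2, ← Finset.sum_add_distrib]
    refine Finset.sum_congr rfl fun i _ => ?_
    rw [← Finset.sum_add_distrib]
    refine Finset.sum_congr rfl fun j _ => ?_
    rw [← real_inner_self_eq_norm_sq, ← mul_add, inner_sub_left, ← neg_sub (x i) (x j),
      inner_neg_right, ← sub_eq_add_neg]
  rw [h3]; ring

theorem IsSymmStochastic.energy_nonneg : 0 ≤ energy A x := by
  rw [hA.energy_eq]
  exact mul_nonneg (by norm_num) (Finset.sum_nonneg fun i _ => Finset.sum_nonneg fun j _ =>
    mul_nonneg (hA.nonneg i j) (sq_nonneg _))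

theorem IsSymmStochastic.energy_le (hn : 2 ≤ n) (y : Matrix (Fin d) (Fin r) ℝ) :
    energy A x ≤ (1 - sortedEigenvalue A (n - 1)) * ∑ i, ‖x i - y‖ ^ 2 := by
  rw [← hA.energy_sub_const y, energy_eq_sum_entries, sum_norm_sq_eq, Finset.mul_sum]
  simp only [Finset.mul_sum (Finset.univ : Finset (Fin r))]
  exact Finset.sum_le_sum fun a _ => Finset.sum_le_sum fun b _ => hA.sum_laplacian_le hn _

theorem IsSymmStochastic.energy_le_two_mul (y : Matrix (Fin d) (Fin r) ℝ) :
    energy A x ≤ 2 * ∑ i, ‖x i - y‖ ^ 2 := by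
  rw [← hA.energy_sub_const y, energy_eq_sum_entries, sum_norm_sq_eq, Finset.mul_sum]
  simp only [Finset.mul_sum (Finset.univ : Finset (Fin r))]
  refine Finset.sum_le_sum fun a _ => Finset.sum_le_sum fun b _ => ?_
  have h1 := hA.sum_mul_laplacian_eq fun i => (x i - y) a b
  have h2 := hA.sum_mul_mulVec_ge fun i => (x i - y) a b
  linarith

theorem IsSymmStochastic.sum_norm_laplacian_sq_le (hn : 2 ≤ n) :
    ∑ i, ‖laplacian A x i‖ ^ 2 ≤ (1 - sortedEigenvalue A (n - 1)) * energy A x := by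
  rw [energy_eq_sum_entries, sum_norm_sq_eq, Finset.mul_sum]
  simp only [Finset.mul_sum (Finset.univ : Finset (Fin r)), laplacian_apply]
  exact Finset.sum_le_sum fun a _ => Finset.sum_le_sum fun b _ => hA.sum_laplacian_sq_le hn _

theorem IsSymmStochastic.gap_mul_le_energy (hn : 2 ≤ n) :
    (1 - sortedEigenvalue A 1) * ∑ i, ‖x i - euclMean x‖ ^ 2 ≤ energy A x := by
  rw [energy_eq_sum_entries, sum_norm_sq_eq, Finset.mul_sum]
  simp only [Finset.mul_sum (Finset.univ : Finset (Fin r))]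
  refine Finset.sum_le_sum fun a _ => Finset.sum_le_sum fun b _ => ?_
  have h := hA.gap_mul_variance_le hn fun i => x i a b
  simpa [euclMean, Matrix.sum_apply] using h

omit hA in
/-- The bias-variance decomposition around an arbitrary point `y`. -/
theorem sum_norm_sub_euclMean_sq (hn : n ≠ 0) (y : Matrix (Fin d) (Fin r) ℝ) :
    ∑ i, ‖x i - euclMean x‖ ^ 2 = ∑ i, ‖x i - y‖ ^ 2 - n * ‖euclMean x - y‖ ^ 2 := by
  have hn' : (n : ℝ) ≠ 0 := by positivity
  have hs : ∑ i, (x i - y) = (n : ℝ) • (euclMean x - y) := by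
    rw [Finset.sum_sub_distrib, euclMean, smul_sub, smul_smul, mul_one_div_cancel hn', one_smul]
    simp [← Nat.cast_smul_eq_nsmul ℝ]
  have h : ∀ i, ‖x i - euclMean x‖ ^ 2 =
      ‖x i - y‖ ^ 2 - 2 * ⟪x i - y, euclMean x - y⟫ + ‖euclMean x - y‖ ^ 2 := fun i => by
    rw [← norm_sub_sq_real, sub_sub_sub_cancel_right]
  simp only [h, Finset.sum_add_distrib, Finset.sum_sub_distrib, ← Finset.mul_sum, ← sum_inner, hs,
    inner_smul_left, real_inner_self_eq_norm_sq]
  simp; ring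

/-! ### The Riemannian gradient of the consensus potential -/

omit hA in
/-- Only the symmetric part of `xᵀ (x - y)` is seen by a symmetric matrix. -/
theorem inner_transpose_mul_sub {Q : Matrix (Fin r) (Fin r) ℝ} (hQ : Qᵀ = Q)
    {x y : Matrix (Fin d) (Fin r) ℝ} (hx : x ∈ stiefel d r) (hy : y ∈ stiefel d r) :
    ⟪Q, xᵀ * (x - y)⟫ = (1 / 2) * ⟪Q, (x - y)ᵀ * (x - y)⟫ := by
  have h1 : ⟪Q, xᵀ * (x - y)⟫ = ⟪Q, (x - y)ᵀ * x⟫ := by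
    rw [← inner_transpose, hQ]; simp
  rw [← transpose_mul_sub_add hx hy, inner_add_right, ← h1]; ring

omit hA in
/-- The normal part of the Euclidean gradient of the consensus potential is quadratic in the
differences `xᵢ - xⱼ`. -/
theorem laplacian_sub_tangentProj (hx : ∀ i, x i ∈ stiefel d r) (i : Fin n) :
    laplacian A x i - tangentProj (x i) (laplacian A x i) =
      (1 / 2 : ℝ) • (x i * ∑ j, A i j • ((x i - x j)ᵀ * (x i - x j))) := by
  rw [tangentProj, sub_sub_cancel, laplacian]
  congr 2
  simp only [Matrix.mul_sum, Matrix.transpose_sum, Matrix.sum_mul, Matrix.transpose_smul,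
    Matrix.mul_smul, Matrix.smul_mul, ← Finset.sum_add_distrib, ← smul_add,
    transpose_mul_sub_add (hx i) (hx _)]

theorem IsSymmStochastic.norm_laplacian_sub_tangentProj_le (hx : ∀ i, x i ∈ stiefel d r)
    (i : Fin n) :
    ‖laplacian A x i - tangentProj (x i) (laplacian A x i)‖ ≤
      (1 / 2) * ∑ j, A i j * ‖x i - x j‖ ^ 2 := by
  rw [laplacian_sub_tangentProj hx, norm_smul, norm_mul_of_orthonormal (hx i)]
  rw [Real.norm_of_nonneg (by norm_num)]
  refine mul_le_mul_of_nonneg_left ((norm_sum_le _ _).trans (Finset.sum_le_sum fun j _ => ?_))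
    (by norm_num)
  rw [norm_smul, Real.norm_of_nonneg (hA.nonneg i j)]
  exact mul_le_mul_of_nonneg_left (norm_transpose_mul_self_le _) (hA.nonneg i j)

/-- The Euclidean gradients of the consensus potential sum to zero, so only the normal parts
contribute to the sum of the Riemannian gradients. -/
theorem IsSymmStochastic.norm_sum_tangentProj_laplacian_le (hx : ∀ i, x i ∈ stiefel d r) :
    ‖∑ i, tangentProj (x i) (laplacian A x i)‖ ≤ energy A x := by
  have h : ∑ i, tangentProj (x i) (laplacian A x i) =
      -∑ i, (laplacian A x i - tangentProj (x i) (laplacian A x i)) := by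
    rw [Finset.sum_sub_distrib, hA.sum_laplacian, zero_sub, neg_neg]
  rw [h, norm_neg, hA.energy_eq, Finset.mul_sum]
  exact (norm_sum_le _ _).trans
    (Finset.sum_le_sum fun i _ => hA.norm_laplacian_sub_tangentProj_le hx i)

theorem IsSymmStochastic.sum_norm_tangentProj_laplacian_sq_le (hn : 2 ≤ n)
    (hx : ∀ i, x i ∈ stiefel d r) :
    ∑ i, ‖tangentProj (x i) (laplacian A x i)‖ ^ 2 ≤
      (1 - sortedEigenvalue A (n - 1)) * energy A x :=
  (Finset.sum_le_sum fun i _ => pow_le_pow_left₀ (norm_nonneg _)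
    (norm_tangentProj_le (hx i) _) 2).trans (hA.sum_norm_laplacian_sq_le hn)

/-- The restricted secant inequality: near the diagonal, the Riemannian gradient of the consensus
potential is positively correlated with the deviation from any reference point `y`. -/
theorem IsSymmStochastic.energy_le_sum_inner (hx : ∀ i, x i ∈ stiefel d r)
    {y : Matrix (Fin d) (Fin r) ℝ} (hy : y ∈ stiefel d r) {δ : ℝ}
    (hδ : ∀ i, ‖x i - y‖ ≤ δ) :
    (1 - δ ^ 2 / 2) * energy A x ≤
      ∑ i, ⟪x i - y, tangentProj (x i) (laplacian A x i)⟫ := by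
  have hi : ∀ i, ⟪x i - y, laplacian A x i⟫ - (δ ^ 2 / 4) * ∑ j, A i j * ‖x i - x j‖ ^ 2 ≤
      ⟪x i - y, tangentProj (x i) (laplacian A x i)⟫ := by
    intro i
    set Q := (x i - y)ᵀ * (x i - y) with hQ
    have hQT : Qᵀ = Q := by simp [hQ]
    have h1 : ⟪x i * Q, laplacian A x i⟫ ≤ (δ ^ 2 / 2) * ∑ j, A i j * ‖x i - x j‖ ^ 2 := by
      rw [inner_mul_left_eq, laplacian, Matrix.mul_sum, inner_sum, Finset.mul_sum]
      refine Finset.sum_le_sum fun j _ => ?_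
      rw [Matrix.mul_smul, inner_smul_right, inner_transpose_mul_sub hQT (hx i) (hx j)]
      have h2 : ⟪Q, (x i - x j)ᵀ * (x i - x j)⟫ ≤ δ ^ 2 * ‖x i - x j‖ ^ 2 :=
        (real_inner_le_norm _ _).trans (mul_le_mul
          ((norm_transpose_mul_self_le _).trans (pow_le_pow_left₀ (norm_nonneg _) (hδ i) 2))
          (norm_transpose_mul_self_le _) (norm_nonneg _) (sq_nonneg _))
      have := mul_le_mul_of_nonneg_left h2 (hA.nonneg i j)
      linarith
    rw [← inner_tangentProj, tangentProj_sub_eq (hx i) hy, inner_sub_left (x i - y), inner_smul_left]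
    simp only [conj_trivial]
    linarith
  have hs := Finset.sum_le_sum fun i (_ : i ∈ Finset.univ) => hi i
  rw [Finset.sum_sub_distrib, ← Finset.mul_sum] at hs
  have h1 : ∑ i, ⟪x i - y, laplacian A x i⟫ = energy A x := by
    rw [← hA.energy_sub_const y, energy, laplacian_sub_const]
  have h2 := hA.energy_eq (x := x)
  rw [h1] at hs
  have h3 : ∑ i, ∑ j, A i j * ‖x i - x j‖ ^ 2 = 2 * energy A x := by linarith
  rw [h3] at hs
  linarith

end Energy

/-! ### One step of the algorithm -/

section Step

local notation "⟪" x ", " y "⟫" => inner ℝ x y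

/-- The standing relations between the network, the radii `δ₁, δ₂` of the consensus region, the
consensus stepsize `α` and the rate `ρ`. -/
structure ConsensusParams {n : ℕ} (r : ℕ) (W : Matrix (Fin n) (Fin n) ℝ) (t : ℕ)
    (δ₁ δ₂ α ρ : ℝ) : Prop where
  two_le : 2 ≤ n
  one_le : 1 ≤ r
  stoch : IsSymmStochastic (W ^ t)
  row : ∀ i, ∑ j, ((W ^ t) i j - 1 / (n : ℝ)) ^ 2 ≤ (1 : ℝ) / (4 * n)
  δ₁_pos : 0 < δ₁
  δ₁_le : δ₁ ≤ δ₂ / (5 * √(r : ℝ))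
  δ₂_le : δ₂ ≤ 1 / 6
  α_pos : 0 < α
  α_le_one : α ≤ 1
  α_mul_le : α * consensusLip W t ≤ 1 - δ₂ ^ 2 / 2
  ρ_eq : ρ = rhoT r δ₁ δ₂ α W t
  ρ_lt_one : ρ < 1

/-- The root mean square consensus error `(1/√n) ‖𝐱 - 𝐱̄‖`. -/
def consensusErr {n d r : ℕ} (x : Fin n → Matrix (Fin d) (Fin r) ℝ) : ℝ :=
  √(1 / (n : ℝ) * consensusErrSq x)

theorem consensusErr_nonneg {n d r : ℕ} (x : Fin n → Matrix (Fin d) (Fin r) ℝ) :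
    0 ≤ consensusErr x := Real.sqrt_nonneg _

theorem consensusErr_sq {n d r : ℕ} (x : Fin n → Matrix (Fin d) (Fin r) ℝ) :
    consensusErr x ^ 2 = 1 / (n : ℝ) * consensusErrSq x :=
  Real.sq_sqrt (mul_nonneg (by positivity) (consensusErrSq_nonneg x))

/-- Minkowski's inequality for families of vectors. -/
theorem sqrt_sum_norm_add_sq_le {ι E : Type*} [Fintype ι] [SeminormedAddCommGroup E]
    (a b : ι → E) :
    √(∑ i, ‖a i + b i‖ ^ 2) ≤ √(∑ i, ‖a i‖ ^ 2) + √(∑ i, ‖b i‖ ^ 2) := by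
  have h := norm_add_le (WithLp.toLp 2 a : PiLp 2 fun _ : ι => E) (WithLp.toLp 2 b)
  simpa [PiLp.norm_eq_of_L2] using h

namespace ConsensusParams

variable {n d r t : ℕ} {W : Matrix (Fin n) (Fin n) ℝ} {δ₁ δ₂ α ρ : ℝ}
  (hp : ConsensusParams r W t δ₁ δ₂ α ρ)
include hp

theorem n_pos : (0 : ℝ) < n := by
  have := hp.two_le
  exact_mod_cast (by omega : 0 < n)

theorem δ₂_nonneg : 0 ≤ δ₂ := by
  by_contra h
  push Not at h
  have := hp.δ₁_pos.trans_le hp.δ₁_le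
  exact absurd (div_nonpos_of_nonpos_of_nonneg h.le (by positivity)) (not_le.2 this)

theorem sqrt_mul_δ₁_le : √(r : ℝ) * δ₁ ≤ δ₂ / 5 := by
  have hr : 0 < √(r : ℝ) := Real.sqrt_pos.2 (by exact_mod_cast hp.one_le)
  have h := hp.δ₁_le
  rw [le_div_iff₀ (by positivity)] at h
  linarith

theorem δ₁_le' : δ₁ ≤ δ₂ / 5 := by
  have hr : 1 ≤ √(r : ℝ) := Real.one_le_sqrt.2 (by exact_mod_cast hp.one_le)
  have := hp.sqrt_mul_δ₁_le
  nlinarith [hp.δ₁_pos]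

theorem δ₁_le_const : δ₁ ≤ 1 / 30 := by linarith [hp.δ₁_le', hp.δ₂_le]

theorem r_mul_δ₁_sq_le : r * δ₁ ^ 2 ≤ δ₂ ^ 2 / 25 := by
  have h := pow_le_pow_left₀ (mul_nonneg (Real.sqrt_nonneg _) hp.δ₁_pos.le) hp.sqrt_mul_δ₁_le 2
  rw [mul_pow, Real.sq_sqrt (Nat.cast_nonneg r)] at h
  linarith

theorem δ₂_sq_le : δ₂ ^ 2 ≤ 1 / 36 := by
  nlinarith [hp.δ₂_le, hp.δ₂_nonneg]

theorem ρ_nonneg : 0 ≤ ρ := by rw [hp.ρ_eq]; exact Real.sqrt_nonneg _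

theorem one_sub_le_ρ_sq : 1 - gammaT r δ₁ δ₂ W t * α ≤ ρ ^ 2 := by
  rw [hp.ρ_eq, rhoT]
  by_cases h : 0 ≤ 1 - gammaT r δ₁ δ₂ W t * α
  · rw [Real.sq_sqrt h]
  · exact (not_le.1 h).le.trans (sq_nonneg _)

theorem gamma_mul_pos : 0 < gammaT r δ₁ δ₂ W t * α := by
  have := hp.one_sub_le_ρ_sq
  nlinarith [hp.ρ_nonneg, hp.ρ_lt_one]

theorem factor_pos : 0 < (1 - 4 * r * δ₁ ^ 2) * (1 - δ₂ ^ 2 / 2) := by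
  have h1 := hp.r_mul_δ₁_sq_le
  have h2 := hp.δ₂_sq_le
  exact mul_pos (by nlinarith) (by linarith)

theorem gap_pos : 0 < 1 - sortedEigenvalue (W ^ t) 1 := by
  have h := pos_of_mul_pos_left hp.gamma_mul_pos hp.α_pos.le
  rw [gammaT] at h
  exact pos_of_mul_pos_right h hp.factor_pos.le

/-- The consensus stepsize is bounded below in terms of the rate, since the spectral gap is at most
`2`. -/
theorem one_sub_ρ_le : 1 - ρ ≤ 2 * α := by
  have h1 := hp.one_sub_le_ρ_sq
  have h2 := hp.stoch.neg_one_le_sortedEigenvalue hp.two_le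
  have h3 : (1 - 4 * r * δ₁ ^ 2) * (1 - δ₂ ^ 2 / 2) ≤ 1 := by
    have h4 : (0 : ℝ) ≤ 4 * r * δ₁ ^ 2 := by positivity
    have h5 := hp.δ₂_sq_le
    exact mul_le_one₀ (by linarith) (by linarith) (by linarith [sq_nonneg δ₂])
  have h4 : gammaT r δ₁ δ₂ W t ≤ 2 := by
    rw [gammaT]
    nlinarith [hp.gap_pos]
  have h5 : gammaT r δ₁ δ₂ W t * α ≤ 2 * α := mul_le_mul_of_nonneg_right h4 hp.α_pos.le
  nlinarith [hp.ρ_nonneg, hp.ρ_lt_one]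

variable {x : Fin n → Matrix (Fin d) (Fin r) ℝ}

theorem consensusErr_le (hx : x ∈ consensusRegion n d r δ₁ δ₂) : consensusErr x ≤ δ₁ := by
  refine Real.sqrt_le_iff.2 ⟨hp.δ₁_pos.le, ?_⟩
  rw [one_div, inv_mul_le_iff₀ hp.n_pos]
  exact hx.2.1

theorem stiefel_nonempty (hx : ∀ i, x i ∈ stiefel d r) : (stiefel d r).Nonempty :=
  ⟨_, hx ⟨0, by have := hp.two_le; omega⟩⟩

theorem n_ne_zero : n ≠ 0 := by have := hp.two_le; omega

/-- The bound with factor `α` absorbed by the condition on the consensus stepsize. -/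
theorem energy_le_sq : α * ((1 / (n : ℝ)) * energy (W ^ t) x) ≤ consensusErr x ^ 2 := by
  have h1 := hp.stoch.energy_le (x := x) hp.two_le (iam x)
  have h2 : α * energy (W ^ t) x ≤ consensusErrSq x := by
    have h3 : (1 - δ₂ ^ 2 / 2) * consensusErrSq x ≤ 1 * consensusErrSq x :=
      mul_le_mul_of_nonneg_right (by nlinarith) (consensusErrSq_nonneg x)
    have h4 := mul_le_mul_of_nonneg_right hp.α_mul_le (consensusErrSq_nonneg x)
    have h5 := mul_le_mul_of_nonneg_left h1 hp.α_pos.le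
    have h6 : α * ((1 - sortedEigenvalue (W ^ t) (n - 1)) * ∑ i, ‖x i - iam x‖ ^ 2) =
      α * consensusLip W t * consensusErrSq x := by rw [consensusLip, consensusErrSq]; ring
    linarith
  rw [consensusErr_sq]
  have := mul_le_mul_of_nonneg_left h2 (one_div_nonneg.2 hp.n_pos.le)
  linarith

theorem energy_le_δ₁ (hx : x ∈ consensusRegion n d r δ₁ δ₂) :
    (1 / (n : ℝ)) * energy (W ^ t) x ≤ 2 * δ₁ ^ 2 := by
  have h1 := hp.stoch.energy_le_two_mul (x := x) (iam x)
  have h2 : energy (W ^ t) x ≤ n * (2 * δ₁ ^ 2) := by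
    have := hx.2.1
    rw [consensusErrSq] at this
    linarith
  rw [one_div, inv_mul_le_iff₀ hp.n_pos]
  exact h2

theorem sum_norm_gradPhi_sq_le (hx : ∀ i, x i ∈ stiefel d r) :
    α ^ 2 * ∑ i, ‖gradPhi W t x i‖ ^ 2 ≤ α * (1 - δ₂ ^ 2 / 2) * energy (W ^ t) x := by
  have h1 := hp.stoch.sum_norm_tangentProj_laplacian_sq_le hp.two_le hx
  have h2 := mul_le_mul_of_nonneg_left h1 (sq_nonneg α)
  have h3 := mul_le_mul_of_nonneg_right hp.α_mul_le
    (mul_nonneg hp.α_pos.le (hp.stoch.energy_nonneg (x := x)))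
  simp only [← gradPhi_eq, consensusLip] at h2 h3
  nlinarith

/-- The consensus part of the step contracts the distance to the induced arithmetic mean. -/
theorem sum_norm_sub_sq_le (hx : x ∈ consensusRegion n d r δ₁ δ₂) :
    ∑ i, ‖x i - iam x - α • gradPhi W t x i‖ ^ 2 ≤ ρ ^ 2 * consensusErrSq x := by
  obtain ⟨hxS, hx1, hx2⟩ := hx
  have hxN : x ∈ consensusRegion n d r δ₁ δ₂ := ⟨hxS, hx1, hx2⟩
  have hy := (isIAM_iam (x := x) (hp.stiefel_nonempty hxS)).1
  have h1 := hp.stoch.energy_le_sum_inner hxS hy hx2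
  have h2 := hp.sum_norm_gradPhi_sq_le hxS
  have h3 := hp.stoch.gap_mul_le_energy (x := x) hp.two_le
  have h4 : (1 - 4 * r * δ₁ ^ 2) * consensusErrSq x ≤ ∑ i, ‖x i - euclMean x‖ ^ 2 := by
    rw [sum_norm_sub_euclMean_sq hp.n_ne_zero (iam x)]
    have h5 := norm_euclMean_sub_iam_le hp.n_ne_zero hxS
    rw [← consensusErr_sq] at h5
    have h6 := pow_le_pow_left₀ (norm_nonneg _) h5 2
    have h7 := hp.consensusErr_le hxN
    have h8 : consensusErr x ^ 2 ≤ δ₁ ^ 2 := pow_le_pow_left₀ (consensusErr_nonneg x) h7 2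
    have h9 : (1 : ℝ) ≤ r := by exact_mod_cast hp.one_le
    have h10 : ‖euclMean x - iam x‖ ^ 2 ≤ 4 * r * δ₁ ^ 2 * consensusErr x ^ 2 := by
      have e1 : (1 / 2 * consensusErr x ^ 2) ^ 2 ≤ δ₁ ^ 2 * consensusErr x ^ 2 := by
        nlinarith [sq_nonneg (consensusErr x)]
      have e2 : 1 * (δ₁ ^ 2 * consensusErr x ^ 2) ≤ 4 * r * (δ₁ ^ 2 * consensusErr x ^ 2) :=
        mul_le_mul_of_nonneg_right (by linarith) (by positivity)
      linarith
    have h11 := mul_le_mul_of_nonneg_left h10 hp.n_pos.le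
    have h12 : n * (4 * r * δ₁ ^ 2 * consensusErr x ^ 2) = 4 * r * δ₁ ^ 2 * consensusErrSq x := by
      rw [consensusErr_sq]
      have := hp.n_pos.ne'
      field_simp
    rw [h12] at h11
    have h13 : ∑ i, ‖x i - iam x‖ ^ 2 = consensusErrSq x := rfl
    rw [h13]; linarith
  have h5 : ∑ i, ‖x i - iam x - α • gradPhi W t x i‖ ^ 2 = consensusErrSq x -
      2 * α * ∑ i, ⟪x i - iam x, gradPhi W t x i⟫ + α ^ 2 * ∑ i, ‖gradPhi W t x i‖ ^ 2 := by
    rw [consensusErrSq, Finset.mul_sum, Finset.mul_sum, ← Finset.sum_sub_distrib,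
      ← Finset.sum_add_distrib]
    refine Finset.sum_congr rfl fun i _ => ?_
    rw [norm_sub_sq_real, inner_smul_right, norm_smul, mul_pow, Real.norm_eq_abs, sq_abs]
    ring
  simp only [← gradPhi_eq] at h1
  -- half of the secant inequality absorbs the quadratic term, the other half gives the rate
  have h6 : ∑ i, ‖x i - iam x - α • gradPhi W t x i‖ ^ 2 ≤
      consensusErrSq x - α * ((1 - δ₂ ^ 2 / 2) * energy (W ^ t) x) := by
    rw [h5]
    nlinarith [mul_le_mul_of_nonneg_left h1 hp.α_pos.le]
  have hq : 0 ≤ 1 - δ₂ ^ 2 / 2 := by linarith [hp.δ₂_sq_le]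
  have h7 : gammaT r δ₁ δ₂ W t * consensusErrSq x ≤ (1 - δ₂ ^ 2 / 2) * energy (W ^ t) x := by
    have e1 := mul_le_mul_of_nonneg_left h4 hp.gap_pos.le
    have e2 := mul_le_mul_of_nonneg_left (e1.trans h3) hq
    rw [gammaT]; linarith
  have h8 := mul_le_mul_of_nonneg_right hp.one_sub_le_ρ_sq (consensusErrSq_nonneg x)
  have h9 := mul_le_mul_of_nonneg_left h7 hp.α_pos.le
  linarith

variable {u x' : Fin n → Matrix (Fin d) (Fin r) ℝ} {b : ℝ}

omit hp in
theorem step_mem_tangentSpace (hx : ∀ i, x i ∈ stiefel d r) (hu : ∀ i, u i ∈ tangentSpace (x i))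
    (i : Fin n) : -(α • gradPhi W t x i) - u i ∈ tangentSpace (x i) := by
  rw [← smul_neg, ← neg_one_smul ℝ (gradPhi W t x i), smul_smul]
  exact sub_mem_tangentSpace (smul_mem_tangentSpace _ (tangentProj_mem (hx i) _)) (hu i)

omit hp in
theorem step_mem_stiefel (hx : ∀ i, x i ∈ stiefel d r) (hu : ∀ i, u i ∈ tangentSpace (x i))
    (hx' : ∀ i, x' i = polarRetraction (x i) (-(α • gradPhi W t x i) - u i)) (i : Fin n) :
    x' i ∈ stiefel d r := by
  rw [hx' i]; exact polarRetraction_mem (hx i) (step_mem_tangentSpace hx hu i)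

/-- The consensus error contracts up to the size `b` of the gradient steps. -/
theorem consensusErr_step_le (hx : x ∈ consensusRegion n d r δ₁ δ₂)
    (hu : ∀ i, u i ∈ tangentSpace (x i)) (hub : ∀ i, ‖u i‖ ≤ b)
    (hx' : ∀ i, x' i = polarRetraction (x i) (-(α • gradPhi W t x i) - u i)) :
    consensusErr x' ≤ ρ * consensusErr x + b := by
  have hne := hp.stiefel_nonempty hx.1
  have hy := (isIAM_iam (x := x) hne).1
  have hb : 0 ≤ b := (norm_nonneg _).trans (hub ⟨0, by have := hp.two_le; omega⟩)
  have h1 : consensusErrSq x' ≤ ∑ i, ‖x' i - iam x‖ ^ 2 := by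
    have := (isIAM_iam (x := x') hne).2 _ hy
    simpa only [consensusErrSq, norm_sub_rev] using this
  have h2 : ∑ i, ‖x' i - iam x‖ ^ 2 ≤ ∑ i, ‖(x i - iam x - α • gradPhi W t x i) + -u i‖ ^ 2 := by
    refine Finset.sum_le_sum fun i _ => pow_le_pow_left₀ (norm_nonneg _) ?_ 2
    rw [hx' i]
    refine (norm_polarRetraction_sub_le (hx.1 i) hy
      (step_mem_tangentSpace hx.1 hu i)).trans (le_of_eq ?_)
    congr 1; abel
  have h3 : √(consensusErrSq x') ≤ ρ * √(consensusErrSq x) + √(n : ℝ) * b := by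
    refine (Real.sqrt_le_sqrt (h1.trans h2)).trans ((sqrt_sum_norm_add_sq_le _ _).trans ?_)
    refine add_le_add ?_ ?_
    · refine (Real.sqrt_le_sqrt (hp.sum_norm_sub_sq_le hx)).trans ?_
      rw [Real.sqrt_mul (sq_nonneg _), Real.sqrt_sq hp.ρ_nonneg]
    · rw [← Real.sqrt_sq hb, ← Real.sqrt_mul (Nat.cast_nonneg n)]
      refine Real.sqrt_le_sqrt ?_
      calc ∑ i, ‖-u i‖ ^ 2 ≤ ∑ _i : Fin n, b ^ 2 := Finset.sum_le_sum fun i _ => by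
            rw [norm_neg]; exact pow_le_pow_left₀ (norm_nonneg _) (hub i) 2
        _ = n * b ^ 2 := by simp
  have h4 : √(1 / (n : ℝ)) * √(n : ℝ) = 1 := by
    rw [← Real.sqrt_mul (by positivity), one_div, inv_mul_cancel₀ hp.n_pos.ne', Real.sqrt_one]
  rw [consensusErr, consensusErr, Real.sqrt_mul (by positivity), Real.sqrt_mul (by positivity)]
  have h5 := mul_le_mul_of_nonneg_left h3 (Real.sqrt_nonneg (1 / (n : ℝ)))
  calc _ ≤ _ := h5
    _ = ρ * (√(1 / (n : ℝ)) * √(consensusErrSq x)) + (√(1 / (n : ℝ)) * √(n : ℝ)) * b := by ring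
    _ = _ := by rw [h4, one_mul]

/-- The Euclidean mean moves by the averaged gradient step, up to second-order terms. -/
theorem norm_euclMean_step_le (hx : x ∈ consensusRegion n d r δ₁ δ₂)
    (hu : ∀ i, u i ∈ tangentSpace (x i)) (hub : ∀ i, ‖u i‖ ≤ b)
    (hx' : ∀ i, x' i = polarRetraction (x i) (-(α • gradPhi W t x i) - u i)) :
    ‖euclMean x' - euclMean x + euclMean u‖ ≤
      2 * (α * ((1 / (n : ℝ)) * energy (W ^ t) x)) + b ^ 2 := by
  have hn := hp.n_pos
  set ξ : Fin n → Matrix (Fin d) (Fin r) ℝ := fun i => -(α • gradPhi W t x i) - u i with hξ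
  have h1 : euclMean x' - euclMean x + euclMean u =
      -((1 / (n : ℝ)) • (∑ i, (x i + ξ i - polarRetraction (x i) (ξ i)) +
        α • ∑ i, gradPhi W t x i)) := by
    simp only [euclMean, ← smul_neg, ← smul_sub, ← smul_add]
    congr 1
    simp only [hξ, hx', Finset.sum_sub_distrib, Finset.sum_add_distrib, Finset.sum_neg_distrib,
      Finset.smul_sum]
    abel
  have h2 : ‖∑ i, (x i + ξ i - polarRetraction (x i) (ξ i))‖ ≤
      α * energy (W ^ t) x + n * b ^ 2 := by
    refine (norm_sum_le _ _).trans ?_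
    have h3 : ∀ i, ‖x i + ξ i - polarRetraction (x i) (ξ i)‖ ≤
        α ^ 2 * ‖gradPhi W t x i‖ ^ 2 + b ^ 2 := by
      intro i
      refine (norm_add_sub_polarRetraction_le (hx.1 i)
        (step_mem_tangentSpace hx.1 hu i)).trans ?_
      have e1 : ‖ξ i‖ ≤ α * ‖gradPhi W t x i‖ + b := by
        refine (norm_sub_le _ _).trans (add_le_add (le_of_eq ?_) (hub i))
        rw [norm_neg, norm_smul, Real.norm_of_nonneg hp.α_pos.le]
      have e2 := pow_le_pow_left₀ (norm_nonneg _) e1 2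
      nlinarith [sq_nonneg (α * ‖gradPhi W t x i‖ - b)]
    refine (Finset.sum_le_sum fun i _ => h3 i).trans ?_
    rw [Finset.sum_add_distrib, ← Finset.mul_sum]
    have h4 := hp.sum_norm_gradPhi_sq_le hx.1
    have h5 := mul_nonneg hp.α_pos.le (hp.stoch.energy_nonneg (x := x))
    simp only [Finset.sum_const, Finset.card_univ, Fintype.card_fin, nsmul_eq_mul]
    nlinarith [sq_nonneg δ₂]
  have h3 : ‖α • ∑ i, gradPhi W t x i‖ ≤ α * energy (W ^ t) x := by
    rw [norm_smul, Real.norm_of_nonneg hp.α_pos.le]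
    exact mul_le_mul_of_nonneg_left (hp.stoch.norm_sum_tangentProj_laplacian_le hx.1) hp.α_pos.le
  rw [h1, norm_neg, norm_smul, Real.norm_of_nonneg (by positivity)]
  have h4 := mul_le_mul_of_nonneg_left ((norm_add_le _ _).trans (add_le_add h2 h3))
    (one_div_nonneg.2 hn.le)
  refine h4.trans (le_of_eq ?_)
  field_simp
  ring

omit hp in
theorem norm_meanDefect_le_sq : ‖meanDefect x‖ ≤ (1 / 2) * consensusErr x ^ 2 := by
  rw [consensusErr_sq]; exact norm_meanDefect_le x

/-- The consensus region is invariant under a step with small gradient stepsize: `b ≤ (1 - ρ) δ₁`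
preserves the mean square bound, and `b ≤ α δ₁ / 5` the bound for each agent. -/
theorem step_mem_consensusRegion (hx : x ∈ consensusRegion n d r δ₁ δ₂)
    (hu : ∀ i, u i ∈ tangentSpace (x i)) (hub : ∀ i, ‖u i‖ ≤ b)
    (hx' : ∀ i, x' i = polarRetraction (x i) (-(α • gradPhi W t x i) - u i))
    (hb1 : b ≤ α * δ₁ / 5) (hb2 : b ≤ (1 - ρ) * δ₁) :
    x' ∈ consensusRegion n d r δ₁ δ₂ := by
  have hn := hp.n_pos
  have hδ₁ := hp.δ₁_pos
  have hα := hp.α_pos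
  have hb : 0 ≤ b := (norm_nonneg _).trans (hub ⟨0, by have := hp.two_le; omega⟩)
  have hS' := step_mem_stiefel hx.1 hu hx'
  have hne := hp.stiefel_nonempty hx.1
  have hy := (isIAM_iam (x := x) hne).1
  have he := hp.consensusErr_le hx
  have he' : consensusErr x' ≤ δ₁ := by
    have h1 := hp.consensusErr_step_le hx hu hub hx'
    have h2 := mul_le_mul_of_nonneg_left he hp.ρ_nonneg
    linarith
  have hN1 : consensusErrSq x' ≤ n * δ₁ ^ 2 := by
    have := pow_le_pow_left₀ (consensusErr_nonneg x') he' 2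
    rwa [consensusErr_sq, one_div, inv_mul_le_iff₀ hn] at this
  refine ⟨hS', hN1, fun i => ?_⟩
  have hsq : ∀ z : Fin n → Matrix (Fin d) (Fin r) ℝ, consensusErr z ≤ δ₁ →
      consensusErr z ^ 2 ≤ δ₁ ^ 2 := fun z hz => pow_le_pow_left₀ (consensusErr_nonneg z) hz 2
  -- displacement of the induced arithmetic mean
  have hmean : ‖iam x' - iam x‖ ≤ α * δ₂ / 4 := by
    have h1 := norm_iam_sub_iam_le hp.n_ne_zero hS' hx.1
    have h2 := norm_meanDefect_le_sq (x := x)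
    have h3 := norm_meanDefect_le_sq (x := x')
    have h4 := hp.norm_euclMean_step_le hx hu hub hx'
    have h5 := mul_le_mul_of_nonneg_left (hp.energy_le_δ₁ hx) hα.le
    have h6 : ‖euclMean u‖ ≤ b := by
      rw [euclMean, norm_smul, Real.norm_of_nonneg (by positivity), one_div, inv_mul_le_iff₀ hn]
      refine (norm_sum_le _ _).trans ((Finset.sum_le_sum fun i _ => hub i).trans ?_)
      simp
    have h7 : ‖euclMean x' - euclMean x‖ ≤ 4 * (α * δ₁ ^ 2) + b ^ 2 + b := by
      have := norm_sub_le (euclMean x' - euclMean x + euclMean u) (euclMean u)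
      rw [add_sub_cancel_right] at this
      linarith
    have h8 : (1 - δ₁ ^ 2 / 2) * ‖iam x' - iam x‖ ≤ 4 * (α * δ₁ ^ 2) + b ^ 2 + b := by
      refine le_trans (mul_le_mul_of_nonneg_right ?_ (norm_nonneg _)) (h1.trans h7)
      linarith [hsq x he, hsq x' he']
    have hb30 : b ≤ 1 / 30 := by nlinarith [hp.δ₁_le_const, hp.α_le_one]
    have h9 : δ₁ ^ 2 ≤ δ₁ / 30 := by nlinarith [hp.δ₁_le_const]
    have h10 : α * δ₁ ^ 2 ≤ α * (δ₁ / 30) := mul_le_mul_of_nonneg_left h9 hα.le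
    have h11 : b ^ 2 ≤ b / 30 := by nlinarith [hb30]
    have h12 : α * δ₁ ≤ α * (δ₂ / 5) := mul_le_mul_of_nonneg_left hp.δ₁_le' hα.le
    have h13 : (9 / 10) * ‖iam x' - iam x‖ ≤ (1 - δ₁ ^ 2 / 2) * ‖iam x' - iam x‖ :=
      mul_le_mul_of_nonneg_right (by nlinarith [hp.δ₁_le_const]) (norm_nonneg _)
    have h14 : 0 ≤ α * δ₂ := mul_nonneg hα.le hp.δ₂_nonneg
    linarith
  -- displacement of agent `i` relative to the old mean
  have hi : ‖x' i - iam x‖ ≤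
      (1 - α) * δ₂ + α * (δ₁ ^ 2 / 2 + δ₁ / 2) + α * (2 * δ₂ ^ 2) + b := by
    have h1 : ‖x' i - iam x‖ ≤ ‖x i + (-(α • gradPhi W t x i) - u i) - iam x‖ := by
      rw [hx' i]
      exact norm_polarRetraction_sub_le (hx.1 i) hy (step_mem_tangentSpace hx.1 hu i)
    set A := W ^ t with hA
    -- `Aᵢⱼ - 1/n` is small by the number of communication rounds; the third term is the normal part
    have hdec : x i + (-(α • gradPhi W t x i) - u i) - iam x =
        (1 - α) • (x i - iam x) + α • ((euclMean x - iam x) +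
          ∑ j, (A i j - 1 / (n : ℝ)) • (x j - iam x)) +
        α • (laplacian A x i - tangentProj (x i) (laplacian A x i)) - u i := by
      have e1 : ∑ j, (A i j - 1 / (n : ℝ)) • (x j - iam x) = ∑ j, A i j • x j - euclMean x := by
        have hrow : ∑ j, A i j = 1 := hp.stoch.row_sum i
        simp only [smul_sub, sub_smul, Finset.sum_sub_distrib, ← Finset.sum_smul, euclMean,
          Finset.smul_sum, hrow]
        simp [← Nat.cast_smul_eq_nsmul ℝ, hn.ne']
      rw [e1, gradPhi_eq, hp.stoch.laplacian_eq_sub]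
      module
    have h2 : ‖∑ j, (A i j - 1 / (n : ℝ)) • (x j - iam x)‖ ≤ δ₁ / 2 := by
      have e1 : ‖∑ j, (A i j - 1 / (n : ℝ)) • (x j - iam x)‖ ≤
          ∑ j, |A i j - 1 / (n : ℝ)| * ‖x j - iam x‖ :=
        (norm_sum_le _ _).trans (le_of_eq (by simp only [norm_smul, Real.norm_eq_abs]))
      have e2 := Finset.sum_mul_sq_le_sq_mul_sq Finset.univ
        (fun j => |A i j - 1 / (n : ℝ)|) (fun j => ‖x j - iam x‖)
      simp only [sq_abs] at e2
      have e3 : (∑ j, |A i j - 1 / (n : ℝ)| * ‖x j - iam x‖) ^ 2 ≤ (δ₁ / 2) ^ 2 := by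
        refine e2.trans ((mul_le_mul (hp.row i) hx.2.1 (consensusErrSq_nonneg x)
          (by positivity)).trans (le_of_eq ?_))
        field_simp; ring
      exact e1.trans (abs_le_of_sq_le_sq' e3 (by positivity)).2
    have h3 : ‖euclMean x - iam x‖ ≤ δ₁ ^ 2 / 2 := by
      have := norm_euclMean_sub_iam_le hp.n_ne_zero hx.1
      rw [← consensusErr_sq] at this
      linarith [hsq x he]
    have h4 : ‖laplacian A x i - tangentProj (x i) (laplacian A x i)‖ ≤ 2 * δ₂ ^ 2 := by
      refine (hp.stoch.norm_laplacian_sub_tangentProj_le hx.1 i).trans ?_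
      have e1 : ∀ j, A i j * ‖x i - x j‖ ^ 2 ≤ A i j * (4 * δ₂ ^ 2) := fun j => by
        refine mul_le_mul_of_nonneg_left ?_ (hp.stoch.nonneg i j)
        have := norm_sub_le (x i - iam x) (x j - iam x)
        rw [sub_sub_sub_cancel_right] at this
        have e2 : ‖x i - x j‖ ≤ 2 * δ₂ := by linarith [hx.2.2 i, hx.2.2 j]
        have := pow_le_pow_left₀ (norm_nonneg _) e2 2
        linarith
      have e3 := Finset.sum_le_sum fun j (_ : j ∈ Finset.univ) => e1 j
      rw [← Finset.sum_mul, hp.stoch.row_sum, one_mul] at e3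
      linarith
    refine h1.trans ?_
    rw [hdec]
    refine (norm_sub_le _ _).trans (add_le_add ((norm_add_le _ _).trans (add_le_add
      ((norm_add_le _ _).trans (add_le_add ?_ ?_)) ?_)) (hub i))
    · rw [norm_smul, Real.norm_of_nonneg (by linarith [hp.α_le_one])]
      exact mul_le_mul_of_nonneg_left (hx.2.2 i) (by linarith [hp.α_le_one])
    · rw [norm_smul, Real.norm_of_nonneg hα.le]
      exact mul_le_mul_of_nonneg_left ((norm_add_le _ _).trans (add_le_add h3 h2)) hα.le
    · rw [norm_smul, Real.norm_of_nonneg hα.le]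
      exact mul_le_mul_of_nonneg_left h4 hα.le
  have h1 : ‖x' i - iam x'‖ ≤ ‖x' i - iam x‖ + ‖iam x' - iam x‖ := by
    have := norm_sub_le (x' i - iam x) (iam x' - iam x)
    rwa [sub_sub_sub_cancel_right] at this
  -- the step gains `α δ₂`; all other contributions together are smaller
  have h2 : δ₁ ^ 2 / 2 + δ₁ / 2 + 2 * δ₂ ^ 2 + δ₁ / 5 + δ₂ / 4 ≤ δ₂ := by
    nlinarith [hp.δ₁_le', hp.δ₂_le, hp.δ₁_le_const, hp.δ₂_nonneg]
  have h3 := mul_le_mul_of_nonneg_left h2 hα.le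
  linarith

/-- The induced arithmetic mean moves by the averaged gradient step, up to second-order terms. -/
theorem norm_iam_step_le (hx : x ∈ consensusRegion n d r δ₁ δ₂)
    (hu : ∀ i, u i ∈ tangentSpace (x i)) (hub : ∀ i, ‖u i‖ ≤ b)
    (hx' : ∀ i, x' i = polarRetraction (x i) (-(α • gradPhi W t x i) - u i)) :
    ‖iam x' - iam x + euclMean u‖ ≤
      (5 / 2) * consensusErr x ^ 2 + (1 / 2) * consensusErr x' ^ 2 + b ^ 2 := by
  have h1 := hp.norm_euclMean_step_le hx hu hub hx'
  have h2 := norm_euclMean_sub_iam_le hp.n_ne_zero hx.1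
  have h3 := norm_euclMean_sub_iam_le hp.n_ne_zero (step_mem_stiefel hx.1 hu hx')
  rw [← consensusErr_sq] at h2 h3
  have h4 := hp.energy_le_sq (x := x)
  have h5 : iam x' - iam x + euclMean u = (euclMean x' - euclMean x + euclMean u) +
      ((euclMean x - iam x) - (euclMean x' - iam x')) := by abel
  rw [h5]
  have h6 := (norm_add_le (euclMean x' - euclMean x + euclMean u)
    ((euclMean x - iam x) - (euclMean x' - iam x'))).trans
      (add_le_add le_rfl (norm_sub_le (euclMean x - iam x) (euclMean x' - iam x')))
  linarith

end ConsensusParams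

end Step

/-! ### Smooth functions restricted to the Stiefel manifold -/

section Smooth

variable {n d r : ℕ} {f : Matrix (Fin d) (Fin r) ℝ → ℝ} {L Ln : ℝ}

local notation "⟪" x ", " y "⟫" => inner ℝ x y

theorem fderiv_eq_inner_euclGrad (f : Matrix (Fin d) (Fin r) ℝ → ℝ)
    (x h : Matrix (Fin d) (Fin r) ℝ) : fderiv ℝ f x h = ⟪euclGrad f x, h⟫ := by
  conv_lhs => rw [Matrix.matrix_eq_sum_single h]
  simp only [map_sum, inner_eq_sum, euclGrad, Matrix.of_apply]
  refine Finset.sum_congr rfl fun a _ => Finset.sum_congr rfl fun b _ => ?_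
  have : Matrix.single a b (h a b) = h a b • Matrix.single a b (1 : ℝ) := by simp
  rw [this, map_smul, smul_eq_mul, mul_comm]

theorem continuous_euclGrad (hL : ∀ x y, ‖euclGrad f x - euclGrad f y‖ ≤ L * ‖x - y‖) :
    Continuous (euclGrad f) :=
  (LipschitzWith.of_dist_le' fun x y => by simpa only [dist_eq_norm] using hL x y).continuous

theorem continuous_riemGrad (hL : ∀ x y, ‖euclGrad f x - euclGrad f y‖ ≤ L * ‖x - y‖) :
    Continuous (riemGrad f) := by
  have := continuous_euclGrad hL
  unfold riemGrad tangentProj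
  fun_prop

/-- The quadratic upper bound for functions with Lipschitz gradient. -/
theorem le_quadratic_bound (hf : Differentiable ℝ f)
    (hL : ∀ x y, ‖euclGrad f x - euclGrad f y‖ ≤ L * ‖x - y‖) (x y : Matrix (Fin d) (Fin r) ℝ) :
    f y ≤ f x + ⟪euclGrad f x, y - x⟫ + L / 2 * ‖y - x‖ ^ 2 := by
  set h := y - x with hh
  set φ : ℝ → ℝ := fun s => f (x + s • h) - s * ⟪euclGrad f x, h⟫ - L / 2 * ‖h‖ ^ 2 * s ^ 2
    with hφ
  have hderiv : ∀ s, HasDerivAt φ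
      (⟪euclGrad f (x + s • h), h⟫ - ⟪euclGrad f x, h⟫ - L / 2 * ‖h‖ ^ 2 * (2 * s)) s := by
    intro s
    have h1 : HasDerivAt (fun s : ℝ => x + s • h) h s := by
      have := ((hasDerivAt_id s).smul_const h).const_add x
      rwa [one_smul] at this
    have h2 : HasDerivAt (fun s : ℝ => f (x + s • h)) ⟪euclGrad f (x + s • h), h⟫ s := by
      rw [← fderiv_eq_inner_euclGrad]
      exact (hf (x + s • h)).hasFDerivAt.comp_hasDerivAt s h1
    have h3 := (h2.sub ((hasDerivAt_id s).mul_const ⟪euclGrad f x, h⟫)).sub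
      ((hasDerivAt_pow 2 s).const_mul (L / 2 * ‖h‖ ^ 2))
    refine h3.congr_deriv ?_
    norm_num
  have hanti : AntitoneOn φ (Set.Icc 0 1) := by
    refine antitoneOn_of_deriv_nonpos (convex_Icc 0 1)
      (fun s _ => (hderiv s).continuousAt.continuousWithinAt)
      (fun s _ => (hderiv s).differentiableAt.differentiableWithinAt) fun s hs => ?_
    rw [interior_Icc] at hs
    rw [(hderiv s).deriv]
    have h1 := real_inner_le_norm (euclGrad f (x + s • h) - euclGrad f x) h
    have h2 := hL (x + s • h) x
    rw [add_sub_cancel_left, norm_smul, Real.norm_of_nonneg hs.1.le] at h2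
    rw [inner_sub_left] at h1
    have h3 := mul_le_mul_of_nonneg_right h2 (norm_nonneg h)
    linarith
  have := hanti (Set.left_mem_Icc.2 zero_le_one) (Set.right_mem_Icc.2 zero_le_one) zero_le_one
  simp only [hφ, one_smul, zero_smul, add_zero, hh, add_sub_cancel] at this
  rw [← hh] at this
  linarith

/-- The quadratic upper bound on the Stiefel manifold in terms of the Riemannian gradient. The
curvature of the manifold contributes the spectral norm bound `Ln`. -/
theorem le_riemannian_quadratic_bound (hf : Differentiable ℝ f)
    (hL : ∀ x y, ‖euclGrad f x - euclGrad f y‖ ≤ L * ‖x - y‖)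
    (hLn : ∀ x ∈ stiefel d r, opNorm (euclGrad f x) ≤ Ln) {x y : Matrix (Fin d) (Fin r) ℝ}
    (hx : x ∈ stiefel d r) (hy : y ∈ stiefel d r) :
    f y ≤ f x + ⟪riemGrad f x, y - x⟫ + (L + Ln) / 2 * ‖y - x‖ ^ 2 := by
  have h1 := le_quadratic_bound hf hL x y
  set G := euclGrad f x
  have h2 : tangentProj x (y - x) = (y - x) + (1 / 2 : ℝ) • (x * ((x - y)ᵀ * (x - y))) := by
    have h := tangentProj_sub_eq hx hy
    rw [← neg_sub x y, ← tangentProjLin_apply, map_neg, tangentProjLin_apply, h]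
    abel
  have h3 : |⟪G, x * ((x - y)ᵀ * (x - y))⟫| ≤ Ln * ‖y - x‖ ^ 2 := by
    have e1 : ⟪G, x * ((x - y)ᵀ * (x - y))⟫ = ⟪G * (x - y)ᵀ, x * (x - y)ᵀ⟫ := by
      rw [inner_mul_right_eq, Matrix.transpose_transpose, Matrix.mul_assoc]
    rw [e1]
    refine (abs_real_inner_le_norm _ _).trans ?_
    rw [norm_mul_of_orthonormal hx, norm_transpose]
    have e2 := norm_mul_le_opNorm G (x - y)ᵀ
    rw [norm_transpose] at e2
    have e3 := mul_le_mul_of_nonneg_right (hLn x hx) (norm_nonneg (x - y))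
    have e4 := mul_le_mul_of_nonneg_right (e2.trans e3) (norm_nonneg (x - y))
    rw [norm_sub_rev y x]
    linarith
  have h4 : ⟪riemGrad f x, y - x⟫ =
      ⟪G, y - x⟫ + (1 / 2) * ⟪G, x * ((x - y)ᵀ * (x - y))⟫ := by
    rw [riemGrad, inner_tangentProj, h2, inner_add_right, inner_smul_right]
  have h5 := (abs_le.1 h3).1
  rw [h4]
  linarith

/-- On the Stiefel manifold the Riemannian gradient is Lipschitz with constant `L + 2 Ln`; the second
term comes from the variation of the tangent projection. -/
theorem norm_riemGrad_sub_le (hL : ∀ x y, ‖euclGrad f x - euclGrad f y‖ ≤ L * ‖x - y‖)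
    (hLn : ∀ x ∈ stiefel d r, opNorm (euclGrad f x) ≤ Ln) {x y : Matrix (Fin d) (Fin r) ℝ}
    (hx : x ∈ stiefel d r) (hy : y ∈ stiefel d r) :
    ‖riemGrad f x - riemGrad f y‖ ≤ (L + 2 * Ln) * ‖x - y‖ := by
  set G := euclGrad f y
  have hG := hLn y hy
  have hGl : ∀ {q : ℕ} (B : Matrix (Fin r) (Fin q) ℝ), ‖G * B‖ ≤ Ln * ‖B‖ := fun B =>
    (norm_mul_le_opNorm G B).trans (mul_le_mul_of_nonneg_right hG (norm_nonneg _))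
  have hGt : ∀ {q : ℕ} (B : Matrix (Fin d) (Fin q) ℝ), ‖Gᵀ * B‖ ≤ Ln * ‖B‖ := fun B =>
    (norm_transpose_mul_le_opNorm G B).trans (mul_le_mul_of_nonneg_right hG (norm_nonneg _))
  have h1 : riemGrad f x - riemGrad f y = tangentProj x (euclGrad f x - G) -
      (1 / 2 : ℝ) • ((x * ((x - y)ᵀ * G) + (x - y) * (yᵀ * G)) +
        (x * (Gᵀ * (x - y)) + (x - y) * (Gᵀ * y))) := by
    rw [← tangentProjLin_apply, map_sub, tangentProjLin_apply, tangentProjLin_apply]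
    simp only [riemGrad, tangentProj, Matrix.transpose_sub, Matrix.mul_sub, Matrix.sub_mul,
      Matrix.mul_add]
    module
  have k0 : ‖tangentProj x (euclGrad f x - G)‖ ≤ L * ‖x - y‖ :=
    (norm_tangentProj_le hx _).trans (hL x y)
  have k1 : ‖x * ((x - y)ᵀ * G)‖ ≤ Ln * ‖x - y‖ := by
    rw [norm_mul_of_orthonormal hx, ← norm_transpose]
    simpa using hGt (x - y)
  have k2 : ‖(x - y) * (yᵀ * G)‖ ≤ Ln * ‖x - y‖ := by
    rw [← norm_transpose]
    have := hGt (y * (x - y)ᵀ)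
    rw [norm_mul_of_orthonormal hy, norm_transpose] at this
    simpa [Matrix.mul_assoc] using this
  have k3 : ‖x * (Gᵀ * (x - y))‖ ≤ Ln * ‖x - y‖ := by
    rw [norm_mul_of_orthonormal hx]; exact hGt _
  have k4 : ‖(x - y) * (Gᵀ * y)‖ ≤ Ln * ‖x - y‖ := by
    rw [← norm_transpose]
    have e := (norm_transpose_mul_le_of_orthonormal hy (G * (x - y)ᵀ)).trans (hGl (x - y)ᵀ)
    rw [norm_transpose] at e
    simpa [Matrix.mul_assoc] using e
  rw [h1]
  refine (norm_sub_le _ _).trans ?_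
  rw [norm_smul, Real.norm_of_nonneg (by norm_num)]
  have := (norm_add_le (x * ((x - y)ᵀ * G) + (x - y) * (yᵀ * G))
    (x * (Gᵀ * (x - y)) + (x - y) * (Gᵀ * y))).trans
      (add_le_add (norm_add_le _ _) (norm_add_le _ _))
  linarith

/-! ### Averages of objectives -/

variable {g : Fin n → Matrix (Fin d) (Fin r) ℝ → ℝ}

theorem differentiable_average (hg : ∀ i, Differentiable ℝ (g i)) :
    Differentiable ℝ (average g) := by
  unfold average
  fun_prop

theorem euclGrad_average (hg : ∀ i, Differentiable ℝ (g i)) (x : Matrix (Fin d) (Fin r) ℝ) :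
    euclGrad (average g) x = (1 / (n : ℝ)) • ∑ i, euclGrad (g i) x := by
  have h : fderiv ℝ (average g) x = (1 / (n : ℝ)) • ∑ i, fderiv ℝ (g i) x := by
    have h1 : HasFDerivAt (fun y => ∑ i, g i y) (∑ i, fderiv ℝ (g i) x) x :=
      HasFDerivAt.fun_sum fun i _ => (hg i x).hasFDerivAt
    exact (h1.const_mul (1 / (n : ℝ))).fderiv
  ext a b
  simp [euclGrad, h, Matrix.sum_apply]

theorem riemGrad_average (hg : ∀ i, Differentiable ℝ (g i)) (x : Matrix (Fin d) (Fin r) ℝ) :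
    riemGrad (average g) x = (1 / (n : ℝ)) • ∑ i, riemGrad (g i) x := by
  simp only [riemGrad, euclGrad_average hg, ← tangentProjLin_apply, map_smul, map_sum]

theorem norm_euclGrad_average_sub_le (hn : n ≠ 0) (hg : ∀ i, Differentiable ℝ (g i))
    (hL : ∀ i x y, ‖euclGrad (g i) x - euclGrad (g i) y‖ ≤ L * ‖x - y‖)
    (x y : Matrix (Fin d) (Fin r) ℝ) :
    ‖euclGrad (average g) x - euclGrad (average g) y‖ ≤ L * ‖x - y‖ := by
  have hn' : (0 : ℝ) < n := by positivity
  rw [euclGrad_average hg, euclGrad_average hg, ← smul_sub, ← Finset.sum_sub_distrib, norm_smul,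
    Real.norm_of_nonneg (by positivity), one_div, inv_mul_le_iff₀ hn']
  refine (norm_sum_le _ _).trans ((Finset.sum_le_sum fun i _ => hL i x y).trans ?_)
  simp

theorem opNorm_euclGrad_average_le (hn : n ≠ 0) (hg : ∀ i, Differentiable ℝ (g i))
    (hLn : ∀ i, ∀ x ∈ stiefel d r, opNorm (euclGrad (g i) x) ≤ Ln)
    (x : Matrix (Fin d) (Fin r) ℝ) (hx : x ∈ stiefel d r) :
    opNorm (euclGrad (average g) x) ≤ Ln := by
  have hn' : (0 : ℝ) < n := by positivity
  rw [euclGrad_average hg, opNorm, map_smul, map_smul, map_sum, map_sum, norm_smul,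
    Real.norm_of_nonneg (by positivity), one_div, inv_mul_le_iff₀ hn']
  refine (norm_sum_le _ _).trans ((Finset.sum_le_sum fun i _ => hLn i x hx).trans ?_)
  simp

/-- The averaged local gradients at the iterates approximate the gradient at the mean. -/
theorem norm_euclMean_riemGrad_sub_le (hn : n ≠ 0) (hg : ∀ i, Differentiable ℝ (g i))
    (hL : ∀ i x y, ‖euclGrad (g i) x - euclGrad (g i) y‖ ≤ L * ‖x - y‖)
    (hLn : ∀ i, ∀ x ∈ stiefel d r, opNorm (euclGrad (g i) x) ≤ Ln)
    {x : Fin n → Matrix (Fin d) (Fin r) ℝ} (hx : ∀ i, x i ∈ stiefel d r) :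
    ‖riemGrad (average g) (iam x) - euclMean fun i => riemGrad (g i) (x i)‖ ^ 2 ≤
      (L + 2 * Ln) ^ 2 * consensusErr x ^ 2 := by
  have hn' : (0 : ℝ) < n := by positivity
  have hy := (isIAM_iam (x := x) ⟨_, hx ⟨0, Nat.pos_of_ne_zero hn⟩⟩).1
  have h1 : ‖riemGrad (average g) (iam x) - euclMean fun i => riemGrad (g i) (x i)‖ ≤
      (1 / (n : ℝ)) * ∑ i, (L + 2 * Ln) * ‖x i - iam x‖ := by
    rw [riemGrad_average hg, euclMean, ← smul_sub, ← Finset.sum_sub_distrib, norm_smul,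
      Real.norm_of_nonneg (by positivity)]
    refine mul_le_mul_of_nonneg_left ((norm_sum_le _ _).trans
      (Finset.sum_le_sum fun i _ => ?_)) (by positivity)
    rw [norm_sub_rev (x i)]
    exact norm_riemGrad_sub_le (hL i) (hLn i) hy (hx i)
  have h2 := sq_sum_le_card_mul_sum_sq (s := Finset.univ) (f := fun i => ‖x i - iam x‖)
  have h3 := pow_le_pow_left₀ (norm_nonneg _) h1 2
  refine h3.trans ?_
  rw [← Finset.mul_sum, consensusErr_sq, consensusErrSq]
  simp only [Finset.card_univ, Fintype.card_fin] at h2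
  calc _ = (L + 2 * Ln) ^ 2 * ((1 / (n : ℝ)) ^ 2 * (∑ i, ‖x i - iam x‖) ^ 2) := by ring
    _ ≤ (L + 2 * Ln) ^ 2 * ((1 / (n : ℝ)) ^ 2 * (n * ∑ i, ‖x i - iam x‖ ^ 2)) := by gcongr
    _ = _ := by field_simp

end Smooth

/-! ### Conditionally independent stochastic gradients -/

section Probability

variable {Ω : Type*} {m : MeasurableSpace Ω} [mΩ : MeasurableSpace Ω] {P : Measure Ω}
  [IsProbabilityMeasure P]
  {E : Type*} [NormedAddCommGroup E] [InnerProductSpace ℝ E] [FiniteDimensional ℝ E]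
  [MeasurableSpace E] [BorelSpace E]

local notation "⟪" x ", " y "⟫" => inner ℝ x y

/-- For conditionally independent real variables, the conditional expectation of the product is the
product of the conditional expectations. -/
theorem condExp_mul_of_condIndepFun [StandardBorelSpace Ω] {hm : m ≤ mΩ} {X Y : Ω → ℝ}
    (hX : Measurable X) (hY : Measurable Y) (hXi : Integrable X P) (hYi : Integrable Y P)
    (hXY : Integrable (fun ω => X ω * Y ω) P) (h : CondIndepFun m hm X Y P) :
    P[fun ω => X ω * Y ω | m] =ᵐ[P] fun ω => P[X | m] ω * P[Y | m] ω := by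
  have h1 := ae_of_ae_trim hm ((condIndepFun_iff_map_prod_eq_prod_map_map hX hY).1 h)
  filter_upwards [h1, condExp_ae_eq_integral_condExpKernel hm hXi,
    condExp_ae_eq_integral_condExpKernel hm hYi, condExp_ae_eq_integral_condExpKernel hm hXY]
    with ω h1 h2 h3 h4
  rw [h2, h3, h4]
  have hind : IndepFun X Y (condExpKernel P m ω) := by
    rw [indepFun_iff_map_prod_eq_prod_map_map hX.aemeasurable hY.aemeasurable]
    rw [Kernel.prod_apply, Kernel.map_apply _ (hX.prodMk hY), Kernel.map_apply _ hX,
      Kernel.map_apply _ hY] at h1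
    exact h1
  exact hind.integral_fun_mul_eq_mul_integral hX.aestronglyMeasurable hY.aestronglyMeasurable

omit [IsProbabilityMeasure P] [FiniteDimensional ℝ E] [MeasurableSpace E] [BorelSpace E] in
theorem integrable_inner_of_bounded [IsFiniteMeasure P] {X Y : Ω → E} {a b : ℝ}
    (hX : AEStronglyMeasurable X P) (hY : AEStronglyMeasurable Y P) (hXb : ∀ᵐ ω ∂P, ‖X ω‖ ≤ a)
    (hYb : ∀ᵐ ω ∂P, ‖Y ω‖ ≤ b) : Integrable (fun ω => ⟪X ω, Y ω⟫) P := by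
  refine Integrable.of_bound (hX.inner hY) (a * b) ?_
  filter_upwards [hXb, hYb] with ω h1 h2
  exact (norm_inner_le_norm _ _).trans
    (mul_le_mul h1 h2 (norm_nonneg _) ((norm_nonneg _).trans h1))

omit [MeasurableSpace E] [BorelSpace E] in
/-- Conditioning inside an inner product with a known vector. -/
theorem integral_inner_condExp (hm : m ≤ mΩ) {X G : Ω → E} {a b : ℝ}
    (hX : AEStronglyMeasurable X P) (hG : AEStronglyMeasurable[m] G P)
    (hXb : ∀ᵐ ω ∂P, ‖X ω‖ ≤ a) (hGb : ∀ᵐ ω ∂P, ‖G ω‖ ≤ b) :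
    ∫ ω, ⟪G ω, X ω⟫ ∂P = ∫ ω, ⟪G ω, P[X | m] ω⟫ ∂P := by
  have h1 := condExp_bilin_of_aestronglyMeasurable_left (m := m) (μ := P) (innerSL ℝ) hG
    (integrable_inner_of_bounded (hG.mono hm) hX hGb hXb) (Integrable.of_bound hX a hXb)
  rw [← integral_condExp hm]
  exact integral_congr_ae h1

/-- The expected inner product of conditionally independent vectors only involves their conditional
expectations. -/
theorem integral_inner_of_condIndepFun [StandardBorelSpace Ω] {hm : m ≤ mΩ} {X Y : Ω → E}
    {a b : ℝ} (hX : Measurable X) (hY : Measurable Y) (hXb : ∀ᵐ ω ∂P, ‖X ω‖ ≤ a)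
    (hYb : ∀ᵐ ω ∂P, ‖Y ω‖ ≤ b) (h : CondIndepFun m hm X Y P) :
    ∫ ω, ⟪X ω, Y ω⟫ ∂P = ∫ ω, ⟪P[X | m] ω, P[Y | m] ω⟫ ∂P := by
  have := FiniteDimensional.proper_real E
  set e := stdOrthonormalBasis ℝ E
  have hXi : Integrable X P := Integrable.of_bound hX.aestronglyMeasurable a hXb
  have hYi : Integrable Y P := Integrable.of_bound hY.aestronglyMeasurable b hYb
  have hcoord : ∀ k (Z : Ω → E), Integrable Z P →
      P[fun ω => ⟪e k, Z ω⟫ | m] =ᵐ[P] fun ω => ⟪e k, P[Z | m] ω⟫ := fun k Z hZ =>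
    ((innerSL ℝ (e k)).comp_condExp_comm hZ).symm
  have hmeas : ∀ k, Measurable fun z : E => ⟪e k, z⟫ := fun k =>
    (continuous_const.inner continuous_id).measurable
  have hint : ∀ k, Integrable (fun ω => ⟪e k, X ω⟫ * ⟪e k, Y ω⟫) P := fun k => by
    refine Integrable.of_bound (((hmeas k).comp hX).mul
      ((hmeas k).comp hY)).aestronglyMeasurable (a * b) ?_
    have hek : ‖e k‖ = 1 := e.orthonormal.1 k
    filter_upwards [hXb, hYb] with ω h1 h2
    have e1 := norm_inner_le_norm (𝕜 := ℝ) (e k) (X ω)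
    have e2 := norm_inner_le_norm (𝕜 := ℝ) (e k) (Y ω)
    rw [hek, one_mul] at e1 e2
    rw [norm_mul]
    exact mul_le_mul (e1.trans h1) (e2.trans h2) (norm_nonneg _) ((norm_nonneg _).trans h1)
  have hprod : ∀ k, P[fun ω => ⟪e k, X ω⟫ * ⟪e k, Y ω⟫ | m] =ᵐ[P]
      fun ω => ⟪e k, P[X | m] ω⟫ * ⟪e k, P[Y | m] ω⟫ := fun k => by
    have h1 := condExp_mul_of_condIndepFun (P := P) ((hmeas k).comp hX) ((hmeas k).comp hY)
      (hXi.const_inner (e k)) (hYi.const_inner (e k)) (hint k) (h.comp (hmeas k) (hmeas k))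
    filter_upwards [h1, hcoord k X hXi, hcoord k Y hYi] with ω h1 h2 h3
    rw [← h2, ← h3]
    exact h1
  have hsum : ∀ z w : E, ⟪z, w⟫ = ∑ k, ⟪e k, z⟫ * ⟪e k, w⟫ := fun z w => by
    rw [← e.sum_inner_mul_inner]
    exact Finset.sum_congr rfl fun k _ => by rw [real_inner_comm]
  rw [integral_congr_ae (ae_of_all _ fun ω => hsum (X ω) (Y ω)),
    integral_congr_ae (ae_of_all _ fun ω => hsum (P[X | m] ω) (P[Y | m] ω)),
    integral_finsetSum _ fun k _ => hint k, integral_finsetSum _ fun k _ =>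
    integrable_condExp.congr (hprod k)]
  refine Finset.sum_congr rfl fun k _ => ?_
  rw [← integral_condExp hm]
  exact integral_congr_ae (hprod k)

/-- The variance of an average of `n` conditionally independent variables is at most `Ξ² / n`. -/
theorem integral_norm_average_sub_sq_le [StandardBorelSpace Ω] {hm : m ≤ mΩ} {n : ℕ}
    (hn : n ≠ 0) {v g : Fin n → Ω → E} {D Ξ : ℝ} (hv : ∀ i, Measurable (v i))
    (hvD : ∀ i, ∀ᵐ ω ∂P, ‖v i ω‖ ≤ D) {B : ℝ} (hgB : ∀ i, ∀ᵐ ω ∂P, ‖g i ω‖ ≤ B)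
    (hvg : ∀ i, P[v i | m] =ᵐ[P] g i)
    (hind : ∀ i j, i ≠ j → CondIndepFun m hm (v i) (v j) P)
    (hvar : ∀ i, ∫ ω, ‖v i ω - g i ω‖ ^ 2 ∂P ≤ Ξ ^ 2) :
    ∫ ω, ‖(1 / (n : ℝ)) • ∑ i, (v i ω - g i ω)‖ ^ 2 ∂P ≤ Ξ ^ 2 / n := by
  have := FiniteDimensional.proper_real E
  have hn' : (0 : ℝ) < n := by positivity
  have hgm : ∀ i, AEStronglyMeasurable[m] (g i) P := fun i =>
    stronglyMeasurable_condExp.aestronglyMeasurable.congr (hvg i)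
  have hga : ∀ i, AEStronglyMeasurable (g i) P := fun i => (hgm i).mono hm
  have hva : ∀ i, AEStronglyMeasurable (v i) P := fun i => (hv i).aestronglyMeasurable
  have hvv := fun i j => integrable_inner_of_bounded (hva i) (hva j) (hvD i) (hvD j)
  have hvgi := fun i j => integrable_inner_of_bounded (hva i) (hga j) (hvD i) (hgB j)
  have hgv := fun i j => integrable_inner_of_bounded (hga i) (hva j) (hgB i) (hvD j)
  have hgg := fun i j => integrable_inner_of_bounded (hga i) (hga j) (hgB i) (hgB j)
  have hexp : ∀ i j, (fun ω => ⟪v i ω - g i ω, v j ω - g j ω⟫) = fun ω =>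
      (⟪v i ω, v j ω⟫ - ⟪v i ω, g j ω⟫) - (⟪g i ω, v j ω⟫ - ⟪g i ω, g j ω⟫) := fun i j => by
    funext ω; simp only [inner_sub_left, inner_sub_right]; ring
  have hint : ∀ i j, Integrable (fun ω => ⟪v i ω - g i ω, v j ω - g j ω⟫) P := fun i j => by
    rw [hexp]; exact ((hvv i j).sub (hvgi i j)).sub ((hgv i j).sub (hgg i j))
  have hcross : ∀ i j, i ≠ j → ∫ ω, ⟪v i ω - g i ω, v j ω - g j ω⟫ ∂P = 0 := fun i j hij => by
    have h1 : ∫ ω, ⟪v i ω, v j ω⟫ ∂P = ∫ ω, ⟪g i ω, g j ω⟫ ∂P := by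
      rw [integral_inner_of_condIndepFun (hv i) (hv j) (hvD i) (hvD j) (hind i j hij)]
      refine integral_congr_ae ?_
      filter_upwards [hvg i, hvg j] with ω e1 e2
      rw [e1, e2]
    have h2 : ∀ i j, ∫ ω, ⟪g i ω, v j ω⟫ ∂P = ∫ ω, ⟪g i ω, g j ω⟫ ∂P := fun i j => by
      rw [integral_inner_condExp hm (hva j) (hgm i) (hvD j) (hgB i)]
      refine integral_congr_ae ?_
      filter_upwards [hvg j] with ω e1
      rw [e1]
    have h3 : ∫ ω, ⟪v i ω, g j ω⟫ ∂P = ∫ ω, ⟪g i ω, g j ω⟫ ∂P := by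
      simp only [real_inner_comm (g j _)]
      rw [h2 j i]
    have k1 : Integrable (fun ω => ⟪v i ω, v j ω⟫ - ⟪v i ω, g j ω⟫) P := (hvv i j).sub (hvgi i j)
    have k2 : Integrable (fun ω => ⟪g i ω, v j ω⟫ - ⟪g i ω, g j ω⟫) P := (hgv i j).sub (hgg i j)
    rw [hexp, integral_sub k1 k2,
      integral_sub (hvv i j) (hvgi i j), integral_sub (hgv i j) (hgg i j), h1, h2, h3]
    ring
  have hpt : ∀ ω, ‖(1 / (n : ℝ)) • ∑ i, (v i ω - g i ω)‖ ^ 2 =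
      (1 / (n : ℝ)) ^ 2 * ∑ i, ∑ j, ⟪v i ω - g i ω, v j ω - g j ω⟫ := fun ω => by
    rw [norm_smul, mul_pow, ← real_inner_self_eq_norm_sq (∑ i, (v i ω - g i ω)), sum_inner]
    simp only [inner_sum, Real.norm_eq_abs, sq_abs]
  simp only [hpt]
  rw [integral_const_mul, integral_finsetSum _ fun i _ => integrable_finsetSum _ fun j _ =>
    hint i j]
  have hrow : ∀ i, ∫ ω, ∑ j, ⟪v i ω - g i ω, v j ω - g j ω⟫ ∂P ≤ Ξ ^ 2 := fun i => by
    rw [integral_finsetSum _ fun j _ => hint i j, Finset.sum_eq_single i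
      (fun j _ hj => hcross i j hj.symm) (fun h => absurd (Finset.mem_univ i) h)]
    simpa only [real_inner_self_eq_norm_sq] using hvar i
  calc _ ≤ (1 / (n : ℝ)) ^ 2 * ∑ _i : Fin n, Ξ ^ 2 := by
        gcongr with i
        exact hrow i
    _ = Ξ ^ 2 / n := by
        simp only [Finset.sum_const, Finset.card_univ, Fintype.card_fin, nsmul_eq_mul]
        field_simp

omit [MeasurableSpace E] [BorelSpace E] in
/-- The descent inequality in expectation. The stochastic direction `V` with conditional mean `G`
and variance at most `s` replaces the gradient `g`, from which `G` differs by at most `√q`. -/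
theorem integral_descent (hm : m ≤ mΩ) {g G V : Ω → E} {Φ Φ' : Ω → ℝ} {a β l R q s : ℝ}
    (hβ : 0 ≤ β) (hlβ : 3 * (l * β) ≤ 1)
    (hg : AEStronglyMeasurable[m] g P) (hV : AEStronglyMeasurable V P) (hVG : P[V | m] =ᵐ[P] G)
    (hga : ∀ᵐ ω ∂P, ‖g ω‖ ≤ a) (hGa : ∀ᵐ ω ∂P, ‖G ω‖ ≤ a) (hVa : ∀ᵐ ω ∂P, ‖V ω‖ ≤ a)
    (hΦ : Integrable Φ P) (hΦ' : Integrable Φ' P) (hl : 0 ≤ l)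
    (hstep : ∀ᵐ ω ∂P, Φ' ω ≤ Φ ω - β * ⟪g ω, V ω⟫ + β / 4 * ‖g ω‖ ^ 2 + R +
      3 / 2 * l * β ^ 2 * ‖V ω‖ ^ 2)
    (hq : ∀ᵐ ω ∂P, ‖g ω - G ω‖ ^ 2 ≤ q) (hs : ∫ ω, ‖V ω - G ω‖ ^ 2 ∂P ≤ s) :
    ∫ ω, Φ' ω ∂P ≤ ∫ ω, Φ ω ∂P - β / 4 * ∫ ω, ‖g ω‖ ^ 2 ∂P + β / 2 * q + R +
      3 / 2 * l * β ^ 2 * s := by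
  have hGm : AEStronglyMeasurable[m] G P :=
    stronglyMeasurable_condExp.aestronglyMeasurable.congr hVG
  have hg' := hg.mono hm
  have hG' := hGm.mono hm
  have igV := integrable_inner_of_bounded hg' hV hga hVa
  have igG := integrable_inner_of_bounded hg' hG' hga hGa
  have iGV := integrable_inner_of_bounded hG' hV hGa hVa
  have igg : Integrable (fun ω => ‖g ω‖ ^ 2) P := by
    simpa only [real_inner_self_eq_norm_sq] using integrable_inner_of_bounded hg' hg' hga hga
  have iGG : Integrable (fun ω => ‖G ω‖ ^ 2) P := by
    simpa only [real_inner_self_eq_norm_sq] using integrable_inner_of_bounded hG' hG' hGa hGa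
  have iVV : Integrable (fun ω => ‖V ω‖ ^ 2) P := by
    simpa only [real_inner_self_eq_norm_sq] using integrable_inner_of_bounded hV hV hVa hVa
  have e1 : ∫ ω, ⟪g ω, V ω⟫ ∂P = ∫ ω, ⟪g ω, G ω⟫ ∂P := by
    rw [integral_inner_condExp hm hV hg hVa hga]
    refine integral_congr_ae ?_
    filter_upwards [hVG] with ω h
    rw [h]
  have e2 : ∫ ω, ⟪G ω, V ω⟫ ∂P = ∫ ω, ‖G ω‖ ^ 2 ∂P := by
    rw [integral_inner_condExp hm hV hGm hVa hGa]
    refine integral_congr_ae ?_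
    filter_upwards [hVG] with ω h
    rw [h, real_inner_self_eq_norm_sq]
  have e3 : ∫ ω, ‖V ω‖ ^ 2 ∂P ≤ ∫ ω, ‖G ω‖ ^ 2 ∂P + s := by
    have h1 : ∀ ω, ‖V ω - G ω‖ ^ 2 = ‖V ω‖ ^ 2 - 2 * ⟪G ω, V ω⟫ + ‖G ω‖ ^ 2 := fun ω => by
      rw [norm_sub_sq_real, real_inner_comm]
    simp only [h1] at hs
    have k1 : Integrable (fun ω => ‖V ω‖ ^ 2 - 2 * ⟪G ω, V ω⟫) P := iVV.sub (iGV.const_mul 2)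
    rw [integral_add k1 iGG, integral_sub iVV (iGV.const_mul 2),
      integral_const_mul, e2] at hs
    linarith
  have k1 : Integrable (fun ω => Φ ω - β * ⟪g ω, V ω⟫) P := hΦ.sub (igV.const_mul β)
  have k2 : Integrable (fun ω => Φ ω - β * ⟪g ω, V ω⟫ + β / 4 * ‖g ω‖ ^ 2) P :=
    k1.add (igg.const_mul _)
  have k3 : Integrable (fun ω => Φ ω - β * ⟪g ω, V ω⟫ + β / 4 * ‖g ω‖ ^ 2 + R) P :=
    k2.add (integrable_const R)
  have h1 : ∫ ω, Φ' ω ∂P ≤ ∫ ω, (Φ ω - β * ⟪g ω, V ω⟫ + β / 4 * ‖g ω‖ ^ 2 + R +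
      3 / 2 * l * β ^ 2 * ‖V ω‖ ^ 2) ∂P :=
    integral_mono_ae hΦ' (k3.add (iVV.const_mul _)) hstep
  rw [integral_add k3 (iVV.const_mul _), integral_add k2 (integrable_const R),
    integral_add k1 (igg.const_mul _), integral_sub hΦ (igV.const_mul β), integral_const_mul,
    integral_const_mul, integral_const_mul, integral_const, e1] at h1
  -- `⟪g, G⟫ = (‖g‖² + ‖G‖² - ‖g - G‖²) / 2`, and the term `‖G‖²` absorbs the second moment of `V`
  have k4 : Integrable (fun ω => β / 2 * ‖g ω‖ ^ 2 + 3 / 2 * l * β ^ 2 * ‖G ω‖ ^ 2) P :=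
    (igg.const_mul _).add (iGG.const_mul _)
  have h2 : ∫ ω, (β / 2 * ‖g ω‖ ^ 2 + 3 / 2 * l * β ^ 2 * ‖G ω‖ ^ 2 - β / 2 * q) ∂P ≤
      ∫ ω, β * ⟪g ω, G ω⟫ ∂P := by
    refine integral_mono_ae (k4.sub (integrable_const _)) (igG.const_mul β) ?_
    filter_upwards [hq] with ω hω
    rw [norm_sub_sq_real] at hω
    have h3 := mul_le_mul_of_nonneg_left hω (by linarith : 0 ≤ β / 2)
    have h4 := mul_le_mul_of_nonneg_right hlβ (mul_nonneg hβ (sq_nonneg ‖G ω‖))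
    nlinarith
  rw [integral_sub k4 (integrable_const _),
    integral_add (igg.const_mul _) (iGG.const_mul _), integral_const_mul, integral_const_mul,
    integral_const_mul, integral_const_mul, integral_const] at h2
  have h3 := mul_le_mul_of_nonneg_left e3 (by positivity : 0 ≤ 3 / 2 * l * β ^ 2)
  simp only [probReal_univ, one_smul] at h1 h2
  linarith

end Probability

/-! ### Measurability of the induced arithmetic mean -/

/-- On the consensus region the selected minimizer is unique and depends Lipschitz continuously on
the points. -/
theorem lipschitzOnWith_iam {n d r : ℕ} (hn : n ≠ 0) {δ₁ δ₂ : ℝ} (h0 : 0 ≤ δ₁) (hδ : δ₁ ≤ 1) :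
    LipschitzOnWith 2 (iam (n := n) (d := d) (r := r)) (consensusRegion n d r δ₁ δ₂) := by
  refine LipschitzOnWith.of_dist_le_mul fun x hx y hy => ?_
  have hn' : (0 : ℝ) < n := by positivity
  have hE : ∀ z ∈ consensusRegion n d r δ₁ δ₂, ‖meanDefect z‖ ≤ 1 / 2 := fun z hz => by
    refine (norm_meanDefect_le z).trans ?_
    have h1 : 1 / (n : ℝ) * consensusErrSq z ≤ δ₁ ^ 2 := by
      rw [one_div, inv_mul_le_iff₀ hn']; exact hz.2.1
    nlinarith
  have h1 := norm_iam_sub_iam_le hn hx.1 hy.1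
  have h2 : (1 / 2) * ‖iam x - iam y‖ ≤
      (1 - (1 / 2) * (‖meanDefect x‖ + ‖meanDefect y‖)) * ‖iam x - iam y‖ :=
    mul_le_mul_of_nonneg_right (by linarith [hE x hx, hE y hy]) (norm_nonneg _)
  have h3 : ‖euclMean x - euclMean y‖ ≤ ‖x - y‖ := by
    rw [euclMean, euclMean, ← smul_sub, ← Finset.sum_sub_distrib, norm_smul,
      Real.norm_of_nonneg (by positivity), one_div, inv_mul_le_iff₀ hn']
    refine (norm_sum_le _ _).trans ((Finset.sum_le_sum fun i _ => norm_le_pi_norm (x - y) i).trans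
      ?_)
    simp
  rw [dist_eq_norm, dist_eq_norm]
  simp only [NNReal.coe_ofNat]
  linarith

/-- On the consensus region the induced arithmetic mean agrees with a continuous function. -/
theorem exists_continuous_eqOn_iam {n d r : ℕ} (hn : n ≠ 0) {δ₁ δ₂ : ℝ} (h0 : 0 ≤ δ₁)
    (hδ : δ₁ ≤ 1) : ∃ G : (Fin n → Matrix (Fin d) (Fin r) ℝ) → Matrix (Fin d) (Fin r) ℝ,
      Continuous G ∧ Set.EqOn iam G (consensusRegion n d r δ₁ δ₂) := by
  obtain ⟨G, hG, hGe⟩ :=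
    (lipschitzOnWith_iam (d := d) (r := r) (δ₂ := δ₂) hn h0 hδ).extend_finite_dimension
  exact ⟨G, hG.continuous, hGe⟩

/-- Needed for strong measurability of continuous functions of matrices. -/
scoped instance matrixSecondCountable (d r : ℕ) :
    SecondCountableTopology (Matrix (Fin d) (Fin r) ℝ) :=
  inferInstanceAs (SecondCountableTopology (Fin d → Fin r → ℝ))

/-- A continuous function of the induced arithmetic mean is almost everywhere measurable with respect
to the iterate, although `iam` is chosen arbitrarily outside the consensus region. -/
theorem aestronglyMeasurable_comp_iam {n d r : ℕ} {Ω F : Type*} [MeasurableSpace Ω]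
    [TopologicalSpace F] [TopologicalSpace.PseudoMetrizableSpace F] [SecondCountableTopology F]
    {P : Measure Ω} (hn : n ≠ 0) {δ₁ δ₂ : ℝ} (h0 : 0 ≤ δ₁) (hδ : δ₁ ≤ 1)
    {x : Ω → Fin n → Matrix (Fin d) (Fin r) ℝ}
    (hxN : ∀ᵐ ω ∂P, x ω ∈ consensusRegion n d r δ₁ δ₂)
    {φ : Matrix (Fin d) (Fin r) ℝ → F} (hφ : Continuous φ) :
    AEStronglyMeasurable[MeasurableSpace.comap x inferInstance] (fun ω => φ (iam (x ω))) P := by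
  obtain ⟨G, hG, hGe⟩ :=
    exists_continuous_eqOn_iam (n := n) (d := d) (r := r) (δ₂ := δ₂) hn h0 hδ
  refine ⟨fun ω => φ (G (x ω)), ?_, ?_⟩
  · have h1 : StronglyMeasurable (φ ∘ G) := (hφ.comp hG).stronglyMeasurable
    exact h1.comp_measurable (comap_measurable x)
  · filter_upwards [hxN] with ω hω
    rw [hGe hω]

/-! ### Stepsize sequences -/

/-- A perturbed linear contraction with factors `q (1 + 1 / (k + 1))`, `q < 1`, stays bounded. -/
theorem exists_bound_of_contraction {q c U : ℝ} (hq0 : 0 ≤ q) (hq1 : q < 1) (hc : 0 ≤ c)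
    (hU : 0 ≤ U) : ∃ B : ℝ, 0 ≤ B ∧ ∀ u : ℕ → ℝ, u 0 ≤ U →
      (∀ k : ℕ, u (k + 1) ≤ q * (((k : ℝ) + 2) / (k + 1)) * u k + c) → ∀ k, u k ≤ B := by
  have h1q : 0 < 1 - q := by linarith
  -- `B (k + 1) / (k + s)` is a supersolution of the recursion
  set s := 1 + 2 * q / (1 - q) with hs
  have hs1 : 1 ≤ s := by rw [hs]; linarith [div_nonneg (by linarith : 0 ≤ 2 * q) h1q.le]
  set B := s * U + 2 * c * (1 + s) / (1 - q) with hB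
  have hB0 : 0 ≤ B := by positivity
  refine ⟨B, hB0, fun u h0 hu => ?_⟩
  have hqs : q * (1 + s) ≤ (1 + q) / 2 * s := by
    have : (1 - q) * s = 1 + q := by rw [hs]; field_simp; ring
    nlinarith
  have hcB : c * (1 + s) ≤ B * (1 - q) / 2 := by
    have h1 : 2 * c * (1 + s) / (1 - q) ≤ B := by rw [hB]; nlinarith
    rw [div_le_iff₀ h1q] at h1
    linarith
  have key : ∀ k : ℕ, u k ≤ B * ((k + 1) / (k + s)) := by
    intro k
    induction k with
    | zero =>
      have h1 : s * U ≤ B := by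
        rw [hB]; linarith [div_nonneg (by positivity : 0 ≤ 2 * c * (1 + s)) h1q.le]
      have h2 : U ≤ B / s := by rw [le_div_iff₀ (by linarith)]; linarith
      have h3 : B * (((0 : ℕ) + 1) / ((0 : ℕ) + s)) = B / s := by push_cast; field_simp; ring
      rw [h3]; linarith
    | succ k ih =>
      have hk : (0 : ℝ) ≤ k := Nat.cast_nonneg k
      have hks : 0 < (k : ℝ) + s := by linarith
      have h1 : u (k + 1) ≤ q * (((k : ℝ) + 2) / (k + 1)) * (B * ((k + 1) / (k + s))) + c :=
        (hu k).trans (by gcongr)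
      refine h1.trans ?_
      have h2 : q * (((k : ℝ) + 2) / (k + 1)) * (B * ((k + 1) / (k + s))) =
          q * B * (k + 2) / (k + s) := by field_simp
      rw [h2]
      push_cast
      have h3 : B * (((k : ℝ) + 1 + 1) / (k + 1 + s)) = B * (k + 2) / (k + 1 + s) := by
        rw [show (k : ℝ) + 1 + 1 = k + 2 by ring, mul_div_assoc]
      rw [h3, div_add' _ _ _ hks.ne', div_le_div_iff₀ hks (by linarith)]
      have e1 : q * (k + 1 + s) ≤ (1 + q) / 2 * (k + s) := by nlinarith
      have e2 : c * (k + 1 + s) ≤ B * (1 - q) / 2 * (k + 2) := by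
        have : c * (k + 1 + s) ≤ c * (1 + s) * (k + 2) := by
          have : (k : ℝ) + 1 + s ≤ (1 + s) * (k + 2) := by nlinarith
          calc c * (k + 1 + s) ≤ c * ((1 + s) * (k + 2)) := mul_le_mul_of_nonneg_left this hc
            _ = _ := by ring
        exact this.trans (mul_le_mul_of_nonneg_right hcB (by linarith))
      have e3 := mul_le_mul_of_nonneg_left e1 (mul_nonneg hB0 (by linarith : (0 : ℝ) ≤ k + 2))
      have e4 := mul_le_mul_of_nonneg_right e2 hks.le
      nlinarith
  intro k
  refine (key k).trans (mul_le_of_le_one_right hB0 ?_)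
  have hk : (0 : ℝ) ≤ k := Nat.cast_nonneg k
  rw [div_le_one (by linarith)]
  linarith

/-- A sequence that contracts linearly up to perturbations of order `(k + 1)^{-p}` is itself of that
order. -/
theorem le_of_linear_contraction {B q c₂ p ρ D b U : ℝ} {e β : ℕ → ℝ}
    (hB : ∀ u : ℕ → ℝ, u 0 ≤ U →
      (∀ k : ℕ, u (k + 1) ≤ q * (((k : ℝ) + 2) / (k + 1)) * u k + 2 * c₂) → ∀ k, u k ≤ B)
    (hq : 0 ≤ q) (hρq : ρ ≤ q) (hc₂ : 0 ≤ c₂) (hp1 : p ≤ 1) (hD : 0 < D)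
    (hb : 0 < b) (he : ∀ k, 0 ≤ e k) (he0 : e 0 ≤ U * (D * b))
    (hstep : ∀ k, e (k + 1) ≤ ρ * e k + D * β k)
    (hβ : ∀ k : ℕ, β k ≤ c₂ * b / ((k : ℝ) + 1) ^ p) (k : ℕ) :
    e k ≤ B * (D * (b / ((k : ℝ) + 1) ^ p)) := by
  have hDb : 0 < D * b := by positivity
  have hpos : ∀ k : ℕ, (0 : ℝ) < ((k : ℝ) + 1) ^ p := fun k => by positivity
  have hmain := hB (fun k => e k * ((k : ℝ) + 1) ^ p / (D * b)) (by
      simp only [Nat.cast_zero, zero_add, Real.one_rpow, mul_one]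
      rwa [div_le_iff₀ hDb]) (fun k => ?_) k
  · rw [div_le_iff₀ hDb] at hmain
    have h1 : B * (D * (b / ((k : ℝ) + 1) ^ p)) = B * (D * b) / ((k : ℝ) + 1) ^ p := by
      field_simp
    rw [h1, le_div_iff₀ (hpos k)]
    exact hmain
  · have hk : (0 : ℝ) ≤ k := Nat.cast_nonneg k
    have hratio : (((k + 1 : ℕ) : ℝ) + 1) ^ p ≤ ((k : ℝ) + 2) / (k + 1) * ((k : ℝ) + 1) ^ p := by
      have h1 : (((k + 1 : ℕ) : ℝ) + 1) = ((k : ℝ) + 2) / (k + 1) * (k + 1) := by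
        push_cast; field_simp; ring
      rw [h1, Real.mul_rpow (by positivity) (by positivity)]
      refine mul_le_mul_of_nonneg_right ?_ (hpos k).le
      have h2 : 1 ≤ ((k : ℝ) + 2) / (k + 1) := by rw [le_div_iff₀ (by linarith)]; linarith
      simpa using Real.rpow_le_rpow_of_exponent_le h2 hp1
    have hr2 : ((k : ℝ) + 2) / (k + 1) ≤ 2 := by rw [div_le_iff₀ (by linarith)]; linarith
    have h1 : e (k + 1) ≤ q * e k + D * (c₂ * b / ((k : ℝ) + 1) ^ p) :=
      (hstep k).trans (add_le_add (mul_le_mul_of_nonneg_right hρq (he k))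
        (mul_le_mul_of_nonneg_left (hβ k) hD.le))
    have h2 : 0 ≤ q * e k + D * (c₂ * b / ((k : ℝ) + 1) ^ p) := by
      have := he k
      positivity
    have h3 : e (k + 1) * (((k + 1 : ℕ) : ℝ) + 1) ^ p ≤
        (q * e k + D * (c₂ * b / ((k : ℝ) + 1) ^ p)) *
          (((k : ℝ) + 2) / (k + 1) * ((k : ℝ) + 1) ^ p) :=
      mul_le_mul h1 hratio (by positivity) h2
    have h4 : (q * e k + D * (c₂ * b / ((k : ℝ) + 1) ^ p)) *
          (((k : ℝ) + 2) / (k + 1) * ((k : ℝ) + 1) ^ p) =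
        q * (((k : ℝ) + 2) / (k + 1)) * (e k * ((k : ℝ) + 1) ^ p) +
          c₂ * (D * b) * (((k : ℝ) + 2) / (k + 1)) := by
      have := (hpos k).ne'
      field_simp
    have h5 : c₂ * (D * b) * (((k : ℝ) + 2) / (k + 1)) ≤ c₂ * (D * b) * 2 :=
      mul_le_mul_of_nonneg_left hr2 (by positivity)
    rw [div_le_iff₀ hDb]
    calc _ ≤ q * (((k : ℝ) + 2) / (k + 1)) * (e k * ((k : ℝ) + 1) ^ p) + c₂ * (D * b) * 2 := by
          linarith
      _ = _ := by field_simp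

/-! ### Sums of powers of `1 / √(k + 1)` -/

theorem sqrt_le_sum_inv_sqrt (K : ℕ) :
    √((K : ℝ) + 1) ≤ ∑ k ∈ Finset.range (K + 1), 1 / √((k : ℝ) + 1) := by
  have h : ∀ k ∈ Finset.range (K + 1), 1 / √((K : ℝ) + 1) ≤ 1 / √((k : ℝ) + 1) := fun k hk => by
    have : (k : ℝ) ≤ K := by exact_mod_cast Nat.lt_succ_iff.1 (Finset.mem_range.1 hk)
    gcongr
  have h1 := Finset.sum_le_sum h
  simp only [Finset.sum_const, Finset.card_range, nsmul_eq_mul] at h1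
  refine le_trans (le_of_eq ?_) h1
  push_cast
  rw [mul_one_div, Real.div_sqrt]

theorem sum_inv_le_log {K : ℕ} (hK : 1 ≤ K) :
    ∑ k ∈ Finset.range (K + 1), (1 / √((k : ℝ) + 1)) ^ 2 ≤ 3 * Real.log ((K : ℝ) + 1) := by
  have h1 := harmonic_le_one_add_log (K + 1)
  rw [harmonic] at h1
  push_cast at h1
  have h2 : ∑ k ∈ Finset.range (K + 1), (1 / √((k : ℝ) + 1)) ^ 2 =
      ∑ k ∈ Finset.range (K + 1), ((k : ℝ) + 1)⁻¹ := by
    refine Finset.sum_congr rfl fun k _ => ?_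
    rw [div_pow, Real.sq_sqrt (by positivity), one_pow, one_div]
  have h3 : Real.log 2 ≤ Real.log ((K : ℝ) + 1) := by
    have : (1 : ℝ) ≤ K := by exact_mod_cast hK
    exact Real.log_le_log (by norm_num) (by linarith)
  have h4 := Real.log_two_gt_d9
  rw [h2]
  linarith

theorem sum_inv_sqrt_cubed_le (K : ℕ) :
    ∑ k ∈ Finset.range (K + 1), (1 / √((k : ℝ) + 1)) ^ 3 ≤ 3 := by
  have key : ∑ k ∈ Finset.range (K + 1), (1 / √((k : ℝ) + 1)) ^ 3 ≤ 3 - 2 / √((K : ℝ) + 1) := by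
    induction K with
    | zero => norm_num
    | succ K ih =>
      rw [Finset.sum_range_succ]
      set a := √((K : ℝ) + 1)
      set b := √(((K + 1 : ℕ) : ℝ) + 1)
      have ha : 0 < a := Real.sqrt_pos.2 (by positivity)
      have hb : 0 < b := Real.sqrt_pos.2 (by positivity)
      have ha2 : a ^ 2 = (K : ℝ) + 1 := Real.sq_sqrt (by positivity)
      have hb2 : b ^ 2 = a ^ 2 + 1 := by
        rw [ha2, Real.sq_sqrt (by positivity)]; push_cast; ring
      have hab : a ≤ b := by nlinarith
      -- `2 / a - 2 / b = 2 / (a b (a + b)) ≥ 1 / b³`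
      have h1 : (1 / b) ^ 3 ≤ 2 / a - 2 / b := by
        have e1 : 2 / a - 2 / b = 2 / (a * b * (a + b)) := by
          have : (b - a) * (a + b) = 1 := by nlinarith
          field_simp
          nlinarith
        rw [e1, div_pow, one_pow, div_le_div_iff₀ (by positivity) (by positivity)]
        have : a * b * (a + b) ≤ b * b * (b + b) := by gcongr
        nlinarith
      linarith
  have : (0 : ℝ) ≤ 2 / √((K : ℝ) + 1) := by positivity
  linarith

theorem sum_inv_sqrt_fourth_le (K : ℕ) :
    ∑ k ∈ Finset.range (K + 1), (1 / √((k : ℝ) + 1)) ^ 4 ≤ 3 := by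
  refine le_trans (Finset.sum_le_sum fun k _ => ?_) (sum_inv_sqrt_cubed_le K)
  have h1 : 1 / √((k : ℝ) + 1) ≤ 1 := by
    rw [div_le_one (Real.sqrt_pos.2 (by positivity)), Real.one_le_sqrt]
    linarith [(Nat.cast_nonneg k : (0 : ℝ) ≤ k)]
  exact pow_le_pow_of_le_one (by positivity) h1 (by norm_num)

/-- For stepsizes of order `b / √(k + 1)`, the weighted complexity bound is of order `1 / √K`. -/
theorem sum_stepsize_bound {c₁ c₂ b Q₁ Q₂ Q₃ Q₃' Q₄ : ℝ} {β : ℕ → ℝ} (hc₁ : 0 < c₁) (hb : 0 < b)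
    (hQ₁ : 0 ≤ Q₁) (hQ₂ : 0 ≤ Q₂) (hQ₃ : 0 ≤ Q₃) (hQ₃' : 0 ≤ Q₃') (hQ₄ : 0 ≤ Q₄)
    (hl : ∀ k : ℕ, c₁ * b / √((k : ℝ) + 1) ≤ β k) (hu : ∀ k : ℕ, β k ≤ c₂ * b / √((k : ℝ) + 1))
    {K : ℕ} (hK : 1 ≤ K) :
    (Q₁ + 3 / 2 * Q₂ * ∑ k ∈ Finset.range (K + 1), β k ^ 2
      + (Q₃ / 2 + Q₃') * ∑ k ∈ Finset.range (K + 1), β k ^ 3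
      + Q₄ * ∑ k ∈ Finset.range (K + 1), β k ^ 4) / ∑ k ∈ Finset.range (K + 1), β k / 4 ≤
    4 / c₁ * (1 + 5 * c₂ ^ 2 + 3 * |c₂| ^ 3 + 3 * c₂ ^ 4) *
      (Q₁ / (b * √((K : ℝ) + 1)) + Q₂ * (b * Real.log ((K : ℝ) + 1) / √((K : ℝ) + 1))
        + (Q₃ + Q₃') * (b ^ 2 / √((K : ℝ) + 1)) + Q₄ * (b ^ 3 / √((K : ℝ) + 1))) := by
  have hs : ∀ k : ℕ, 0 < √((k : ℝ) + 1) := fun k => Real.sqrt_pos.2 (by positivity)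
  have hβ0 : ∀ k, 0 ≤ β k := fun k => le_trans (by have := hs k; positivity) (hl k)
  have hc₂ : 0 < c₂ := by
    have h := (hl 0).trans (hu 0)
    have h1 : 0 < c₁ * b / √(((0 : ℕ) : ℝ) + 1) := by have := hs 0; positivity
    have h2 := h1.trans_le h
    rw [div_pos_iff_of_pos_right (hs 0)] at h2
    exact pos_of_mul_pos_left h2 hb.le
  have hpow : ∀ m : ℕ, ∑ k ∈ Finset.range (K + 1), β k ^ m ≤
      (c₂ * b) ^ m * ∑ k ∈ Finset.range (K + 1), (1 / √((k : ℝ) + 1)) ^ m := fun m => by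
    rw [Finset.mul_sum]
    refine Finset.sum_le_sum fun k _ => ?_
    rw [← mul_pow, mul_one_div]
    exact pow_le_pow_left₀ (hβ0 k) (hu k) m
  have hcb : 0 < c₂ * b := by positivity
  set S := √((K : ℝ) + 1) with hS
  set ℓ := Real.log ((K : ℝ) + 1) with hℓ
  have hSpos : 0 < S := hs K
  have hℓ0 : 0 ≤ ℓ := Real.log_nonneg (by linarith [(Nat.cast_nonneg K : (0 : ℝ) ≤ K)])
  have h2 : ∑ k ∈ Finset.range (K + 1), β k ^ 2 ≤ (c₂ * b) ^ 2 * (3 * ℓ) :=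
    (hpow 2).trans (by gcongr; exact sum_inv_le_log hK)
  have h3 : ∑ k ∈ Finset.range (K + 1), β k ^ 3 ≤ (c₂ * b) ^ 3 * 3 :=
    (hpow 3).trans (by gcongr; exact sum_inv_sqrt_cubed_le K)
  have h4 : ∑ k ∈ Finset.range (K + 1), β k ^ 4 ≤ (c₂ * b) ^ 4 * 3 :=
    (hpow 4).trans (by gcongr; exact sum_inv_sqrt_fourth_le K)
  have hden : c₁ * b * S / 4 ≤ ∑ k ∈ Finset.range (K + 1), β k / 4 := by
    rw [← Finset.sum_div]
    refine div_le_div_of_nonneg_right ?_ (by norm_num)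
    refine (mul_le_mul_of_nonneg_left (sqrt_le_sum_inv_sqrt K) (by positivity)).trans ?_
    rw [Finset.mul_sum]
    exact Finset.sum_le_sum fun k _ => by rw [mul_one_div]; exact hl k
  have hden0 : 0 < c₁ * b * S / 4 := by positivity
  have hnum : Q₁ + 3 / 2 * Q₂ * ∑ k ∈ Finset.range (K + 1), β k ^ 2
      + (Q₃ / 2 + Q₃') * ∑ k ∈ Finset.range (K + 1), β k ^ 3
      + Q₄ * ∑ k ∈ Finset.range (K + 1), β k ^ 4 ≤
      (1 + 5 * c₂ ^ 2 + 3 * c₂ ^ 3 + 3 * c₂ ^ 4) *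
        (Q₁ + Q₂ * (b ^ 2 * ℓ) + (Q₃ + Q₃') * b ^ 3 + Q₄ * b ^ 4) := by
    have g2 := mul_le_mul_of_nonneg_left h2 (by positivity : 0 ≤ 3 / 2 * Q₂)
    have g3 := mul_le_mul_of_nonneg_left h3 (by positivity : 0 ≤ Q₃ / 2 + Q₃')
    have g4 := mul_le_mul_of_nonneg_left h4 hQ₄
    set M := 1 + 5 * c₂ ^ 2 + 3 * c₂ ^ 3 + 3 * c₂ ^ 4 with hM
    have p2 : 0 < c₂ ^ 2 := by positivity
    have p3 : 0 < c₂ ^ 3 := by positivity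
    have p4 : 0 < c₂ ^ 4 := by positivity
    have f1 : Q₁ ≤ M * Q₁ := le_mul_of_one_le_left hQ₁ (by linarith)
    have f2 : 9 / 2 * c₂ ^ 2 * (Q₂ * (b ^ 2 * ℓ)) ≤ M * (Q₂ * (b ^ 2 * ℓ)) :=
      mul_le_mul_of_nonneg_right (by linarith) (by positivity)
    have f3 : 3 * c₂ ^ 3 * ((Q₃ / 2 + Q₃') * b ^ 3) ≤ M * ((Q₃ + Q₃') * b ^ 3) :=
      mul_le_mul (by linarith) (mul_le_mul_of_nonneg_right (by linarith) (by positivity))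
        (by positivity) (by positivity)
    have f4 : 3 * c₂ ^ 4 * (Q₄ * b ^ 4) ≤ M * (Q₄ * b ^ 4) :=
      mul_le_mul_of_nonneg_right (by linarith) (by positivity)
    rw [mul_pow] at g2 g3 g4
    linarith
  have hrhs0 : 0 ≤ (1 + 5 * c₂ ^ 2 + 3 * c₂ ^ 3 + 3 * c₂ ^ 4) *
        (Q₁ + Q₂ * (b ^ 2 * ℓ) + (Q₃ + Q₃') * b ^ 3 + Q₄ * b ^ 4) := by positivity
  calc _ ≤ ((1 + 5 * c₂ ^ 2 + 3 * c₂ ^ 3 + 3 * c₂ ^ 4) *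
        (Q₁ + Q₂ * (b ^ 2 * ℓ) + (Q₃ + Q₃') * b ^ 3 + Q₄ * b ^ 4)) / (c₁ * b * S / 4) :=
        div_le_div₀ hrhs0 hnum hden0 hden
    _ = _ := by
        rw [abs_of_pos hc₂]
        field_simp

/-! ### Trajectories and descent -/

section Trajectory

variable {n d r t : ℕ} {W : Matrix (Fin n) (Fin n) ℝ} {δ₁ δ₂ α ρ : ℝ}

local notation "⟪" x ", " y "⟫" => inner ℝ x y

/-- Along a trajectory the iterates stay in the consensus region and the consensus error contracts
up to the size of the gradient steps. -/
theorem ConsensusParams.trajectory (hp : ConsensusParams r W t δ₁ δ₂ α ρ) {β : ℕ → ℝ} {D : ℝ}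
    (hD : 0 < D) (hβ0 : ∀ k, 0 ≤ β k) (hβ1 : ∀ k, β k ≤ α * δ₁ / (5 * D))
    (hβ2 : ∀ k, β k ≤ (1 - ρ) * δ₁ / D) {x v : ℕ → Fin n → Matrix (Fin d) (Fin r) ℝ}
    (hx0 : x 0 ∈ consensusRegion n d r δ₁ δ₂)
    (hv : ∀ k i, v k i ∈ tangentSpace (x k i)) (hvD : ∀ k i, ‖v k i‖ ≤ D)
    (hstep : ∀ k i, x (k + 1) i =
      polarRetraction (x k i) (-(α • gradPhi W t (x k) i) - β k • v k i)) (k : ℕ) :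
    x k ∈ consensusRegion n d r δ₁ δ₂ ∧
      consensusErr (x (k + 1)) ≤ ρ * consensusErr (x k) + D * β k := by
  have hu : ∀ k i, β k • v k i ∈ tangentSpace (x k i) := fun k i =>
    smul_mem_tangentSpace _ (hv k i)
  have hub : ∀ k i, ‖β k • v k i‖ ≤ D * β k := fun k i => by
    rw [norm_smul, Real.norm_of_nonneg (hβ0 k), mul_comm]
    exact mul_le_mul_of_nonneg_right (hvD k i) (hβ0 k)
  have hN : ∀ k, x k ∈ consensusRegion n d r δ₁ δ₂ := fun k => by
    induction k with
    | zero => exact hx0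
    | succ k ih =>
      refine hp.step_mem_consensusRegion ih (hu k) (hub k) (hstep k) ?_ ?_
      · have := hβ1 k
        rw [le_div_iff₀ (by positivity)] at this
        linarith
      · have := hβ2 k
        rw [le_div_iff₀ hD] at this
        linarith
  exact ⟨hN k, hp.consensusErr_step_le (hN k) (hu k) (hub k) (hstep k)⟩

/-- The descent of the objective at the induced arithmetic mean along one step. -/
theorem ConsensusParams.descent (hp : ConsensusParams r W t δ₁ δ₂ α ρ) {β D C₀ L Ln : ℝ}
    (hβ0 : 0 ≤ β) (hLn : 0 ≤ L + Ln)
    {f : Matrix (Fin d) (Fin r) ℝ → ℝ} (hf : Differentiable ℝ f)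
    (hfL : ∀ x y, ‖euclGrad f x - euclGrad f y‖ ≤ L * ‖x - y‖)
    (hfLn : ∀ x ∈ stiefel d r, opNorm (euclGrad f x) ≤ Ln)
    {x x' v : Fin n → Matrix (Fin d) (Fin r) ℝ} (hx : x ∈ consensusRegion n d r δ₁ δ₂)
    (hv : ∀ i, v i ∈ tangentSpace (x i)) (hvD : ∀ i, ‖v i‖ ≤ D)
    (hstep : ∀ i, x' i = polarRetraction (x i) (-(α • gradPhi W t x i) - β • v i))
    (he : consensusErr x ^ 2 ≤ C₀ * D ^ 2 * β ^ 2)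
    (he' : consensusErr x' ^ 2 ≤ C₀ * D ^ 2 * β ^ 2) :
    f (iam x') ≤ f (iam x) - β * ⟪riemGrad f (iam x), euclMean v⟫
      + β / 4 * ‖riemGrad f (iam x)‖ ^ 2
      + ((3 * C₀ + 1) ^ 2 * D ^ 4 * β ^ 3 + 3 / 4 * (L + Ln) * (3 * C₀ + 1) ^ 2 * D ^ 4 * β ^ 4)
      + 3 / 2 * (L + Ln) * β ^ 2 * ‖euclMean v‖ ^ 2 := by
  have hu : ∀ i, β • v i ∈ tangentSpace (x i) := fun i => smul_mem_tangentSpace _ (hv i)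
  have hub : ∀ i, ‖β • v i‖ ≤ D * β := fun i => by
    rw [norm_smul, Real.norm_of_nonneg hβ0, mul_comm]
    exact mul_le_mul_of_nonneg_right (hvD i) hβ0
  have hxS' := step_mem_stiefel hx.1 hu hstep
  have hy := (isIAM_iam (x := x) (hp.stiefel_nonempty hx.1)).1
  have hy' := (isIAM_iam (x := x') (hp.stiefel_nonempty hx.1)).1
  have h1 := le_riemannian_quadratic_bound hf hfL hfLn hy hy'
  set g := riemGrad f (iam x)
  set V := euclMean v
  set Δ := iam x' - iam x
  set ε := (3 * C₀ + 1) * D ^ 2 * β ^ 2 with hε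
  have hV : euclMean (fun i => β • v i) = β • V := by
    simp only [V, euclMean, ← Finset.smul_sum]
    rw [smul_comm]
  have h2 : ‖Δ + β • V‖ ≤ ε := by
    have h := hp.norm_iam_step_le hx hu hub hstep
    rw [hV] at h
    refine h.trans ?_
    rw [hε]; linarith
  have h3 : ⟪g, Δ⟫ ≤ -(β * ⟪g, V⟫) + ‖g‖ * ε := by
    have h4 := (real_inner_le_norm g (Δ + β • V)).trans
      (mul_le_mul_of_nonneg_left h2 (norm_nonneg g))
    rw [inner_add_right, inner_smul_right] at h4
    linarith
  -- Young's inequality, with half of the available multiple of `‖g‖²`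
  have h4 : ‖g‖ * ε ≤ β / 4 * ‖g‖ ^ 2 + (3 * C₀ + 1) ^ 2 * D ^ 4 * β ^ 3 := by
    have h5 : 0 ≤ β * (‖g‖ / 2 - (3 * C₀ + 1) * D ^ 2 * β) ^ 2 :=
      mul_nonneg hβ0 (sq_nonneg _)
    rw [hε]; nlinarith
  have h5 : ‖Δ‖ ^ 2 ≤ 3 * (β ^ 2 * ‖V‖ ^ 2) + 3 / 2 * ε ^ 2 := by
    have h6 : ‖Δ‖ ≤ ‖Δ + β • V‖ + β * ‖V‖ := by
      have := norm_sub_le (Δ + β • V) (β • V)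
      rwa [add_sub_cancel_right, norm_smul β V, Real.norm_of_nonneg hβ0] at this
    have h7 := pow_le_pow_left₀ (norm_nonneg _) (h6.trans (add_le_add h2 le_rfl)) 2
    nlinarith [sq_nonneg (ε - 2 * (β * ‖V‖))]
  have h6 := mul_le_mul_of_nonneg_left h5 (by linarith : 0 ≤ (L + Ln) / 2)
  have h7 : ε ^ 2 = (3 * C₀ + 1) ^ 2 * D ^ 4 * β ^ 4 := by rw [hε]; ring
  rw [h7] at h6
  linarith

end Trajectory

/-- Telescoping a descent inequality bounds the smallest `a k`, as every weighted average dominates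
the minimum. -/
theorem inf'_le_div_of_telescope {a F R β : ℕ → ℝ} {Fstar : ℝ} (hβ : ∀ k, 0 < β k)
    (hF : ∀ k, Fstar ≤ F k) (hstep : ∀ k, F (k + 1) ≤ F k - β k / 4 * a k + R k) (K : ℕ) :
    (Finset.range (K + 1)).inf' Finset.nonempty_range_add_one a ≤
      (F 0 - Fstar + ∑ k ∈ Finset.range (K + 1), R k) /
        ∑ k ∈ Finset.range (K + 1), β k / 4 := by
  set I := (Finset.range (K + 1)).inf' Finset.nonempty_range_add_one a
  have hden : 0 < ∑ k ∈ Finset.range (K + 1), β k / 4 :=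
    Finset.sum_pos (fun k _ => div_pos (hβ k) (by norm_num)) Finset.nonempty_range_add_one
  rw [le_div_iff₀ hden, Finset.mul_sum]
  have h1 : ∑ k ∈ Finset.range (K + 1), I * (β k / 4) ≤
      ∑ k ∈ Finset.range (K + 1), (F k - F (k + 1) + R k) := by
    refine Finset.sum_le_sum fun k hk => ?_
    have h2 : I ≤ a k := Finset.inf'_le _ hk
    have h3 := mul_le_mul_of_nonneg_right h2 (div_pos (hβ k) (by norm_num : (0 : ℝ) < 4)).le
    linarith [hstep k]
  rw [Finset.sum_add_distrib, Finset.sum_range_sub'] at h1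
  linarith [hF (K + 1)]

section Expectation

/-- The measurable structure of matrices is Borel for the topology of the Frobenius norm, which is
definitionally, but not reducibly, the product topology. -/
scoped instance frobeniusBorelSpace (d r : ℕ) :
    @BorelSpace (Matrix (Fin d) (Fin r) ℝ)
      Matrix.frobeniusNormedAddCommGroup.toSeminormedAddCommGroup.toPseudoMetricSpace.toUniformSpace.toTopologicalSpace
      (matrixMeasurableSpace d r) :=
  matrixBorelSpace d r

theorem integrable_of_measurable_of_bounded {Ω E : Type*} [MeasurableSpace Ω] {P : Measure Ω}
    [IsFiniteMeasure P] [NormedAddCommGroup E] [NormedSpace ℝ E] [FiniteDimensional ℝ E]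
    [MeasurableSpace E] [BorelSpace E] {X : Ω → E} (hX : Measurable X) {B : ℝ}
    (hB : ∀ᵐ ω ∂P, ‖X ω‖ ≤ B) : Integrable X P :=
  have := FiniteDimensional.proper_real E
  Integrable.of_bound hX.aestronglyMeasurable B hB

variable {n d r t : ℕ} {W : Matrix (Fin n) (Fin n) ℝ} {δ₁ δ₂ α ρ : ℝ} {Ω : Type*}
  [MeasurableSpace Ω] {P : Measure Ω} [IsProbabilityMeasure P]

/-- Continuous functions of the induced arithmetic mean are integrable, since the Stiefel manifold
is compact. -/
theorem ConsensusParams.integrable_comp_iam (hp : ConsensusParams r W t δ₁ δ₂ α ρ)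
    {X : Ω → Fin n → Matrix (Fin d) (Fin r) ℝ} (hX : Measurable X)
    (hXN : ∀ᵐ ω ∂P, X ω ∈ consensusRegion n d r δ₁ δ₂)
    {φ : Matrix (Fin d) (Fin r) ℝ → ℝ} (hφ : Continuous φ) :
    Integrable (fun ω => φ (iam (X ω))) P := by
  obtain ⟨B, hB⟩ := (isCompact_stiefel d r).exists_bound_of_continuousOn hφ.continuousOn
  refine Integrable.of_bound ((aestronglyMeasurable_comp_iam hp.n_ne_zero hp.δ₁_pos.le
    (by linarith [hp.δ₁_le_const]) hXN hφ).mono hX.comap_le) B ?_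
  filter_upwards [hXN] with ω hω
  exact hB _ (isIAM_iam (hp.stiefel_nonempty hω.1)).1

variable [StandardBorelSpace Ω]

/-- One step of the algorithm decreases the expected objective at the induced arithmetic mean. -/
theorem ConsensusParams.integral_descent (hp : ConsensusParams r W t δ₁ δ₂ α ρ)
    {f : Fin n → Matrix (Fin d) (Fin r) ℝ → ℝ} {L Ln β D Ξ C₀ : ℝ} (hL : 0 ≤ L + Ln)
    (hf : ∀ i, Differentiable ℝ (f i))
    (hfL : ∀ i x y, ‖euclGrad (f i) x - euclGrad (f i) y‖ ≤ L * ‖x - y‖)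
    (hfLn : ∀ i, ∀ x ∈ stiefel d r, opNorm (euclGrad (f i) x) ≤ Ln)
    (hβ0 : 0 ≤ β) (hβ1 : 5 * ((L + Ln) * β) ≤ 1)
    {X X' V : Ω → Fin n → Matrix (Fin d) (Fin r) ℝ} (hX : Measurable X) (hX' : Measurable X')
    (hV : Measurable V)
    (hstep : ∀ ω i, X' ω i = polarRetraction (X ω i) (-(α • gradPhi W t (X ω) i) - β • V ω i))
    (hXN : ∀ᵐ ω ∂P, X ω ∈ consensusRegion n d r δ₁ δ₂)
    (hX'N : ∀ᵐ ω ∂P, X' ω ∈ consensusRegion n d r δ₁ δ₂)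
    (he : ∀ᵐ ω ∂P, consensusErr (X ω) ^ 2 ≤ C₀ * D ^ 2 * β ^ 2)
    (he' : ∀ᵐ ω ∂P, consensusErr (X' ω) ^ 2 ≤ C₀ * D ^ 2 * β ^ 2)
    (hVT : ∀ i, ∀ᵐ ω ∂P, V ω i ∈ tangentSpace (X ω i)) (hVD : ∀ i, ∀ᵐ ω ∂P, ‖V ω i‖ ≤ D)
    (hVE : ∀ i, P[fun ω => V ω i | MeasurableSpace.comap X inferInstance]
      =ᵐ[P] fun ω => riemGrad (f i) (X ω i))
    (hind : ∀ i j, i ≠ j → CondIndepFun (MeasurableSpace.comap X inferInstance) hX.comap_le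
      (fun ω => V ω i) (fun ω => V ω j) P)
    (hvar : ∀ i, ∫ ω, ‖V ω i - riemGrad (f i) (X ω i)‖ ^ 2 ∂P ≤ Ξ ^ 2) :
    ∫ ω, average f (iam (X' ω)) ∂P ≤ ∫ ω, average f (iam (X ω)) ∂P
      - β / 4 * ∫ ω, ‖riemGrad (average f) (iam (X ω))‖ ^ 2 ∂P
      + (3 / 2 * (L + Ln) * (Ξ ^ 2 / n) * β ^ 2
        + ((L + 2 * Ln) ^ 2 * C₀ / 2 * D ^ 2 + (3 * C₀ + 1) ^ 2 * D ^ 4) * β ^ 3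
        + 3 / 4 * (L + Ln) * (3 * C₀ + 1) ^ 2 * D ^ 4 * β ^ 4) := by
  have hn := hp.n_ne_zero
  have hFL := norm_euclGrad_average_sub_le hn hf hfL
  have hFLn := opNorm_euclGrad_average_le hn hf hfLn
  have hFd := differentiable_average hf
  have hFg : Continuous (riemGrad (average f)) := continuous_riemGrad hFL
  -- a common bound for all gradients
  obtain ⟨B, hB⟩ := (isCompact_stiefel d r).exists_bound_of_continuousOn
    (f := fun x => ∑ i, ‖riemGrad (f i) x‖)
    (continuous_finsetSum _ fun i _ => (continuous_riemGrad (hfL i)).norm).continuousOn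
  obtain ⟨B', hB'⟩ := (isCompact_stiefel d r).exists_bound_of_continuousOn hFg.continuousOn
  have hgB : ∀ i, ∀ᵐ ω ∂P, ‖riemGrad (f i) (X ω i)‖ ≤ B := fun i => by
    filter_upwards [hXN] with ω hω
    refine le_trans ?_ ((Real.le_norm_self _).trans (hB _ (hω.1 i)))
    exact Finset.single_le_sum (f := fun j => ‖riemGrad (f j) (X ω i)‖)
      (fun j _ => norm_nonneg _) (Finset.mem_univ i)
  have hmean : ∀ (w : Fin n → Matrix (Fin d) (Fin r) ℝ) (b : ℝ), (∀ i, ‖w i‖ ≤ b) →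
      ‖euclMean w‖ ≤ b := fun w b hw => by
    rw [euclMean, norm_smul, Real.norm_of_nonneg (by positivity), one_div,
      inv_mul_le_iff₀ hp.n_pos]
    refine (norm_sum_le _ _).trans ((Finset.sum_le_sum fun i _ => hw i).trans ?_)
    simp
  have hVi : ∀ i, Measurable fun ω => V ω i := fun i => (measurable_pi_apply i).comp hV
  have hVint := fun i => integrable_of_measurable_of_bounded (hVi i) (hVD i)
  have hVGmean : P[fun ω => euclMean (V ω) | MeasurableSpace.comap X inferInstance] =ᵐ[P]
      fun ω => euclMean fun i => riemGrad (f i) (X ω i) := by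
    have e1 : (fun ω => euclMean (V ω)) = (1 / (n : ℝ)) • ∑ i, fun ω => V ω i := by
      funext ω; simp [euclMean]
    rw [e1]
    refine (condExp_smul _ _ _).trans ?_
    have e2 := condExp_finsetSum (s := Finset.univ) (fun i _ => hVint i)
      (MeasurableSpace.comap X inferInstance)
    filter_upwards [e2, ae_all_iff.2 hVE] with ω h1 h2
    rw [Pi.smul_apply, h1, Finset.sum_apply, euclMean]
    simp only [h2]
  have hVvar : ∫ ω, ‖euclMean (V ω) - euclMean fun i => riemGrad (f i) (X ω i)‖ ^ 2 ∂P ≤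
      Ξ ^ 2 / n := by
    have h := integral_norm_average_sub_sq_le (hm := hX.comap_le) hn hVi hVD hgB hVE hind hvar
    simpa only [euclMean, ← smul_sub, ← Finset.sum_sub_distrib] using h
  have hmain := DRSGD.integral_descent (P := P) (m := MeasurableSpace.comap X inferInstance)
    (g := fun ω => riemGrad (average f) (iam (X ω)))
    (G := fun ω => euclMean fun i => riemGrad (f i) (X ω i)) (V := fun ω => euclMean (V ω))
    (Φ := fun ω => average f (iam (X ω))) (Φ' := fun ω => average f (iam (X' ω)))
    (a := max D (max B B')) (β := β) (l := L + Ln)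
    (R := (3 * C₀ + 1) ^ 2 * D ^ 4 * β ^ 3 + 3 / 4 * (L + Ln) * (3 * C₀ + 1) ^ 2 * D ^ 4 * β ^ 4)
    (q := (L + 2 * Ln) ^ 2 * (C₀ * D ^ 2 * β ^ 2)) (s := Ξ ^ 2 / n)
    hX.comap_le hβ0 (by linarith [mul_nonneg hL hβ0])
    (aestronglyMeasurable_comp_iam hn hp.δ₁_pos.le (by linarith [hp.δ₁_le_const]) hXN hFg)
    (by
      have : Measurable fun ω => euclMean (V ω) :=
        Continuous.measurable (f := euclMean) (by unfold euclMean; fun_prop) |>.comp hV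
      exact this.aestronglyMeasurable)
    hVGmean
    (by
      filter_upwards [hXN] with ω hω
      exact (hB' _ (isIAM_iam (hp.stiefel_nonempty hω.1)).1).trans
        ((le_max_right _ _).trans (le_max_right _ _)))
    (by
      filter_upwards [ae_all_iff.2 hgB] with ω hω
      exact (hmean _ _ hω).trans ((le_max_left _ _).trans (le_max_right _ _)))
    (by
      filter_upwards [ae_all_iff.2 hVD] with ω hω
      exact (hmean _ _ hω).trans (le_max_left _ _))
    (hp.integrable_comp_iam hX hXN hFd.continuous)
    (hp.integrable_comp_iam hX' hX'N hFd.continuous) hL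
    (by
      filter_upwards [hXN, he, he', ae_all_iff.2 hVT, ae_all_iff.2 hVD] with ω h1 h2 h3 h4 h5
      exact hp.descent hβ0 hL hFd hFL hFLn h1 h4 h5 (hstep ω) h2 h3)
    (by
      filter_upwards [hXN, he] with ω h1 h2
      exact (norm_euclMean_riemGrad_sub_le hn hf hfL hfLn h1.1).trans
        (mul_le_mul_of_nonneg_left h2 (sq_nonneg _)))
    hVvar
  refine hmain.trans (le_of_eq ?_)
  ring

end Expectation

/-! ### Consensus and stationarity -/

section Assembly

variable {n d r t : ℕ} {W : Matrix (Fin n) (Fin n) ℝ} {δ₁ δ₂ α ρ : ℝ}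

/-- Where `L_t ≤ 0` the quotient bounding `α` carries no information, but then `α L_t ≤ 0`. -/
theorem IsMixingMatrix.consensusParams (hW : IsMixingMatrix W) (hn : 2 ≤ n) (hr : 1 ≤ r)
    (ht : 1 ≤ t) (hlog : ⌈Real.logb (sigmaTwo W) (1 / (2 * √(n : ℝ)))⌉ ≤ (t : ℤ))
    (hδ₁ : 0 < δ₁) (hδ : δ₁ ≤ δ₂ / (5 * √(r : ℝ))) (hδ₂ : δ₂ ≤ 1 / 6) (hα : 0 < α)
    (hα' : α ≤ min ((2 - δ₂ ^ 2) / (2 * consensusLip W t)) 1) (hρ : ρ = rhoT r δ₁ δ₂ α W t)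
    (hρ1 : ρ < 1) : ConsensusParams r W t δ₁ δ₂ α ρ where
  two_le := hn
  one_le := hr
  stoch := hW.isSymmStochastic_pow t
  row := hW.sum_sq_pow_sub_le_of_logb hn ht hlog
  δ₁_pos := hδ₁
  δ₁_le := hδ
  δ₂_le := hδ₂
  α_pos := hα
  α_le_one := hα'.trans (min_le_right _ _)
  α_mul_le := by
    have h1 := hα'.trans (min_le_left _ _)
    rcases le_or_gt (consensusLip W t) 0 with h | h
    · have h2 : 0 ≤ δ₂ := by
        by_contra h2
        exact absurd (div_nonpos_of_nonpos_of_nonneg (not_le.1 h2).le (by positivity))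
          (not_le.2 (hδ₁.trans_le hδ))
      nlinarith [mul_nonpos_of_nonneg_of_nonpos hα.le h]
    · rw [le_div_iff₀ (by positivity)] at h1
      linarith
  ρ_eq := hρ
  ρ_lt_one := hρ1

/-- The constants of the complexity bound dominate those produced by the descent inequality. Since
`α ≥ (1 - q) / 2`, the last term of `C` makes `α C` large as well. -/
theorem constants_le {C₀ C q : ℝ} (hC₀ : 0 ≤ C₀) (hq : q < 1) (hr : 1 ≤ r) (hα : 1 - q ≤ 2 * α)
    (hC : C = 4 * C₀ + 1 + (3 * C₀ + 1) * (2 / (1 - q))) :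
    4 * C₀ ≤ C ∧ (3 * C₀ + 1) ^ 2 ≤ T₁ r α C ∧ 3 / 4 * (3 * C₀ + 1) ^ 2 ≤ T₂ α C := by
  have h1q : 0 < 1 - q := by linarith
  have hα0 : 0 < α := by linarith
  have h0 : 0 ≤ (3 * C₀ + 1) * (2 / (1 - q)) := by positivity
  have hr' : 1 ≤ √(r : ℝ) := Real.one_le_sqrt.2 (by exact_mod_cast hr)
  have h1 : 3 * C₀ + 1 ≤ C := by linarith
  have h2 : 3 * C₀ + 1 ≤ α * C := by
    have e1 : 3 * C₀ + 1 = (1 - q) / 2 * ((3 * C₀ + 1) * (2 / (1 - q))) := by field_simp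
    rw [e1]
    exact mul_le_mul (by linarith) (by linarith) h0 hα0.le
  have h3 := pow_le_pow_left₀ (by positivity) h1 2
  have h4 := pow_le_pow_left₀ (by positivity) h2 2
  rw [mul_pow] at h4
  refine ⟨by linarith, ?_, ?_⟩
  · have h5 : 1 ≤ (4 * √(r : ℝ) + 6 * α) ^ 2 := one_le_pow₀ (by linarith)
    have h6 := mul_le_mul_of_nonneg_right h5 (sq_nonneg C)
    rw [T₁]
    linarith [sq_nonneg C]
  · rw [T₂]
    linarith [sq_nonneg (3 * C₀ + 1)]

variable {Ω : Type*} [MeasurableSpace Ω] [StandardBorelSpace Ω] {P : Measure Ω}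
  [IsProbabilityMeasure P]

theorem ConsensusParams.ae_trajectory (hp : ConsensusParams r W t δ₁ δ₂ α ρ) {β : ℕ → ℝ} {D Ξ : ℝ}
    (hD : 0 < D) (hβ0 : ∀ k, 0 ≤ β k) (hβ1 : ∀ k, β k ≤ α * δ₁ / (5 * D))
    (hβ2 : ∀ k, β k ≤ (1 - ρ) * δ₁ / D) {f : Fin n → Matrix (Fin d) (Fin r) ℝ → ℝ}
    {x₀ : Fin n → Matrix (Fin d) (Fin r) ℝ} (hx₀ : x₀ ∈ consensusRegion n d r δ₁ δ₂)
    {v x : ℕ → Ω → Fin n → Matrix (Fin d) (Fin r) ℝ} (hrun : IsRun W t α β x₀ v x)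
    (hsg : IsStochasticGradient P f Ξ D v x hrun.measurable_x) :
    ∀ᵐ ω ∂P, ∀ k, x k ω ∈ consensusRegion n d r δ₁ δ₂ ∧
      consensusErr (x (k + 1) ω) ≤ ρ * consensusErr (x k ω) + D * β k := by
  filter_upwards [ae_all_iff.2 fun k => ae_all_iff.2 (hsg.tangent k),
    ae_all_iff.2 fun k => ae_all_iff.2 (hsg.bounded k)] with ω h1 h2
  exact hp.trajectory (x := fun k => x k ω) (v := fun k => v k ω) hD hβ0 hβ1 hβ2
    (by rw [hrun.init]; exact hx₀) h1 h2 fun k i => hrun.step k ω i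

/-- The complexity bound, for a run whose consensus error is of the order of the stepsize. -/
theorem ConsensusParams.inf'_le (hp : ConsensusParams r W t δ₁ δ₂ α ρ) {β : ℕ → ℝ}
    {D Ξ L Ln C C₀ : ℝ} (hL : 0 ≤ L) (hLn : 0 ≤ Ln) (hβ0 : ∀ k, 0 < β k)
    (hβL : ∀ k, 5 * ((L + Ln) * β k) ≤ 1) {f : Fin n → Matrix (Fin d) (Fin r) ℝ → ℝ}
    (hf : ∀ i, Differentiable ℝ (f i))
    (hfL : ∀ i x y, ‖euclGrad (f i) x - euclGrad (f i) y‖ ≤ L * ‖x - y‖)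
    (hfLn : ∀ i, ∀ x ∈ stiefel d r, opNorm (euclGrad (f i) x) ≤ Ln)
    {x₀ : Fin n → Matrix (Fin d) (Fin r) ℝ}
    {v x : ℕ → Ω → Fin n → Matrix (Fin d) (Fin r) ℝ} (hrun : IsRun W t α β x₀ v x)
    (hsg : IsStochasticGradient P f Ξ D v x hrun.measurable_x)
    (hxN : ∀ k, ∀ᵐ ω ∂P, x k ω ∈ consensusRegion n d r δ₁ δ₂)
    (he : ∀ k, ∀ᵐ ω ∂P, consensusErr (x k ω) ^ 2 ≤ C₀ * D ^ 2 * β k ^ 2)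
    (he' : ∀ k, ∀ᵐ ω ∂P, consensusErr (x (k + 1) ω) ^ 2 ≤ C₀ * D ^ 2 * β k ^ 2)
    (hC₀ : 0 ≤ C₀) (hC : 4 * C₀ ≤ C) (hT₁ : (3 * C₀ + 1) ^ 2 ≤ T₁ r α C)
    (hT₂ : 3 / 4 * (3 * C₀ + 1) ^ 2 ≤ T₂ α C) (K : ℕ) :
    (Finset.range (K + 1)).inf' Finset.nonempty_range_add_one
        (fun k => ∫ ω, ‖riemGrad (average f) (iam (x k ω))‖ ^ 2 ∂P) ≤
      (average f (iam x₀) - sInf (average f '' stiefel d r)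
        + 3 * (L + Ln) * Ξ ^ 2 / (2 * n) * ∑ k ∈ Finset.range (K + 1), β k ^ 2
        + (C * D ^ 2 * (L + Ln) ^ 2 / 2 + T₁ r α C * D ^ 4)
            * ∑ k ∈ Finset.range (K + 1), β k ^ 3
        + T₂ α C * (L + Ln) * D ^ 4 * ∑ k ∈ Finset.range (K + 1), β k ^ 4)
        / ∑ k ∈ Finset.range (K + 1), β k / 4 := by
  have hFc : Continuous (average f) := (differentiable_average hf).continuous
  have hlow : ∀ k, sInf (average f '' stiefel d r) ≤ ∫ ω, average f (iam (x k ω)) ∂P := fun k => by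
    have h1 := integral_mono_ae (integrable_const (sInf (average f '' stiefel d r)))
      (hp.integrable_comp_iam (hrun.measurable_x k) (hxN k) hFc) (by
        filter_upwards [hxN k] with ω hω
        exact csInf_le ((isCompact_stiefel d r).image hFc).bddBelow
          ⟨_, (isIAM_iam (hp.stiefel_nonempty hω.1)).1, rfl⟩)
    simpa using h1
  have h := inf'_le_div_of_telescope
    (a := fun k => ∫ ω, ‖riemGrad (average f) (iam (x k ω))‖ ^ 2 ∂P)
    (R := fun k => 3 * (L + Ln) * Ξ ^ 2 / (2 * n) * β k ^ 2
      + (C * D ^ 2 * (L + Ln) ^ 2 / 2 + T₁ r α C * D ^ 4) * β k ^ 3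
      + T₂ α C * (L + Ln) * D ^ 4 * β k ^ 4) hβ0 hlow (fun k => ?_) K
  · -- the starting point is deterministic
    simp only [Finset.sum_add_distrib, ← Finset.mul_sum, hrun.init, integral_const, probReal_univ,
      one_smul, ← add_assoc] at h
    exact h
  · have hLL : 0 ≤ L + Ln := by linarith
    have h1 := hp.integral_descent (C₀ := C₀) hLL hf hfL hfLn (hβ0 k).le (hβL k)
      (hrun.measurable_x k) (hrun.measurable_x (k + 1)) (hrun.measurable_v k) (hrun.step k)
      (hxN k) (hxN (k + 1)) (he k) (he' k) (hsg.tangent k) (hsg.bounded k) (hsg.unbiased k)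
      (hsg.indep k) (hsg.variance k)
    refine h1.trans (add_le_add_right ?_ _)
    have hβ := (hβ0 k).le
    have e2 : (L + 2 * Ln) ^ 2 * C₀ / 2 ≤ C * (L + Ln) ^ 2 / 2 := by
      have h2 : (L + 2 * Ln) ^ 2 ≤ (2 * (L + Ln)) ^ 2 :=
        pow_le_pow_left₀ (by linarith) (by linarith) 2
      have h3 := mul_le_mul_of_nonneg_right h2 hC₀
      have h4 := mul_le_mul_of_nonneg_right hC (sq_nonneg (L + Ln))
      linarith
    have e3 := mul_le_mul_of_nonneg_right e2 (by positivity : 0 ≤ D ^ 2 * β k ^ 3)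
    have e4 := mul_le_mul_of_nonneg_right hT₁ (by positivity : 0 ≤ D ^ 4 * β k ^ 3)
    have e5 := mul_le_mul_of_nonneg_right hT₂
      (mul_nonneg hLL (by positivity : 0 ≤ D ^ 4 * β k ^ 4))
    have e6 : 3 / 2 * (L + Ln) * (Ξ ^ 2 / n) * β k ^ 2 =
      3 * (L + Ln) * Ξ ^ 2 / (2 * n) * β k ^ 2 := by ring
    linarith

end Assembly

end

end DRSGD

theorem mainTheorem1 (c₁ c₂ : ℝ) (hc₁ : 0 < c₁) :
    ∃ A : ℝ, 0 < A ∧ ∀ (p ρ₀ κ : ℝ), 0 < p → p ≤ 1 → ρ₀ < 1 →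
    ∃ C : ℝ, 0 < C ∧
    ∀ (n d r : ℕ) (_ : 2 ≤ n) (_ : 1 ≤ r) (_ : r ≤ d)
      -- the network, the consensus region and the consensus stepsize
      (W : Matrix (Fin n) (Fin n) ℝ) (_ : DRSGD.IsMixingMatrix W)
      (t : ℕ) (_ : 1 ≤ t) (_ : ⌈Real.logb (DRSGD.sigmaTwo W) (1 / (2 * √(n : ℝ)))⌉ ≤ (t : ℤ))
      (δ₁ δ₂ α : ℝ) (_ : 0 < δ₁) (_ : δ₁ ≤ δ₂ / (5 * √(r : ℝ))) (_ : δ₂ ≤ 1 / 6)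
      (_ : 0 < α) (_ : α ≤ min ((2 - δ₂ ^ 2) / (2 * DRSGD.consensusLip W t)) 1)
      -- the objective
      (f : Fin n → Matrix (Fin d) (Fin r) ℝ → ℝ) (L Ln Lg LG : ℝ) (_ : 0 < L)
      (_ : ∀ i, Differentiable ℝ (f i))
      (_ : ∀ i x y, ‖DRSGD.euclGrad (f i) x - DRSGD.euclGrad (f i) y‖ ≤ L * ‖x - y‖)
      (_ : ∀ i, ∀ x ∈ DRSGD.stiefel d r, DRSGD.opNorm (DRSGD.euclGrad (f i) x) ≤ Ln)
      (_ : Lg = L + Ln) (_ : LG = L + 2 * Ln)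
      -- the stepsizes
      (D Ξ : ℝ) (_ : 0 < D) (_ : 0 ≤ Ξ) (_ : LG ≤ κ * D)
      (ρ βtilde : ℝ) (_ : ρ = DRSGD.rhoT r δ₁ δ₂ α W t) (_ : ρ ≤ ρ₀)
      (_ : βtilde = min ((1 - ρ) / D) (1 / LG))
      (β : ℕ → ℝ) (_ : Antitone β)
      (_ : ∀ k : ℕ, c₁ * βtilde / ((k : ℝ) + 1) ^ p ≤ β k)
      (_ : ∀ k : ℕ, β k ≤ c₂ * βtilde / ((k : ℝ) + 1) ^ p)
      (_ : ∀ k : ℕ, β k ≤ min (min (1 / (5 * Lg)) (α * δ₁ / (5 * D))) ((1 - ρ) * δ₁ / D))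
      -- the stochastic gradients and the iterates
      (Ω : Type*) (_ : MeasurableSpace Ω) (_ : StandardBorelSpace Ω)
      (P : MeasureTheory.Measure Ω) (_ : MeasureTheory.IsProbabilityMeasure P)
      (x₀ : Fin n → Matrix (Fin d) (Fin r) ℝ) (_ : x₀ ∈ DRSGD.consensusRegion n d r δ₁ δ₂)
      (v x : ℕ → Ω → Fin n → Matrix (Fin d) (Fin r) ℝ)
      (hrun : DRSGD.IsRun W t α β x₀ v x)
      (_ : DRSGD.IsStochasticGradient P f Ξ D v x hrun.measurable_x)
      (F : Matrix (Fin d) (Fin r) ℝ → ℝ) (_ : F = DRSGD.average f)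
      (Fstar : ℝ) (_ : Fstar = sInf (F '' DRSGD.stiefel d r)),
      -- consensus
      (∀ᵐ ω ∂P, ∀ k, x k ω ∈ DRSGD.consensusRegion n d r δ₁ δ₂ ∧
        1 / (n : ℝ) * DRSGD.consensusErrSq (x k ω) ≤ C * D ^ 2 * β k ^ 2) ∧
      -- the expectations below are finite
      (∀ k, MeasureTheory.Integrable
        (fun ω => ‖DRSGD.riemGrad F (DRSGD.iam (x k ω))‖ ^ 2) P) ∧
      -- stationarity at the induced arithmetic mean
      (∀ K : ℕ,
        (Finset.range (K + 1)).inf' Finset.nonempty_range_add_one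
          (fun k => ∫ ω, ‖DRSGD.riemGrad F (DRSGD.iam (x k ω))‖ ^ 2 ∂P) ≤
        (F (DRSGD.iam x₀) - Fstar
          + 3 * Lg * Ξ ^ 2 / (2 * n) * ∑ k ∈ Finset.range (K + 1), β k ^ 2
          + (C * D ^ 2 * Lg ^ 2 / 2 + DRSGD.T₁ r α C * D ^ 4)
              * ∑ k ∈ Finset.range (K + 1), β k ^ 3
          + DRSGD.T₂ α C * Lg * D ^ 4 * ∑ k ∈ Finset.range (K + 1), β k ^ 4)
          / ∑ k ∈ Finset.range (K + 1), β k / 4) ∧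
      -- the rate for `p = 1/2`
      (p = 1 / 2 → ∀ K : ℕ, 1 ≤ K →
        (Finset.range (K + 1)).inf' Finset.nonempty_range_add_one
          (fun k => ∫ ω, ‖DRSGD.riemGrad F (DRSGD.iam (x k ω))‖ ^ 2 ∂P) ≤
        A * ((F (DRSGD.iam x₀) - Fstar) / (βtilde * √((K : ℝ) + 1))
          + Lg * Ξ ^ 2 / n * (βtilde * Real.log ((K : ℝ) + 1) / √((K : ℝ) + 1))
          + (C * D ^ 2 * Lg ^ 2 + DRSGD.T₁ r α C * D ^ 4) * (βtilde ^ 2 / √((K : ℝ) + 1))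
          + DRSGD.T₂ α C * Lg * D ^ 4 * (βtilde ^ 3 / √((K : ℝ) + 1)))) := by
  refine ⟨4 / c₁ * (1 + 5 * c₂ ^ 2 + 3 * |c₂| ^ 3 + 3 * c₂ ^ 4), by positivity,
    fun p ρ₀ κ hp0 hp1 hρ₀ => ?_⟩
  -- nonnegative rates and positive ratios, whatever the signs of `ρ₀` and `κ`
  set q := max ρ₀ 0 with hq
  have hq0 : 0 ≤ q := le_max_right _ _
  have hq1 : q < 1 := max_lt hρ₀ one_pos
  have h1q : 0 < 1 - q := by linarith
  set κ' := max κ 1 with hκ'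
  have hκ0 : 0 < κ' := lt_max_of_lt_right one_pos
  -- `D β̃ ≥ min (1 - q) (1 / κ')`, so `U D β̃ ≥ 1` bounds the initial consensus error
  set U := 1 / min (1 - q) (1 / κ') with hU
  have hm : 0 < min (1 - q) (1 / κ') := lt_min h1q (by positivity)
  -- the consensus error is at most `B D β̃ / (k + 1) ^ p`, hence at most `(B / c₁) D β k`
  obtain ⟨B, hB0, hB⟩ := DRSGD.exists_bound_of_contraction (q := q) (c := 2 * |c₂|) (U := U) hq0 hq1
    (by positivity) (by positivity)
  set C₀ := (B / c₁) ^ 2 with hC₀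
  have hC₀0 : 0 ≤ C₀ := sq_nonneg _
  refine ⟨4 * C₀ + 1 + (3 * C₀ + 1) * (2 / (1 - q)), by positivity, ?_⟩
  intro n d r hn hr hrd W hW t ht hlog δ₁ δ₂ α hδ₁ hδ hδ₂ hα hα' f L Ln Lg LG hL hf hfL hfLn hLg hLG
    D Ξ hD hΞ hκD ρ βt hρ hρρ₀ hβt β hanti hβl hβu hβm Ω _ _ P _ x₀ hx₀ v x hrun hsg F hF Fstar hFs
  subst hF hFs hLg hLG
  set C := 4 * C₀ + 1 + (3 * C₀ + 1) * (2 / (1 - q)) with hC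
  have hρq : ρ ≤ q := hρρ₀.trans (le_max_left _ _)
  have hp : DRSGD.ConsensusParams r W t δ₁ δ₂ α ρ :=
    hW.consensusParams hn hr ht hlog hδ₁ hδ hδ₂ hα hα' hρ (hρq.trans_lt hq1)
  obtain ⟨hC4, hT₁, hT₂⟩ := DRSGD.constants_le (α := α) hC₀0 hq1 hr
    (by linarith [hp.one_sub_ρ_le]) hC
  have hLn : 0 ≤ Ln := by
    obtain ⟨y, hy⟩ := DRSGD.stiefel_nonempty hrd
    exact (DRSGD.opNorm_nonneg _).trans (hfLn ⟨0, by omega⟩ y hy)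
  have hLG : 0 < L + 2 * Ln := by linarith
  have hLg : 0 < L + Ln := by linarith
  have h1ρ : 0 < 1 - ρ := by linarith
  have hβt0 : 0 < βt := by rw [hβt]; exact lt_min (by positivity) (by positivity)
  have hβ0 : ∀ k, 0 < β k := fun k => lt_of_lt_of_le (by positivity) (hβl k)
  have hDβt : 1 ≤ U * (D * βt) := by
    rw [hU, one_div, ← div_eq_inv_mul, le_div_iff₀ hm, one_mul, hβt,
      mul_min_of_nonneg _ _ hD.le, mul_div_cancel₀ _ hD.ne']
    refine min_le_min (by linarith) ?_
    rw [mul_one_div, div_le_div_iff₀ hκ0 hLG, one_mul]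
    exact hκD.trans ((mul_le_mul_of_nonneg_right (le_max_left _ _) hD.le).trans
      (mul_comm _ _).le)
  have hβL : ∀ k, 5 * ((L + Ln) * β k) ≤ 1 := fun k => by
    have h := (hβm k).trans ((min_le_left _ _).trans (min_le_left _ _))
    rw [le_div_iff₀ (by positivity)] at h
    linarith
  have htraj := hp.ae_trajectory hD (fun k => (hβ0 k).le)
    (fun k => (hβm k).trans ((min_le_left _ _).trans (min_le_right _ _)))
    (fun k => (hβm k).trans (min_le_right _ _)) hx₀ hrun hsg
  have herr : ∀ᵐ ω ∂P, ∀ k, DRSGD.consensusErr (x k ω) ≤ B / c₁ * (D * β k) := by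
    filter_upwards [htraj] with ω hω k
    have h1 := DRSGD.le_of_linear_contraction (B := B) (p := p)
      (e := fun k => DRSGD.consensusErr (x k ω)) hB hq0 hρq (abs_nonneg c₂) hp1 hD hβt0
      (fun k => DRSGD.consensusErr_nonneg _)
      ((hp.consensusErr_le (hω 0).1).trans (by linarith [hp.δ₁_le_const])) (fun k => (hω k).2)
      (fun k => (hβu k).trans (by gcongr; exact le_abs_self c₂)) k
    refine h1.trans ?_
    rw [div_mul_eq_mul_div, le_div_iff₀ hc₁]
    have h2 := mul_le_mul_of_nonneg_left (hβl k) (mul_nonneg hB0 hD.le)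
    calc _ = B * D * (c₁ * βt / ((k : ℝ) + 1) ^ p) := by ring
      _ ≤ _ := by linarith
  have herr2 : ∀ᵐ ω ∂P, ∀ k, DRSGD.consensusErr (x k ω) ^ 2 ≤ C₀ * D ^ 2 * β k ^ 2 := by
    filter_upwards [herr] with ω hω k
    refine (pow_le_pow_left₀ (DRSGD.consensusErr_nonneg _) (hω k) 2).trans (le_of_eq ?_)
    rw [hC₀]; ring
  have herr2' : ∀ᵐ ω ∂P, ∀ k, DRSGD.consensusErr (x (k + 1) ω) ^ 2 ≤ C₀ * D ^ 2 * β k ^ 2 := by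
    filter_upwards [herr2] with ω hω k
    refine (hω (k + 1)).trans (mul_le_mul_of_nonneg_left ?_ (by positivity))
    exact pow_le_pow_left₀ (hβ0 _).le (hanti k.le_succ) 2
  have hxN : ∀ k, ∀ᵐ ω ∂P, x k ω ∈ DRSGD.consensusRegion n d r δ₁ δ₂ := fun k => by
    filter_upwards [htraj] with ω hω using (hω k).1
  have hbound := hp.inf'_le hL.le hLn hβ0 hβL hf hfL hfLn hrun hsg hxN (ae_all_iff.1 herr2)
    (ae_all_iff.1 herr2') hC₀0 hC4 hT₁ hT₂
  refine ⟨?_, fun k => ?_, hbound, fun hp2 K hK => ?_⟩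
  · filter_upwards [htraj, herr2] with ω h1 h2 k
    refine ⟨(h1 k).1, ?_⟩
    rw [← DRSGD.consensusErr_sq]
    exact (h2 k).trans (by gcongr; linarith)
  · exact hp.integrable_comp_iam (φ := fun y => ‖DRSGD.riemGrad (DRSGD.average f) y‖ ^ 2)
      (hrun.measurable_x k) (hxN k) ((DRSGD.continuous_riemGrad
        (DRSGD.norm_euclGrad_average_sub_le hp.n_ne_zero hf hfL)).norm.pow 2)
  · have hlow : DRSGD.average f (DRSGD.iam x₀) - sInf (DRSGD.average f '' DRSGD.stiefel d r) ≥ 0 :=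
      sub_nonneg.2 (csInf_le ((DRSGD.isCompact_stiefel d r).image
        (DRSGD.differentiable_average hf).continuous).bddBelow
        ⟨_, (DRSGD.isIAM_iam (DRSGD.stiefel_nonempty hrd)).1, rfl⟩)
    simp only [hp2, ← Real.sqrt_eq_rpow] at hβl hβu
    have hT₁0 : 0 ≤ DRSGD.T₁ r α C := (sq_nonneg _).trans hT₁
    have hT₂0 : 0 ≤ DRSGD.T₂ α C := le_trans (by positivity) hT₂
    have h := DRSGD.sum_stepsize_bound (Q₂ := (L + Ln) * Ξ ^ 2 / n)
      (Q₃ := C * D ^ 2 * (L + Ln) ^ 2) (Q₃' := DRSGD.T₁ r α C * D ^ 4)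
      (Q₄ := DRSGD.T₂ α C * (L + Ln) * D ^ 4) hc₁ hβt0 hlow
      (by positivity) (by positivity) (by positivity) (by positivity) hβl hβu hK
    have e : 3 / 2 * ((L + Ln) * Ξ ^ 2 / n) = 3 * (L + Ln) * Ξ ^ 2 / (2 * n) := by ring
    rw [e] at h
    exact (hbound K).trans h
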